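/- Let $k$ be an algebraically closed field and let $\mathcal A$ be a $k$-linear abelian category which is Ext-finite (all $\operatorname{Ext}^i(X,Y)$ are finite-dimensional over $k$), hereditary ($\operatorname{Ext}^2(X,Y)=0$ for all $X,Y$) and satisfies Serre duality, i.e. $D^b(\mathcal A)$ has a Serre functor: an auto-equivalence $S$ with isomorphisms $\operatorname{Hom}(X,Y)\cong\operatorname{Hom}(Y,SX)^*$ natural in $X$ and $Y$. Write $\tau=S[-1]$ for the Auslander–Reiten translation on $D^b(\mathcal A)$. Let $\mathcal K$ be a tube in $D^b(\mathcal A)$, that is, a component of the Auslander–Reiten quiver of $D^b(\mathcal A)$ which is isomorphic, as a translation quiver, to $\mathbb Z A_\infty/\langle\tau^r\rangle$ for some $r\ge 1$. Then: 1. $\mathcal K$ is generalized standard: $\operatorname{rad}^\infty(X,Y)=\bigcap_{n\ge 0}\operatorname{rad}^n(X,Y)=0$ for all $X,Y\in\mathcal K$, where $\operatorname{rad}$ is the radical of the category $D^b(\mathcal A)$. 2. $\mathcal K$ is convex: if $X_0,X_1,\dots,X_n$ are indecomposable objects of $D^b(\mathcal A)$ with $\operatorname{Hom}(X_i,X_{i+1})\neq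 0$ for $0\le i<n$, and $X_0,X_n\in\mathcal K$, then $X_i\in\mathcal K$ for all $i$. 3. There is a $\tau$-invariant t-structure on $D^b(\mathcal A)$ whose heart $\mathcal H$ is a hereditary abelian category containing $\mathcal K$, such that the peripheral objects of $\mathcal K$ are simple objects of $\mathcal H$. Here a t-structure is $\tau$-invariant if $D^{\le 0}$ and $D^{\ge 0}$ (hence also $\mathcal H$) are invariant under $\tau$, and an indecomposable object $X$ is peripheral if the middle term $M$ of the Auslander–Reiten triangle $\tau X\to M\to X\to(\tau X)[1]$ is indecomposable. -/

import Mathlib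

open CategoryTheory Limits Pretriangulated Triangulated

universe w t v u

namespace Tubes

section Heart

variable {C : Type u} [Category.{v} C] [Preadditive C] [HasZeroObject C] [HasShift C ℤ]
  [∀ n : ℤ, (shiftFunctor C n).Additive] [Pretriangulated C]

/-- The heart contains the zero object. -/
instance heart_containsZero (t : TStructure C) : t.heart.ContainsZero where
  exists_zero := by
    obtain ⟨Z, h0⟩ := HasZeroObject.zero (C := C)
    refine ⟨Z, h0, ?_⟩
    rw [TStructure.mem_heart_iff]
    constructor
    · rw [t.isLE_iff_orthogonal 0 1 (by lia)]
      intro Y f _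
      exact h0.eq_of_src _ _
    · rw [t.isGE_iff_orthogonal (-1) 0 (by lia)]
      intro Y f _
      exact h0.eq_of_tgt _ _

/-- The heart is closed under extensions. -/
theorem heart_of_distTriang (t : TStructure C) (T : Triangle C) (hT : T ∈ distTriang C)
    (h₁ : t.heart T.obj₁) (h₃ : t.heart T.obj₃) : t.heart T.obj₂ := by
  rw [TStructure.mem_heart_iff] at *
  exact ⟨t.isLE₂ T hT 0 h₁.1 h₃.1, t.isGE₂ T hT 0 h₁.2 h₃.2⟩

/-- The heart is closed under finite products. -/
instance heart_isClosedUnderFiniteProducts (t : TStructure C) :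
    t.heart.IsClosedUnderFiniteProducts := by
  have : t.heart.IsClosedUnderBinaryProducts := by
    refine ⟨?_⟩
    rintro X ⟨p⟩
    refine t.heart.prop_of_iso ?_ (heart_of_distTriang t _
      (binaryProductTriangle_distinguished _ _)
      (p.prop_diag_obj (.mk .left)) (p.prop_diag_obj (.mk .right)))
    exact IsLimit.conePointUniqueUpToIso (prodIsProd _ _)
      ((IsLimit.postcomposeHomEquiv (diagramIsoPair p.diag) _).2 p.isLimit)
  exact ObjectProperty.IsClosedUnderFiniteProducts.mk'

/-- There are no negative extensions between objects of the heart. -/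
theorem heart_hom_shift_eq_zero (t : TStructure C) ⦃X Y : t.heart.FullSubcategory⦄ ⦃n : ℤ⦄
    (f : t.heart.ι.obj X ⟶ (t.heart.ι.obj Y)⟦n⟧) (hn : n < 0) : f = 0 := by
  have hX : t.IsLE (t.heart.ι.obj X) 0 := ((t.mem_heart_iff _).1 X.property).1
  have hY : t.IsGE (t.heart.ι.obj Y) 0 := ((t.mem_heart_iff _).1 Y.property).2
  exact t.zero_of_isLE_of_isGE f 0 (-n) (by lia) hX (t.isGE_shift _ 0 n (-n))

/-- Every morphism of the heart is admissible. -/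
theorem heart_admissible (t : TStructure C) :
    AbelianSubcategory.admissibleMorphism t.heart.ι = ⊤ := by
  ext X₁ X₂ f₁
  simp only [MorphismProperty.top_apply, iff_true]
  intro X₃ f₂ f₃ hT
  obtain ⟨h₁, h₁'⟩ : t.IsLE (t.heart.ι.obj X₁) 0 ∧ t.IsGE (t.heart.ι.obj X₁) 0 :=
    (t.mem_heart_iff _).1 X₁.property
  obtain ⟨h₂, h₂'⟩ : t.IsLE (t.heart.ι.obj X₂) 0 ∧ t.IsGE (t.heart.ι.obj X₂) 0 :=
    (t.mem_heart_iff _).1 X₂.property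
  have a₁ : t.IsLE ((t.heart.ι.obj X₁)⟦(1 : ℤ)⟧) (-1) := t.isLE_shift _ 0 1 (-1)
  have a₂ : t.IsGE ((t.heart.ι.obj X₁)⟦(1 : ℤ)⟧) (-1) := t.isGE_shift _ 0 1 (-1)
  have a₃ : t.IsLE ((t.heart.ι.obj X₁)⟦(1 : ℤ)⟧) 0 := t.isLE_of_le _ (-1) 0
  have a₄ : t.IsGE (t.heart.ι.obj X₂) (-1) := t.isGE_of_ge _ (-1) 0
  have hle : t.IsLE X₃ 0 := t.isLE₂ _ (rot_of_distTriang _ hT) 0 h₂ a₃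
  have hge : t.IsGE X₃ (-1) := t.isGE₂ _ (rot_of_distTriang _ hT) (-1) a₄ a₂
  obtain ⟨X, Y, hX, hY, f, g, h, hT'⟩ := t.exists_triangle X₃ (-1) 0 (by lia)
  have hX1 : t.IsLE X (-1) := ⟨hX⟩
  have hY1 : t.IsGE Y 0 := ⟨hY⟩
  have b₁ : t.IsLE (X⟦(1 : ℤ)⟧) (-2) := t.isLE_shift _ (-1) 1 (-2)
  have b₂ : t.IsGE (Y⟦(-1 : ℤ)⟧) 1 := t.isGE_shift _ 0 (-1) 1
  have b₃ : t.IsLE (X⟦(1 : ℤ)⟧) 0 := t.isLE_of_le _ (-2) 0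
  have b₄ : t.IsGE (Y⟦(-1 : ℤ)⟧) (-1) := t.isGE_of_ge _ (-1) 1
  have hY2 : t.IsLE Y 0 := t.isLE₂ _ (rot_of_distTriang _ hT') 0 hle b₃
  have hX2 : t.IsGE X (-1) := t.isGE₂ _ (inv_rot_of_distTriang _ hT') (-1) b₄ hge
  have c₁ : t.IsLE (X⟦(-1 : ℤ)⟧) 0 := t.isLE_shift _ (-1) (-1) 0
  have c₂ : t.IsGE (X⟦(-1 : ℤ)⟧) 0 := t.isGE_shift _ (-1) (-1) 0
  let e : (X⟦(-1 : ℤ)⟧)⟦(1 : ℤ)⟧ ≅ X := (shiftEquiv C (1 : ℤ)).counitIso.app X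
  refine ⟨⟨X⟦(-1 : ℤ)⟧, (t.mem_heart_iff _).2 ⟨c₁, c₂⟩⟩,
    ⟨Y, (t.mem_heart_iff _).2 ⟨hY2, hY1⟩⟩, e.hom ≫ f, g, h ≫ e.inv⟦(1 : ℤ)⟧', ?_⟩
  refine isomorphic_distinguished _ hT' _ (Triangle.isoMk _ _ e (Iso.refl _) (Iso.refl _) ?_ ?_ ?_)
  · exact Category.comp_id _
  · exact (Category.comp_id g).trans (Category.id_comp g).symm
  · have he : e.inv⟦(1 : ℤ)⟧' ≫ e.hom⟦(1 : ℤ)⟧' = 𝟙 _ := by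
      rw [← Functor.map_comp, e.inv_hom_id, CategoryTheory.Functor.map_id]
    have : (h ≫ e.inv⟦(1 : ℤ)⟧') ≫ e.hom⟦(1 : ℤ)⟧' = 𝟙 _ ≫ h := by
      rw [Category.assoc, he, Category.comp_id, Category.id_comp]
    exact this

/-- The heart of a t-structure on a triangulated category is an abelian category. -/
noncomputable instance heart_abelian [IsTriangulated C] (t : TStructure C) :
    Abelian t.heart.FullSubcategory :=
  AbelianSubcategory.abelian t.heart.ι (heart_hom_shift_eq_zero t) (heart_admissible t)

end Heart

section AbelianCategories

/-- An abelian category is hereditary if all its `Ext²` vanish. -/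
def IsHereditary (A : Type u) [Category.{v} A] [Abelian A] : Prop :=
  haveI := HasExt.standard A
  ∀ X Y : A, Subsingleton (Abelian.Ext.{max u v} X Y 2)

/-- A `k`-linear abelian category is Ext-finite if every `Extⁱ(X, Y)`, `i ≥ 0`, is
finite-dimensional over `k`. -/
def IsExtFinite (k : Type t) [Field k] (A : Type u) [Category.{v} A] [Abelian A] [Linear k A] :
    Prop :=
  haveI := HasExt.standard A
  ∀ (X Y : A) (i : ℕ), Module.Finite k (Abelian.Ext.{max u v} X Y i)

end AbelianCategories

section LinearCategories

variable (k : Type t) [Field k] {C : Type u} [Category.{v} C] [Preadditive C] [Linear k C]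

/-- The (Jacobson) radical `rad(X, Y)` of a `k`-linear category: the morphisms `f : X ⟶ Y` such
that `1 - f ≫ g` is invertible for every `g : Y ⟶ X`. -/
def rad (X Y : C) : Submodule k (X ⟶ Y) where
  carrier := {f | ∀ g : Y ⟶ X, IsIso (𝟙 X - f ≫ g)}
  zero_mem' g := by
    rw [zero_comp, sub_zero]
    infer_instance
  add_mem' := by
    intro f₁ f₂ h₁ h₂ g
    have i₁ := h₁ g
    have i₂ := h₂ (g ≫ inv (𝟙 X - f₁ ≫ g))
    have : 𝟙 X - (f₁ + f₂) ≫ g =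
        (𝟙 X - f₂ ≫ g ≫ inv (𝟙 X - f₁ ≫ g)) ≫ (𝟙 X - f₁ ≫ g) := by
      rw [Preadditive.sub_comp, Category.assoc, Category.assoc, IsIso.inv_hom_id,
        Category.comp_id, Category.id_comp, Preadditive.add_comp]
      abel
    rw [this]
    infer_instance
  smul_mem' := by
    intro c f hf g
    have := hf (c • g)
    rwa [Linear.comp_smul, ← Linear.smul_comp] at this

/-- The powers of the radical: `rad⁰(X, Y) = Hom(X, Y)`, and `radⁿ⁺¹(X, Y)` consists of the sums of
compositions `f ≫ g` with `f ∈ radⁿ(X, Z)` and `g ∈ rad(Z, Y)`, where `Z` is any object. -/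
def radPow : ℕ → ∀ X Y : C, Submodule k (X ⟶ Y)
  | 0, _, _ => ⊤
  | n + 1, X, Y => Submodule.span k
      {h | ∃ (Z : C) (f : X ⟶ Z) (g : Z ⟶ Y), f ∈ radPow n X Z ∧ g ∈ rad k Z Y ∧ f ≫ g = h}

/-- The infinite radical: the intersection of all powers of the radical. -/
def infRad (X Y : C) : Submodule k (X ⟶ Y) := ⨅ n : ℕ, radPow k n X Y

/-- The number of arrows from `X` to `Y` in the Auslander-Reiten quiver: the dimension of the
space of irreducible morphisms `rad(X, Y) / rad²(X, Y)`. -/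
noncomputable def numArrows (X Y : C) : ℕ :=
  Module.finrank k (rad k X Y ⧸ (radPow k 2 X Y).submoduleOf (rad k X Y))

/-- `X` and `Y` are indecomposable and are either isomorphic (that is, represent the same vertex
of the Auslander-Reiten quiver) or joined by an arrow from `X` to `Y`. -/
def ARLinked [HasBinaryBiproducts C] (X Y : C) : Prop :=
  Indecomposable X ∧ Indecomposable Y ∧ (Nonempty (X ≅ Y) ∨ numArrows k X Y ≠ 0)

/-- `K` is the class of indecomposable objects lying in a connected component of the
Auslander-Reiten quiver. -/
def IsARComponent [HasBinaryBiproducts C] (K : ObjectProperty C) : Prop :=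
  ∃ X : C, Indecomposable X ∧ ∀ Y : C, K Y ↔ Relation.EqvGen (ARLinked k) X Y

/-- A component is generalized standard if the infinite radical of the ambient category vanishes
on it. -/
def IsGeneralizedStandard (K : ObjectProperty C) : Prop :=
  ∀ X Y : C, K X → K Y → infRad k X Y = ⊥

/-- A Serre functor on a `k`-linear category: an auto-equivalence `S` with isomorphisms
`Hom(X, Y) ≅ Hom(Y, S X)*` of vector spaces which are natural in `X` and `Y`. -/
structure SerreFunctor (k : Type t) [Field k] (C : Type u) [Category.{v} C] [Preadditive C]
    [Linear k C] where
  /-- the auto-equivalence -/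
  S : C ≌ C
  /-- the duality isomorphisms -/
  duality (X Y : C) : (X ⟶ Y) ≃ₗ[k] Module.Dual k (Y ⟶ S.functor.obj X)
  naturality_left {X' X Y : C} (f : X' ⟶ X) (h : X ⟶ Y) (φ : Y ⟶ S.functor.obj X') :
    duality X' Y (f ≫ h) φ = duality X Y h (φ ≫ S.functor.map f)
  naturality_right {X Y Y' : C} (h : X ⟶ Y) (g : Y ⟶ Y') (φ : Y' ⟶ S.functor.obj X) :
    duality X Y' (h ≫ g) φ = duality X Y h (g ≫ φ)

end LinearCategories

section Paths

variable {C : Type u} [Category.{v} C] [Preadditive C] [HasBinaryBiproducts C]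

/-- A path `X₀ → ⋯ → Xₙ`: a sequence of indecomposable objects with
`Hom(Xᵢ, Xᵢ₊₁) ≠ 0` for all `i`. -/
def IsPath (n : ℕ) (X : Fin (n + 1) → C) : Prop :=
  (∀ i, Indecomposable (X i)) ∧ ∀ i : Fin n, ∃ f : X i.castSucc ⟶ X i.succ, f ≠ 0

/-- `K` is convex: every path which starts and ends in `K` lies entirely in `K`. -/
def IsConvex (K : ObjectProperty C) : Prop :=
  ∀ (n : ℕ) (X : Fin (n + 1) → C), IsPath n X → K (X 0) → K (X (Fin.last n)) → ∀ i, K (X i)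

end Paths

section TubeQuiver

/-- The translation on the vertices of the translation quiver `ℤA_∞ / ⟨τ^r⟩`. The vertices of
`ℤA_∞` are the pairs `(i, l)` with `i : ℤ` and `l : ℕ`, and `τ (i, l) = (i - 1, l)`. -/
def tubeTranslation (r : ℕ) (x : ZMod r × ℕ) : ZMod r × ℕ := (x.1 - 1, x.2)

/-- The number of arrows from `x` to `y` in the translation quiver `ℤA_∞ / ⟨τ^r⟩`. The arrows of
`ℤA_∞` are `(i, l) ⟶ (i, l + 1)` and `(i, l + 1) ⟶ (i + 1, l)`, one for each `i : ℤ`, `l : ℕ`. -/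
def tubeArrows (r : ℕ) (x y : ZMod r × ℕ) : ℕ :=
  if y = (x.1, x.2 + 1) ∨ (y.1 = x.1 + 1 ∧ x.2 = y.2 + 1) then 1 else 0

end TubeQuiver

section TriangulatedCategories

variable {k : Type t} [Field k] {C : Type u} [Category.{v} C] [Preadditive C] [Linear k C]
  [HasZeroObject C] [HasShift C ℤ] [∀ n : ℤ, (shiftFunctor C n).Additive] [Pretriangulated C]

/-- The Auslander-Reiten translation `τ = S[-1]`, where `S` is the Serre functor. -/
noncomputable def SerreFunctor.tau (S : SerreFunctor k C) (X : C) : C :=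
  (S.S.functor.obj X)⟦(-1 : ℤ)⟧

/-- An Auslander-Reiten triangle `X ⟶ Y ⟶ Z ⟶ X⟦1⟧`: a distinguished triangle with `X` and `Z`
indecomposable and nonzero third morphism, such that every morphism `W ⟶ Z` which is not a split
epimorphism factors through `Y ⟶ Z`. -/
def IsARTriangle (T : Triangle C) : Prop :=
  T ∈ distTriang C ∧ Indecomposable T.obj₁ ∧ Indecomposable T.obj₃ ∧ T.mor₃ ≠ 0 ∧
    ∀ (W : C) (f : W ⟶ T.obj₃), ¬ IsSplitEpi f → ∃ g : W ⟶ T.obj₂, g ≫ T.mor₂ = f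

/-- An indecomposable object `X` is peripheral if the middle term `M` of the Auslander-Reiten
triangle `τ X ⟶ M ⟶ X ⟶ (τ X)⟦1⟧` is indecomposable. -/
def IsPeripheral (S : SerreFunctor k C) (X : C) : Prop :=
  ∃ (M : C) (f : S.tau X ⟶ M) (g : M ⟶ X) (h : X ⟶ (S.tau X)⟦(1 : ℤ)⟧),
    IsARTriangle (Triangle.mk f g h) ∧ Indecomposable M

/-- `K` is a tube of rank `r`: a component of the Auslander-Reiten quiver which is isomorphic, as
a translation quiver, to `ℤA_∞ / ⟨τ^r⟩`. The isomorphism is given by a complete and irredundant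
system of representatives `V x`, one for each vertex `x`, of the objects of `K`. -/
def IsTubeOfRank (S : SerreFunctor k C) (K : ObjectProperty C) (r : ℕ) : Prop :=
  0 < r ∧ IsARComponent k K ∧ ∃ V : ZMod r × ℕ → C,
    (∀ x, K (V x)) ∧
    (∀ X, K X → ∃ x, Nonempty (X ≅ V x)) ∧
    (∀ x y, Nonempty (V x ≅ V y) → x = y) ∧
    (∀ x, Nonempty (S.tau (V x) ≅ V (tubeTranslation r x))) ∧
    ∀ x y, numArrows k (V x) (V y) = tubeArrows r x y

/-- `K` is a tube, that is, a tube of rank `r` for some `r > 0`. -/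
def IsTube (S : SerreFunctor k C) (K : ObjectProperty C) : Prop :=
  ∃ r : ℕ, IsTubeOfRank S K r

/-- A t-structure is `τ`-invariant if `D^{≤ 0}` and `D^{≥ 0}`, and hence also the heart, are
invariant under `τ`. -/
def IsTauInvariant (S : SerreFunctor k C) (T : TStructure C) : Prop :=
  ∀ X : C, (T.le 0 X ↔ T.le 0 (S.tau X)) ∧ (T.ge 0 X ↔ T.ge 0 (S.tau X))

end TriangulatedCategories

end Tubes

/-! The t-structure comes from paths. Any two objects of the tube `K` are joined by a path of
nonzero morphisms, and Serre duality gives a nonzero morphism from `Y` to `S Y = (τ Y)[1]`; hence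
the indecomposables reachable from `K` are closed under `[1]`. Every object is the direct sum of a
part with reachable summands and a part without, so these two classes form a t-structure with split
truncation triangles (`exists_tStructure`). It is `τ`-invariant because `K` is. Since the abelian
category is hereditary, every indecomposable of the derived category is a shifted object of it, and
this yields a degree which never drops along nonzero morphisms and is raised by one by `[1]`. So no
path leads from `Z` to `Z[-1]`, and every path between objects of `K` stays in the heart `H`
(`heart_of_path`).

In `H`, `Ext¹(Z, X)` is dual to `Hom(X, τ Z)`, and `τ` is an auto-equivalence of `H`. As `τ`
preserves monomorphisms, `Ext¹(-, L)` turns them into surjections, which makes `H` hereditary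
(`isHereditary_heart`). `ARDuality` records what is needed of `H`; the next steps are abstract.

The tube provides a `τ`-periodic indecomposable `E`. Among the nonzero periodic objects that are
both quotients and subobjects of members of the `τ`-orbit of `E`, take an indecomposable `I` of
minimal dimension. An eigenvector of the action of a power of `τ` on `Hom(I, τ^m I)` has a periodic
image, so by minimality it is an isomorphism; it follows that all nonzero morphisms between the
objects `τ^i I` are isomorphisms. This gives bricks `S a` with `τ (S (a + 1)) ≅ S a`
(`SimpleSystem`), not yet known to be simple. Iterated extensions yield objects `V a n` with socle
`S a` and top `S (a + n)`, uniserial relative to the bricks. Duality decides when morphisms extend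
or lift along these extensions; alternating the two shows that an indecomposable through which a
nonzero morphism from a brick to some `V a n` factors is itself uniserial
(`isUniserial_of_comp_ne_zero`).

The crux is `isUniserial_of_ne_zero`: an indecomposable with nonzero morphisms from a brick and to a
brick is uniserial. A counterexample leads to a critical object of minimal total dimension, which
maps onto uniserial objects of every length; this is incompatible with finite-dimensional Hom
spaces. Consequently `E` is uniserial and the uniserial objects are convex in `H`.

The almost split maps of the uniserial objects remain almost split in the derived category, so the
uniserial objects make up a whole component, namely `K`. Convexity of `K` follows. A peripheral
object has length one, hence is a brick, and it is simple: an indecomposable of `H` with a nonzero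
morphism to it is reachable from `K`, so lies in `K` by convexity. Finally, by induction on the
length of the target, a morphism of the infinite radical factors through arbitrarily long composites
of the quotient maps `π`, and these kill every morphism from a uniserial object of bounded length
(`infRad_eq_zero`). -/

namespace Tubes

set_option linter.unusedSectionVars false

/-! ### Endomorphisms of indecomposable objects and direct sum decompositions. -/

section LocalEnd

variable {C : Type u} [Category.{v} C] [Preadditive C] [HasBinaryBiproducts C]

theorem eq_zero_or_eq_one_of_splitting {X : C} (hX : Indecomposable X) {e : X ⟶ X} {Y Z : C}
    (i : Y ⟶ X) (p : X ⟶ Y) (j : Z ⟶ X) (q : X ⟶ Z) (hip : i ≫ p = 𝟙 Y) (hpi : p ≫ i = e)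
    (hjq : j ≫ q = 𝟙 Z) (hqj : q ≫ j = 𝟙 X - e) : e = 0 ∨ e = 𝟙 X := by
  have he : e ≫ e = e := by rw [← hpi]; simp [reassoc_of% hip]
  have hiq : i ≫ q = 0 := by
    have : i ≫ q = (i ≫ e) ≫ (𝟙 X - e) ≫ q := by
      rw [← hqj, ← hpi]; simp [reassoc_of% hip, hjq]
    rw [this]; simp [Preadditive.sub_comp, Preadditive.comp_sub, reassoc_of% he]
  have hjp : j ≫ p = 0 := by
    have : j ≫ p = (j ≫ (𝟙 X - e)) ≫ e ≫ p := by
      rw [← hqj, ← hpi]; simp [hip, reassoc_of% hjq]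
    rw [this]; simp [Preadditive.sub_comp, Preadditive.comp_sub, reassoc_of% he]
  let iso : X ≅ Y ⊞ Z :=
    { hom := biprod.lift p q
      inv := biprod.desc i j
      hom_inv_id := by rw [biprod.lift_desc, hpi, hqj]; abel
      inv_hom_id := by ext <;> simp [hip, hiq, hjp, hjq] }
  rcases hX.2 Y Z iso with h | h
  · left; rw [← hpi, h.eq_of_tgt p 0, zero_comp]
  · right
    have := hqj
    rw [h.eq_of_tgt q 0, zero_comp] at this
    exact (sub_eq_zero.1 this.symm).symm

variable (C) in
/-- Indecomposable objects have only the trivial idempotent endomorphisms. -/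
class HasTrivialIdempotents : Prop where
  eq_zero_or_eq_one {X : C} (hX : Indecomposable X) (e : X ⟶ X) (he : e ≫ e = e) : e = 0 ∨ e = 𝟙 X

theorem eq_zero_or_eq_one_of_idempotent [HasTrivialIdempotents C] {X : C} (hX : Indecomposable X)
    (e : X ⟶ X) (he : e ≫ e = e) : e = 0 ∨ e = 𝟙 X :=
  HasTrivialIdempotents.eq_zero_or_eq_one hX e he

instance [IsIdempotentComplete C] : HasTrivialIdempotents C where
  eq_zero_or_eq_one {X} hX e he := by
    obtain ⟨Y, i, p, hip, hpi⟩ := IsIdempotentComplete.idempotents_split X e he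
    obtain ⟨Z, j, q, hjq, hqj⟩ := IsIdempotentComplete.idempotents_split X (𝟙 X - e) (by
      simp [Preadditive.sub_comp, Preadditive.comp_sub, he])
    exact eq_zero_or_eq_one_of_splitting hX i p j q hip hpi hjq hqj

variable {k : Type t} [Field k] [IsAlgClosed k] [Linear k C]

/-- Over an algebraically closed field, every endomorphism of an indecomposable object is the sum
of a scalar and a nilpotent endomorphism. -/
theorem exists_isNilpotent_sub_smul [HasTrivialIdempotents C] {X : C} (hX : Indecomposable X)
    [Module.Finite k (X ⟶ X)] (e : End X) : ∃ c : k, IsNilpotent (e - c • (1 : End X)) := by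
  have : Module.Finite k (End X) := inferInstanceAs (Module.Finite k (X ⟶ X))
  have : Nontrivial (End X) := ⟨0, 1, fun h ↦ hX.1 ((IsZero.iff_id_eq_zero X).2 h.symm)⟩
  have hint : IsIntegral k e := Algebra.IsIntegral.isIntegral e
  obtain ⟨c, hc⟩ := IsAlgClosed.exists_root (minpoly k e)
    (ne_of_gt (minpoly.degree_pos hint))
  obtain ⟨q, hq, hq'⟩ := Polynomial.exists_eq_pow_rootMultiplicity_mul_and_not_dvd
    (minpoly k e) (minpoly.ne_zero hint) c
  set m := (minpoly k e).rootMultiplicity c with hm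
  have hmpos : 0 < m := (Polynomial.rootMultiplicity_pos (minpoly.ne_zero hint)).2 hc
  have hcop : IsCoprime ((Polynomial.X - Polynomial.C c) ^ m) q := by
    apply IsCoprime.pow_left
    exact (Irreducible.coprime_iff_not_dvd (Polynomial.irreducible_X_sub_C c)).2 hq'
  obtain ⟨a, b, hab⟩ := hcop
  set P := (Polynomial.X - Polynomial.C c) ^ m with hP
  have h0 : Polynomial.aeval e P * Polynomial.aeval e q = 0 := by
    rw [← map_mul, ← hq, minpoly.aeval]
  have h1 : Polynomial.aeval e a * Polynomial.aeval e P +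
      Polynomial.aeval e b * Polynomial.aeval e q = 1 := by
    rw [← map_mul, ← map_mul, ← map_add, hab, map_one]
  have hcomm : ∀ p₁ p₂ : Polynomial k, Polynomial.aeval e p₁ * Polynomial.aeval e p₂ =
      Polynomial.aeval e p₂ * Polynomial.aeval e p₁ := fun p₁ p₂ ↦ by
    rw [← map_mul, mul_comm, map_mul]
  have hev : Polynomial.aeval e P = (e - c • (1 : End X)) ^ m := by
    simp [hP, Algebra.algebraMap_eq_smul_one]
  refine ⟨c, m, ?_⟩
  rw [← hev]
  set f := Polynomial.aeval e a * Polynomial.aeval e P with hf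
  set g := Polynomial.aeval e b * Polynomial.aeval e q with hg
  have hfg : f * g = 0 := by
    rw [hf, hg, mul_assoc, hcomm b q, ← mul_assoc (Polynomial.aeval e P), h0, zero_mul, mul_zero]
  have hff : f * f = f := by
    have := congrArg (f * ·) h1
    simpa [mul_add, hfg] using this
  -- The Bézout relation makes `f` and `g` complementary idempotents, and one of them is trivial. If
  -- `f = 1`, then `q` annihilates `e`, although its degree is smaller than that of the minimal
  -- polynomial by `m > 0`.
  rcases eq_zero_or_eq_one_of_idempotent hX f hff with h | h
  · have hg1 : g = 1 := by simpa [show f = 0 from h] using h1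
    calc Polynomial.aeval e P = Polynomial.aeval e P * g := by rw [hg1, mul_one]
      _ = 0 := by rw [hg, hcomm b q, ← mul_assoc, h0, zero_mul]
  · exfalso
    have hq0 : Polynomial.aeval e q = 0 := by
      calc Polynomial.aeval e q = f * Polynomial.aeval e q := by
            rw [show f = 1 from h, one_mul]
        _ = 0 := by rw [hf, mul_assoc, h0, mul_zero]
    have hqne : q ≠ 0 := by rintro rfl; exact hq' (dvd_zero _)
    have hdvd := minpoly.dvd k e hq0
    have hle := Polynomial.degree_le_of_dvd hdvd hqne
    have hd : (minpoly k e).natDegree = m + q.natDegree := by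
      rw [hq, Polynomial.natDegree_mul (pow_ne_zero _ (Polynomial.X_sub_C_ne_zero c)) hqne,
        Polynomial.natDegree_pow, Polynomial.natDegree_X_sub_C, mul_one]
    have := Polynomial.natDegree_le_natDegree hle
    omega

theorem isIso_of_isNilpotent_sub_smul {X : C} {e : X ⟶ X} {c : k} (hc : c ≠ 0)
    (h : IsNilpotent ((show End X from e) - c • (1 : End X))) : IsIso e := by
  rw [← isUnit_iff_isIso]
  have hu : IsUnit (c • (1 : End X)) := by
    rw [← Algebra.algebraMap_eq_smul_one]; exact (IsUnit.mk0 c hc).map _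
  have hcomm : Commute ((show End X from e) - c • (1 : End X)) (c • (1 : End X)) :=
    ((Commute.one_right _).smul_right c)
  have := h.isUnit_add_left_of_commute hu hcomm
  simpa using this

variable (k) in
theorem isIso_or_isNilpotent [HasTrivialIdempotents C] {X : C} (hX : Indecomposable X)
    [Module.Finite k (X ⟶ X)] (e : X ⟶ X) : IsIso e ∨ IsNilpotent (show End X from e) := by
  obtain ⟨c, hc⟩ := exists_isNilpotent_sub_smul (k := k) hX e
  by_cases h : c = 0
  · right; simpa [h] using hc
  · left; exact isIso_of_isNilpotent_sub_smul h hc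

/-- A nonzero retract of an indecomposable object is isomorphic to it. -/
theorem isIso_of_retract [HasTrivialIdempotents C] {X Y : C} (hX : Indecomposable X)
    (i : Y ⟶ X) (r : X ⟶ Y) (hir : i ≫ r = 𝟙 Y)
    (hY : ¬ IsZero Y) : IsIso i ∧ IsIso r := by
  rcases eq_zero_or_eq_one_of_idempotent hX (r ≫ i) (by simp [reassoc_of% hir]) with h | h
  · exfalso; apply hY
    rw [IsZero.iff_id_eq_zero]
    calc 𝟙 Y = (i ≫ r) ≫ (i ≫ r) := by rw [hir, Category.comp_id]
      _ = i ≫ (r ≫ i) ≫ r := by simp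
      _ = 0 := by rw [h]; simp
  · exact ⟨⟨r, hir, h⟩, ⟨i, h, hir⟩⟩

variable (k) in
/-- To prove a property of all objects, it suffices to prove it for zero objects and for
indecomposable objects, and to show that it is stable under direct sums. -/
theorem induction_indecomposable [HasZeroObject C] (hfin : ∀ X : C, Module.Finite k (X ⟶ X))
    {P : C → Prop} (hiso : ∀ X Y, (X ≅ Y) → P X → P Y) (hzero : ∀ X, IsZero X → P X)
    (hind : ∀ X, Indecomposable X → P X) (hsum : ∀ X Y, P X → P Y → P (X ⊞ Y)) (X : C) : P X := by
  induction hn : Module.finrank k (X ⟶ X) using Nat.strong_induction_on generalizing X with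
  | _ n ih =>
  by_cases h0 : IsZero X
  · exact hzero X h0
  by_cases hX : Indecomposable X
  · exact hind X hX
  have : ∃ Y Z, Nonempty (X ≅ Y ⊞ Z) ∧ ¬ IsZero Y ∧ ¬ IsZero Z := by
    by_contra! h
    exact hX ⟨h0, fun Y Z e ↦ by
      by_cases hY : IsZero Y
      · exact Or.inl hY
      · exact Or.inr (h Y Z ⟨e⟩ hY)⟩
  obtain ⟨Y, Z, ⟨e⟩, hY, hZ⟩ := this
  -- A proper retract has fewer endomorphisms: `f ↦ p ≫ f ≫ i` is injective and misses `𝟙 X`.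
  have key : ∀ (Y : C) (i : Y ⟶ X) (p : X ⟶ Y), i ≫ p = 𝟙 Y → p ≫ i ≠ 𝟙 X →
      Module.finrank k (Y ⟶ Y) < n := by
    intro Y i p hip hpi
    have := hfin X
    rw [← hn]
    let φ : (Y ⟶ Y) →ₗ[k] (X ⟶ X) :=
      { toFun := fun f ↦ p ≫ f ≫ i
        map_add' := by simp
        map_smul' := by simp }
    have hφ : Function.Injective φ := by
      intro f g hfg
      have := congrArg (fun h ↦ i ≫ h ≫ p) hfg
      simpa [φ, reassoc_of% hip, hip] using this
    rw [← LinearMap.finrank_range_of_inj hφ]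
    apply Submodule.finrank_lt
    intro htop
    have : 𝟙 X ∈ LinearMap.range φ := by rw [htop]; trivial
    obtain ⟨f, hf⟩ := this
    apply hpi
    have h1 : f = 𝟙 Y := by
      have := congrArg (fun h ↦ i ≫ h ≫ p) hf
      simpa [φ, reassoc_of% hip, hip] using this
    rw [← hf, h1]; simp [φ]
  refine hiso _ _ e.symm (hsum _ _ ?_ ?_)
  · refine ih _ (key Y (biprod.inl ≫ e.inv) (e.hom ≫ biprod.fst) (by simp) ?_) Y rfl
    intro h
    apply hZ
    rw [IsZero.iff_id_eq_zero]
    have := congrArg (fun h ↦ biprod.inr ≫ e.inv ≫ h ≫ e.hom ≫ biprod.snd) h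
    simpa using this.symm
  · refine ih _ (key Z (biprod.inr ≫ e.inv) (e.hom ≫ biprod.snd) (by simp) ?_) Z rfl
    intro h
    apply hY
    rw [IsZero.iff_id_eq_zero]
    have := congrArg (fun h ↦ biprod.inl ≫ e.inv ≫ h ≫ e.hom ≫ biprod.fst) h
    simpa using this.symm

variable (k) in
/-- A nonzero morphism has a nonzero component on some indecomposable summand of its target. -/
theorem exists_indecomposable_summand_tgt [HasZeroObject C]
    (hfin : ∀ X : C, Module.Finite k (X ⟶ X)) {G : C} (X : C) (f : G ⟶ X) (hf : f ≠ 0) :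
    ∃ (Y : C) (i : Y ⟶ X) (p : X ⟶ Y), Indecomposable Y ∧ i ≫ p = 𝟙 Y ∧ f ≫ p ≠ 0 := by
  revert f
  refine induction_indecomposable k hfin (P := fun X ↦ ∀ (f : G ⟶ X), f ≠ 0 →
    ∃ (Y : C) (i : Y ⟶ X) (p : X ⟶ Y), Indecomposable Y ∧ i ≫ p = 𝟙 Y ∧ f ≫ p ≠ 0)
    ?_ ?_ ?_ ?_ X
  · intro X X' e h f hf
    obtain ⟨Y, i, p, hY, hip, hfp⟩ := h (f ≫ e.inv) (by simpa using hf)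
    exact ⟨Y, i ≫ e.hom, e.inv ≫ p, hY, by simp [hip], by simpa using hfp⟩
  · intro X hX f hf
    exact (hf (hX.eq_of_tgt _ _)).elim
  · intro X hX f hf
    exact ⟨X, 𝟙 X, 𝟙 X, hX, by simp, by simpa using hf⟩
  · intro X X' h h' f hf
    by_cases h1 : f ≫ biprod.fst = 0
    · have h2 : f ≫ biprod.snd ≠ 0 := fun h2 ↦ hf (by ext <;> simp [h1, h2])
      obtain ⟨Y, i, p, hY, hip, hfp⟩ := h' _ h2
      exact ⟨Y, i ≫ biprod.inr, biprod.snd ≫ p, hY, by simp [hip], by simpa using hfp⟩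
    · obtain ⟨Y, i, p, hY, hip, hfp⟩ := h _ h1
      exact ⟨Y, i ≫ biprod.inl, biprod.fst ≫ p, hY, by simp [hip], by simpa using hfp⟩

variable (k) in
/-- A nonzero morphism has a nonzero component on some indecomposable summand of its source. -/
theorem exists_indecomposable_summand_src [HasZeroObject C]
    (hfin : ∀ X : C, Module.Finite k (X ⟶ X)) {G : C} (X : C) (f : X ⟶ G) (hf : f ≠ 0) :
    ∃ (Y : C) (i : Y ⟶ X) (p : X ⟶ Y), Indecomposable Y ∧ i ≫ p = 𝟙 Y ∧ i ≫ f ≠ 0 := by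
  revert f
  refine induction_indecomposable k hfin (P := fun X ↦ ∀ (f : X ⟶ G), f ≠ 0 →
    ∃ (Y : C) (i : Y ⟶ X) (p : X ⟶ Y), Indecomposable Y ∧ i ≫ p = 𝟙 Y ∧ i ≫ f ≠ 0)
    ?_ ?_ ?_ ?_ X
  · intro X X' e h f hf
    obtain ⟨Y, i, p, hY, hip, hfp⟩ := h (e.hom ≫ f) (by simpa using hf)
    exact ⟨Y, i ≫ e.hom, e.inv ≫ p, hY, by simp [hip], by simpa using hfp⟩
  · intro X hX f hf
    exact (hf (hX.eq_of_src _ _)).elim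
  · intro X hX f hf
    exact ⟨X, 𝟙 X, 𝟙 X, hX, by simp, by simpa using hf⟩
  · intro X X' h h' f hf
    by_cases h1 : biprod.inl ≫ f = 0
    · have h2 : biprod.inr ≫ f ≠ 0 := fun h2 ↦ hf (by ext <;> simp [h1, h2])
      obtain ⟨Y, i, p, hY, hip, hfp⟩ := h' _ h2
      exact ⟨Y, i ≫ biprod.inr, biprod.snd ≫ p, hY, by simp [hip], by simpa using hfp⟩
    · obtain ⟨Y, i, p, hY, hip, hfp⟩ := h _ h1
      exact ⟨Y, i ≫ biprod.inl, biprod.fst ≫ p, hY, by simp [hip], by simpa using hfp⟩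

end LocalEnd

/-! ### Short exact sequences as pairs of morphisms. -/

section Ses

variable {C : Type u} [Category.{v} C] [Abelian C]

/-- Two composable morphisms which form a short exact sequence. -/
def Ses {X Y Z : C} (i : X ⟶ Y) (p : Y ⟶ Z) : Prop :=
  ∃ w : i ≫ p = 0, (ShortComplex.mk i p w).ShortExact

namespace Ses

variable {X Y Z : C} {i : X ⟶ Y} {p : Y ⟶ Z}

theorem w (h : Ses i p) : i ≫ p = 0 := h.1

theorem mono (h : Ses i p) : Mono i := h.2.mono_f

theorem epi (h : Ses i p) : Epi p := h.2.epi_g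

theorem lift (h : Ses i p) {W : C} (x : W ⟶ Y) (hx : x ≫ p = 0) : ∃ y, y ≫ i = x :=
  have := h.mono
  ⟨h.2.exact.lift x hx, h.2.exact.lift_f x hx⟩

theorem desc (h : Ses i p) {W : C} (x : Y ⟶ W) (hx : i ≫ x = 0) : ∃ y, p ≫ y = x :=
  have := h.epi
  ⟨h.2.exact.desc x hx, h.2.exact.g_desc x hx⟩

theorem of_lift [Mono i] [Epi p] (w : i ≫ p = 0)
    (h : ∀ (W : C) (x : W ⟶ Y), x ≫ p = 0 → ∃ y, y ≫ i = x) : Ses i p := by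
  refine ⟨w, ⟨?_⟩⟩
  exact (ShortComplex.mk i p w).exact_of_f_is_kernel
    (KernelFork.IsLimit.ofι' i w fun x hx ↦ ⟨(h _ x hx).choose, (h _ x hx).choose_spec⟩)

theorem of_kernel (p : Y ⟶ Z) [Epi p] : Ses (kernel.ι p) p :=
  of_lift (kernel.condition p) fun _ x hx ↦ ⟨kernel.lift p x hx, kernel.lift_ι _ _ _⟩

theorem of_cokernel (i : X ⟶ Y) [Mono i] : Ses i (cokernel.π i) :=
  of_lift (cokernel.condition i) fun _ x hx ↦ ⟨Abelian.monoLift i x hx, Abelian.monoLift_comp _ _ _⟩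

/-- If the second morphism has a section, then the first one has a retraction. -/
theorem exists_retraction (h : Ses i p) (s : Z ⟶ Y) (hs : s ≫ p = 𝟙 Z) : ∃ r, i ≫ r = 𝟙 X := by
  obtain ⟨r, hr⟩ := h.lift (𝟙 Y - p ≫ s) (by simp [Preadditive.sub_comp, hs])
  refine ⟨r, ?_⟩
  have := h.mono
  rw [← cancel_mono i, Category.assoc, hr, Preadditive.comp_sub, reassoc_of% h.w]
  simp

end Ses

end Ses

/-! ### Abstract Auslander-Reiten duality and the construction of uniserial objects. -/

section Duality

variable (k : Type t) [Field k] {C : Type u} [Category.{v} C] [Abelian C] [Linear k C]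

/-- The functional `η` on `Hom(A, τ D)` is the class of the extension `A ⟶ B ⟶ D`: it governs the
lifting of morphisms to `D` and the extension of morphisms from `A`. -/
def IsExtClass (τ : C ⥤ C) {A B D : C} (i : A ⟶ B) (p : B ⟶ D)
    (η : Module.Dual k (A ⟶ τ.obj D)) : Prop :=
  (∀ (Y : C) (g : Y ⟶ D), (∃ l, l ≫ p = g) ↔ ∀ h : A ⟶ τ.obj Y, η (h ≫ τ.map g) = 0) ∧
    ∀ (Z : C) (h : A ⟶ Z), (∃ e, i ≫ e = h) ↔ ∀ u : Z ⟶ τ.obj D, η (h ≫ u) = 0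

variable (C) in
/-- A Hom-finite hereditary abelian category with Serre duality, where the duality is expressed by
the classes of extensions. -/
structure ARDuality where
  /-- the Auslander-Reiten translation -/
  τ : C ⥤ C
  isEquivalence : τ.IsEquivalence
  additive : τ.Additive
  linear : τ.Linear k
  finite (X Y : C) : Module.Finite k (X ⟶ Y)
  exists_class {A B D : C} {i : A ⟶ B} {p : B ⟶ D} (h : Ses i p) :
    ∃ η : Module.Dual k (A ⟶ τ.obj D), IsExtClass k τ i p η
  exists_extension (A D : C) (η : Module.Dual k (A ⟶ τ.obj D)) :
    ∃ (B : C) (i : A ⟶ B) (p : B ⟶ D), Ses i p ∧ IsExtClass k τ i p η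

namespace ARDuality

attribute [instance] isEquivalence additive linear

variable {k} (T : ARDuality k C)

/-- The obstruction to lifting is the pulled back class, whose functional is `η` evaluated on the
composites with `τ g`. When all these composites vanish, the lift exists whatever the class is.
`exists_extend` is the dual version. -/
theorem exists_lift {A B D : C} {i : A ⟶ B} {p : B ⟶ D} (h : Ses i p) {Y : C} (g : Y ⟶ D)
    (hg : ∀ f : A ⟶ T.τ.obj Y, f ≫ T.τ.map g = 0) : ∃ l, l ≫ p = g := by
  obtain ⟨η, hη⟩ := T.exists_class h
  exact (hη.1 Y g).2 fun f ↦ by rw [hg f, map_zero]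

theorem exists_extend {A B D : C} {i : A ⟶ B} {p : B ⟶ D} (h : Ses i p) {Z : C} (f : A ⟶ Z)
    (hf : ∀ u : Z ⟶ T.τ.obj D, f ≫ u = 0) : ∃ e, i ≫ e = f := by
  obtain ⟨η, hη⟩ := T.exists_class h
  exact (hη.2 Z f).2 fun u ↦ by rw [hf u, map_zero]

variable [IsAlgClosed k]

/-- A family of pairwise Hom-orthogonal bricks, up to isomorphism, permuted by `τ`. -/
structure SimpleSystem where
  /-- the bricks -/
  S : ℤ → C
  iso {a b : ℤ} (h : a + 1 = b) : T.τ.obj (S b) ≅ S a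
  not_isZero (a : ℤ) : ¬ IsZero (S a)
  isIso {a b : ℤ} (f : S a ⟶ S b) : f ≠ 0 → IsIso f

end ARDuality

namespace ARDuality.SimpleSystem

variable {k} [IsAlgClosed k] {T : ARDuality k C} (𝒮 : T.SimpleSystem)

/-- Since `τ (S c) ≅ S b`, the morphism `t` is a nonzero element of `Hom(X, τ (S c))`. An extension
whose functional does not vanish on it glues `S c` on top of `X` in such a way that `t` does not
extend. This failure is what makes the iterated extensions uniserial. -/
theorem exists_step {b c : ℤ} (h : b + 1 = c) {X : C} (t : X ⟶ 𝒮.S b) (ht : t ≠ 0) :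
    ∃ (X' : C) (i : X ⟶ X') (t' : X' ⟶ 𝒮.S c), Ses i t' ∧ t' ≠ 0 ∧ ¬ ∃ e, i ≫ e = t := by
  obtain ⟨η, hη⟩ : ∃ η : Module.Dual k (X ⟶ T.τ.obj (𝒮.S c)), η (t ≫ (𝒮.iso h).inv) ≠ 0 := by
    by_contra! h'
    have := (Module.forall_dual_apply_eq_zero_iff k (t ≫ (𝒮.iso h).inv)).1 h'
    exact ht (by simpa using this)
  obtain ⟨B, i, p, hs, hc⟩ := T.exists_extension X (𝒮.S c) η
  refine ⟨B, i, p, hs, ?_, fun he ↦ hη ((hc.2 _ t).1 he _)⟩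
  rintro rfl
  have := hs.epi
  exact 𝒮.not_isZero c (IsZero.of_epi_eq_zero (0 : B ⟶ 𝒮.S c) rfl)

/-- An object with a nonzero morphism to `S b`. -/
structure Over (b : ℤ) where
  /-- the object -/
  W : C
  /-- the morphism -/
  t : W ⟶ 𝒮.S b
  ne : t ≠ 0

/-- The next object in the construction of uniserial objects. -/
noncomputable def Over.next {b c : ℤ} (h : b + 1 = c) (X : 𝒮.Over b) : 𝒮.Over c where
  W := (𝒮.exists_step h X.t X.ne).choose
  t := (𝒮.exists_step h X.t X.ne).choose_spec.choose_spec.choose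
  ne := (𝒮.exists_step h X.t X.ne).choose_spec.choose_spec.choose_spec.2.1

/-- The uniserial objects with socle `S a`. -/
noncomputable def chain (a : ℤ) : ∀ n : ℕ, 𝒮.Over (a + n)
  | 0 => ⟨𝒮.S a, eqToHom (by simp), fun h ↦ 𝒮.not_isZero a (IsZero.of_mono_eq_zero _ h)⟩
  | n + 1 => (chain a n).next 𝒮 (by push_cast; ring)

/-- The uniserial object of length `n + 1` with socle `S a`. -/
noncomputable def V (a : ℤ) (n : ℕ) : C := (𝒮.chain a n).W

/-- The top of a uniserial object. -/
noncomputable def top (a : ℤ) (n : ℕ) {b : ℤ} (h : a + n = b) : 𝒮.V a n ⟶ 𝒮.S b :=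
  (𝒮.chain a n).t ≫ eqToHom (by rw [h])

/-- The inclusion of the maximal subobject of a uniserial object. -/
noncomputable def ι (a : ℤ) (n : ℕ) : 𝒮.V a n ⟶ 𝒮.V a (n + 1) :=
  (𝒮.exists_step (b := a + n) (c := a + (n + 1 : ℕ)) (by push_cast; ring)
    (𝒮.chain a n).t (𝒮.chain a n).ne).choose_spec.choose

theorem top_eq (a : ℤ) (n : ℕ) : 𝒮.top a n rfl = (𝒮.chain a n).t := Category.comp_id _

theorem ses_ι_top (a : ℤ) (n : ℕ) {b : ℤ} (h : a + (n + 1 : ℕ) = b) :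
    Ses (𝒮.ι a n) (𝒮.top a (n + 1) h) := by
  subst h
  have := (𝒮.exists_step (b := a + n) (c := a + (n + 1 : ℕ)) (by push_cast; ring)
    (𝒮.chain a n).t (𝒮.chain a n).ne).choose_spec.choose_spec.choose_spec.1
  rw [top_eq]
  exact this

theorem not_extend_top (a : ℤ) (n : ℕ) {b : ℤ} (h : a + n = b) :
    ¬ ∃ e, 𝒮.ι a n ≫ e = 𝒮.top a n h := by
  subst h
  have := (𝒮.exists_step (b := a + n) (c := a + (n + 1 : ℕ)) (by push_cast; ring)
    (𝒮.chain a n).t (𝒮.chain a n).ne).choose_spec.choose_spec.choose_spec.2.2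
  rw [top_eq]
  exact this

/-- The inclusion of the socle of a uniserial object. -/
noncomputable def soc (a : ℤ) : ∀ n : ℕ, 𝒮.S a ⟶ 𝒮.V a n
  | 0 => 𝟙 _
  | n + 1 => soc a n ≫ 𝒮.ι a n

theorem soc_succ (a : ℤ) (n : ℕ) : 𝒮.soc a (n + 1) = 𝒮.soc a n ≫ 𝒮.ι a n := rfl

instance (a : ℤ) (n : ℕ) : Mono (𝒮.ι a n) := (𝒮.ses_ι_top a n rfl).mono

instance mono_soc (a : ℤ) (n : ℕ) : Mono (𝒮.soc a n) := by
  induction n with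
  | zero => exact inferInstanceAs (Mono (𝟙 (𝒮.S a)))
  | succ n ih => rw [soc_succ]; infer_instance

instance isIso_soc_zero (a : ℤ) : IsIso (𝒮.soc a 0) := inferInstanceAs (IsIso (𝟙 (𝒮.S a)))

instance isIso_top_zero (a : ℤ) {b : ℤ} (h : a + (0 : ℕ) = b) : IsIso (𝒮.top a 0 h) := by
  subst h
  rw [top_eq]
  exact inferInstanceAs (IsIso (eqToHom (show 𝒮.S a = 𝒮.S (a + (0 : ℕ)) by simp)))

theorem top_ne_zero (a : ℤ) (n : ℕ) {b : ℤ} (h : a + n = b) : 𝒮.top a n h ≠ 0 := fun h0 ↦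
  𝒮.not_extend_top a n h ⟨0, by rw [h0, comp_zero]⟩

theorem soc_ne_zero (a : ℤ) (n : ℕ) : 𝒮.soc a n ≠ 0 := fun h0 ↦
  𝒮.not_isZero a (IsZero.of_mono_eq_zero _ h0)

instance epi_top (a : ℤ) (n : ℕ) {b : ℤ} (h : a + n = b) : Epi (𝒮.top a n h) := by
  cases n with
  | zero => infer_instance
  | succ n => exact (𝒮.ses_ι_top a n h).epi

/-- Every nonzero morphism to a brick of the system factors through the top by an isomorphism. -/
theorem eq_top_comp (a : ℤ) (n : ℕ) {b : ℤ} (h : a + n = b) {j : ℤ} (f : 𝒮.V a n ⟶ 𝒮.S j) :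
    ∃ g, 𝒮.top a n h ≫ g = f := by
  induction n generalizing b j with
  | zero => exact ⟨inv (𝒮.top a 0 h) ≫ f, by simp⟩
  | succ n ih =>
    refine (𝒮.ses_ι_top a n h).desc f ?_
    -- If `f` were nonzero on the subobject, its restriction would be the top followed by an
    -- isomorphism `g`, and `f ≫ inv g` would extend the top.
    by_contra hf
    obtain ⟨g, hg⟩ := ih rfl (𝒮.ι a n ≫ f)
    have hg0 : g ≠ 0 := by
      rintro rfl
      exact hf (by rw [← hg, comp_zero])
    have := 𝒮.isIso g hg0
    exact 𝒮.not_extend_top a n rfl ⟨f ≫ inv g, by rw [← Category.assoc, ← hg]; simp⟩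

theorem ι_comp_eq_zero (a : ℤ) (n : ℕ) {j : ℤ} (f : 𝒮.V a (n + 1) ⟶ 𝒮.S j) :
    𝒮.ι a n ≫ f = 0 := by
  obtain ⟨g, rfl⟩ := 𝒮.eq_top_comp a (n + 1) rfl f
  rw [← Category.assoc, (𝒮.ses_ι_top a n rfl).w, zero_comp]

theorem exists_top_comp_iso (a : ℤ) (n : ℕ) {b : ℤ} (h : a + n = b) {j : ℤ}
    (f : 𝒮.V a n ⟶ 𝒮.S j) (hf : f ≠ 0) : ∃ g : 𝒮.S b ⟶ 𝒮.S j, IsIso g ∧ 𝒮.top a n h ≫ g = f := by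
  obtain ⟨g, rfl⟩ := 𝒮.eq_top_comp a n h f
  exact ⟨g, 𝒮.isIso g (by rintro rfl; simp at hf), rfl⟩

/-- Every morphism from a brick of the system factors through the socle. -/
theorem eq_comp_soc (a : ℤ) (n : ℕ) {j : ℤ} (f : 𝒮.S j ⟶ 𝒮.V a n) : ∃ g, g ≫ 𝒮.soc a n = f := by
  induction n with
  | zero => exact ⟨f ≫ inv (𝒮.soc a 0), by simp⟩
  | succ n ih =>
    have hs := 𝒮.ses_ι_top a n rfl
    -- Otherwise the composite is an isomorphism, the sequence splits, and the top of `V a n`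
    -- extends along the retraction.
    have : f ≫ 𝒮.top a (n + 1) rfl = 0 := by
      by_contra h0
      have := 𝒮.isIso _ h0
      obtain ⟨r, hr⟩ := hs.exists_retraction (inv (f ≫ 𝒮.top a (n + 1) rfl) ≫ f) (by simp)
      exact 𝒮.not_extend_top a n rfl ⟨r ≫ 𝒮.top a n rfl, by simp [reassoc_of% hr]⟩
    obtain ⟨f', rfl⟩ := hs.lift f this
    obtain ⟨g, rfl⟩ := ih f'
    exact ⟨g, by rw [soc_succ, Category.assoc]⟩

theorem exists_iso_comp_soc (a : ℤ) (n : ℕ) {j : ℤ} (f : 𝒮.S j ⟶ 𝒮.V a n) (hf : f ≠ 0) :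
    ∃ g : 𝒮.S j ⟶ 𝒮.S a, IsIso g ∧ g ≫ 𝒮.soc a n = f := by
  obtain ⟨g, rfl⟩ := 𝒮.eq_comp_soc a n f
  exact ⟨g, 𝒮.isIso g (by rintro rfl; simp at hf), rfl⟩

theorem comp_top_succ_eq_zero (a : ℤ) (n : ℕ) {j b : ℤ} (f : 𝒮.S j ⟶ 𝒮.V a (n + 1))
    (g : 𝒮.V a (n + 1) ⟶ 𝒮.S b) : f ≫ g = 0 := by
  obtain ⟨f, rfl⟩ := 𝒮.eq_comp_soc a (n + 1) f
  rw [soc_succ, Category.assoc, Category.assoc, ι_comp_eq_zero, comp_zero, comp_zero]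

/-- If a morphism from `V a n` does not extend to `V a (n + 1)`, then its target has a morphism to
the top of `V a n` that does not vanish on it. -/
theorem extend_or (a : ℤ) (n : ℕ) {b : ℤ} (h : a + n = b) {X : C} (f : 𝒮.V a n ⟶ X) :
    (∃ e, 𝒮.ι a n ≫ e = f) ∨ ∃ u : X ⟶ 𝒮.S b, f ≫ u ≠ 0 := by
  by_cases h' : ∀ u : X ⟶ 𝒮.S b, f ≫ u = 0
  · left
    refine T.exists_extend (𝒮.ses_ι_top a n rfl) f fun u ↦ ?_
    have h1 : b + 1 = a + (n + 1 : ℕ) := by push_cast; lia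
    have := h' (u ≫ (𝒮.iso h1).hom)
    rw [← Category.assoc] at this
    exact (cancel_mono _).1 (this.trans zero_comp.symm)
  · right; push Not at h'; exact h'

/-- If a morphism `b` to the quotient of an extension by `S a` does not lift, then its source `X`
has a morphism from `S (a + 1)` whose composition with `b` does not vanish. -/
theorem lift_or {a a' : ℤ} (h : a + 1 = a') {B D : C} {i : 𝒮.S a ⟶ B} {p : B ⟶ D} (hs : Ses i p)
    {X : C} (f : X ⟶ D) : (∃ l, l ≫ p = f) ∨ ∃ c : 𝒮.S a' ⟶ X, c ≫ f ≠ 0 := by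
  by_cases h' : ∀ c : 𝒮.S a' ⟶ X, c ≫ f = 0
  · left
    refine T.exists_lift hs f fun u ↦ ?_
    obtain ⟨c, hc⟩ := T.τ.map_surjective ((𝒮.iso h).hom ≫ u)
    have := congrArg T.τ.map (h' c)
    rw [T.τ.map_comp, hc, Category.assoc, T.τ.map_zero] at this
    exact (cancel_epi _).1 (this.trans comp_zero.symm)
  · right; push Not at h'; exact h'

/-- Nothing obstructs extending `p ≫ ι` along `ι`, because `ι` dies in every brick. The extension
`q` is an isomorphism on tops: if it missed the top, it would land in `V (a + 1) n` and extend `p`,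
and then `p` would miss the top as well. Comparing the layers shows that `q` is an epimorphism with
the same kernel as `p`. -/
theorem exists_π_succ (a : ℤ) (n : ℕ) (p : 𝒮.V a (n + 1) ⟶ 𝒮.V (a + 1) n)
    (hp : Ses (𝒮.soc a (n + 1)) p) : ∃ q : 𝒮.V a (n + 1 + 1) ⟶ 𝒮.V (a + 1) (n + 1),
      𝒮.ι a (n + 1) ≫ q = p ≫ 𝒮.ι (a + 1) n ∧ Ses (𝒮.soc a (n + 1 + 1)) q := by
  have hpe := hp.epi
  rcases 𝒮.extend_or a (n + 1) rfl (p ≫ 𝒮.ι (a + 1) n) with ⟨q, hq⟩ | ⟨u, hu⟩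
  swap
  · exact (hu (by rw [Category.assoc, ι_comp_eq_zero, comp_zero])).elim
  have hb : (a + 1) + (n + 1 : ℕ) = a + (n + 1 + 1 : ℕ) := by push_cast; ring
  obtain ⟨c, hc⟩ := 𝒮.eq_top_comp a (n + 1 + 1) rfl (q ≫ 𝒮.top (a + 1) (n + 1) hb)
  have hc0 : c ≠ 0 := by
    rintro rfl
    rw [comp_zero] at hc
    obtain ⟨r, hr⟩ := (𝒮.ses_ι_top (a + 1) n hb).lift q hc.symm
    have hr' : 𝒮.ι a (n + 1) ≫ r = p := by
      rw [← cancel_mono (𝒮.ι (a + 1) n), Category.assoc, hr, hq]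
    have : p ≫ 𝒮.top (a + 1) n rfl = 0 := by
      rw [← hr', Category.assoc, ι_comp_eq_zero]
    exact 𝒮.top_ne_zero _ _ _ ((cancel_epi p).1 (this.trans comp_zero.symm))
  have hci := 𝒮.isIso c hc0
  have hqe : Epi q := by
    refine Preadditive.epi_of_cancel_zero _ fun {Z} f hf ↦ ?_
    have h1 : 𝒮.ι (a + 1) n ≫ f = 0 := by
      rw [← cancel_epi p, ← Category.assoc, ← hq, Category.assoc, hf, comp_zero, comp_zero]
    obtain ⟨f', rfl⟩ := (𝒮.ses_ι_top (a + 1) n hb).desc f h1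
    rw [← Category.assoc, ← hc, Category.assoc] at hf
    have h2 : c ≫ f' = 0 := (cancel_epi (𝒮.top a (n + 1 + 1) rfl)).1 (hf.trans comp_zero.symm)
    rw [(cancel_epi c).1 (h2.trans comp_zero.symm), comp_zero]
  refine ⟨q, hq, Ses.of_lift ?_ fun W x hx ↦ ?_⟩
  · rw [soc_succ, Category.assoc, hq, ← Category.assoc, hp.w, zero_comp]
  · have h1 : x ≫ 𝒮.top a (n + 1 + 1) rfl = 0 := by
      rw [← cancel_mono c, Category.assoc, hc, ← Category.assoc, hx, zero_comp, zero_comp]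
    obtain ⟨y, rfl⟩ := (𝒮.ses_ι_top a (n + 1) rfl).lift x h1
    have h2 : y ≫ p = 0 := by
      rw [← cancel_mono (𝒮.ι (a + 1) n), Category.assoc, ← hq, ← Category.assoc, hx, zero_comp]
    obtain ⟨z, rfl⟩ := hp.lift y h2
    exact ⟨z, by rw [soc_succ, Category.assoc]⟩

theorem exists_π (a : ℤ) {a' : ℤ} (h : a + 1 = a') (n : ℕ) :
    ∃ p : 𝒮.V a (n + 1) ⟶ 𝒮.V a' n, Ses (𝒮.soc a (n + 1)) p := by
  subst h
  induction n with
  | zero =>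
    refine ⟨𝒮.top a 1 (by simp), ?_⟩
    have := 𝒮.ses_ι_top a 0 (b := a + 1) (by simp)
    have h1 : 𝒮.soc a 1 = 𝒮.ι a 0 := Category.id_comp _
    rw [h1]
    exact this
  | succ n ih =>
    obtain ⟨p, hp⟩ := ih
    obtain ⟨q, -, hq⟩ := 𝒮.exists_π_succ a n p hp
    exact ⟨q, hq⟩

/-- The quotient of a uniserial object by its socle. -/
noncomputable def π (a : ℤ) {a' : ℤ} (h : a + 1 = a') (n : ℕ) : 𝒮.V a (n + 1) ⟶ 𝒮.V a' n :=
  (𝒮.exists_π a h n).choose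

theorem ses_soc_π (a : ℤ) {a' : ℤ} (h : a + 1 = a') (n : ℕ) :
    Ses (𝒮.soc a (n + 1)) (𝒮.π a h n) := (𝒮.exists_π a h n).choose_spec

instance (a : ℤ) {a' : ℤ} (h : a + 1 = a') (n : ℕ) : Epi (𝒮.π a h n) := (𝒮.ses_soc_π a h n).epi

theorem soc_comp_π (a : ℤ) {a' : ℤ} (h : a + 1 = a') (n : ℕ) :
    𝒮.soc a (n + 1) ≫ 𝒮.π a h n = 0 := (𝒮.ses_soc_π a h n).w

theorem ι_zero_comp_π (a : ℤ) {a' : ℤ} (h : a + 1 = a') : 𝒮.ι a 0 ≫ 𝒮.π a h 0 = 0 := by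
  rw [← cancel_epi (𝒮.soc a 0), ← Category.assoc, ← soc_succ, comp_zero]
  exact 𝒮.soc_comp_π a h 0

/-- The quotient maps `π` are chosen independently for each length, so the squares formed with `ι`
commute only up to an endomorphism `e`. This suffices for the filtration arguments. -/
theorem exists_ι_comp_π (a : ℤ) {a' : ℤ} (h : a + 1 = a') (n : ℕ) :
    ∃ e, 𝒮.ι a (n + 1) ≫ 𝒮.π a h (n + 1) = 𝒮.π a h n ≫ e ≫ 𝒮.ι a' n := by
  subst h
  obtain ⟨q, hq, hs⟩ := 𝒮.exists_π_succ a n _ (𝒮.ses_soc_π a rfl n)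
  obtain ⟨e, he⟩ := hs.desc (𝒮.π a rfl (n + 1)) (𝒮.soc_comp_π a rfl (n + 1))
  obtain ⟨e', he'⟩ := (𝒮.ses_ι_top (a + 1) n rfl).lift (𝒮.ι (a + 1) n ≫ e)
    (by rw [Category.assoc, ι_comp_eq_zero])
  exact ⟨e', by rw [he', ← he, ← Category.assoc, hq, Category.assoc]⟩

end ARDuality.SimpleSystem

end Duality

/-! ### Recognition of uniserial objects and their almost split maps. -/

section Uniserial

variable {k : Type t} [Field k] [IsAlgClosed k] {C : Type u} [Category.{v} C] [Abelian C]
  [Linear k C] {T : ARDuality k C} (𝒮 : T.SimpleSystem)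

namespace ARDuality.SimpleSystem

/-- Endomorphisms of the bricks are scalars. -/
theorem exists_eq_smul (a : ℤ) (f : 𝒮.S a ⟶ 𝒮.S a) : ∃ c : k, f = c • 𝟙 _ := by
  have := T.finite (𝒮.S a) (𝒮.S a)
  have : Module.Finite k (End (𝒮.S a)) := this
  have : Nontrivial (End (𝒮.S a)) :=
    ⟨0, 1, fun h ↦ 𝒮.not_isZero a ((IsZero.iff_id_eq_zero _).2 h.symm)⟩
  obtain ⟨c, hc⟩ := spectrum.nonempty_of_isAlgClosed_of_finiteDimensional k
    (show End (𝒮.S a) from f)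
  refine ⟨c, ?_⟩
  by_contra hne
  have h0 : f - c • 𝟙 _ ≠ 0 := sub_ne_zero.2 hne
  have h1 := 𝒮.isIso _ h0
  rw [spectrum.mem_iff, Algebra.algebraMap_eq_smul_one] at hc
  apply hc
  have h2 : IsUnit (M := End (𝒮.S a)) (f - c • 𝟙 _) := (isUnit_iff_isIso _).2 h1
  have h3 := h2.neg
  rwa [neg_sub] at h3

/-- An endomorphism which vanishes on the socle is nilpotent. -/
theorem comp_pow_eq_zero {b : ℤ} {m : ℕ} (e : End (𝒮.V b m)) (he : 𝒮.soc b m ≫ e = 0) (n : ℕ)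
    (a : ℤ) (f : 𝒮.V a n ⟶ 𝒮.V b m) : f ≫ (e ^ (n + 1) : End (𝒮.V b m)) = 0 := by
  induction n generalizing a with
  | zero =>
    obtain ⟨g, hg⟩ := 𝒮.eq_comp_soc b m (𝒮.soc a 0 ≫ f)
    rw [← cancel_epi (𝒮.soc a 0), zero_add, pow_one, ← Category.assoc, ← hg, Category.assoc, he,
      comp_zero, comp_zero]
  | succ n ih =>
    obtain ⟨g, hg⟩ := 𝒮.eq_comp_soc b m (𝒮.soc a (n + 1) ≫ f)
    have h1 : 𝒮.soc a (n + 1) ≫ f ≫ e = 0 := by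
      rw [← Category.assoc, ← hg, Category.assoc, he, comp_zero]
    obtain ⟨f', hf'⟩ := (𝒮.ses_soc_π a rfl n).desc _ h1
    have : (e ^ (n + 1 + 1) : End (𝒮.V b m)) = e ≫ (e ^ (n + 1) : End (𝒮.V b m)) := by
      rw [pow_succ, End.mul_def]
    rw [this, ← Category.assoc, ← hf', Category.assoc, ih, comp_zero]

theorem isNilpotent_of_soc_comp {b : ℤ} {m : ℕ} (e : End (𝒮.V b m)) (he : 𝒮.soc b m ≫ e = 0) :
    IsNilpotent e :=
  ⟨m + 1, by simpa using 𝒮.comp_pow_eq_zero e he m b (𝟙 _)⟩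

theorem exists_isNilpotent_sub (b : ℤ) (m : ℕ) (e : End (𝒮.V b m)) :
    ∃ c : k, 𝒮.soc b m ≫ e = c • 𝒮.soc b m ∧ IsNilpotent (e - c • (1 : End (𝒮.V b m))) := by
  obtain ⟨g, hg⟩ := 𝒮.eq_comp_soc b m (𝒮.soc b m ≫ e)
  obtain ⟨c, rfl⟩ := 𝒮.exists_eq_smul b g
  have h1 : 𝒮.soc b m ≫ e = c • 𝒮.soc b m := by rw [← hg]; simp
  refine ⟨c, h1, 𝒮.isNilpotent_of_soc_comp _ ?_⟩
  rw [Preadditive.comp_sub, h1, Linear.comp_smul]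
  exact sub_eq_zero.2 (congrArg _ (Category.comp_id _).symm)

theorem isIso_of_soc_comp_ne_zero (b : ℤ) (m : ℕ) (e : 𝒮.V b m ⟶ 𝒮.V b m)
    (he : 𝒮.soc b m ≫ e ≠ 0) : IsIso e := by
  obtain ⟨c, h1, h2⟩ := 𝒮.exists_isNilpotent_sub b m e
  refine isIso_of_isNilpotent_sub_smul (c := c) ?_ h2
  rintro rfl
  exact he (by rw [h1, zero_smul])

/-- An endomorphism acts on the top by a scalar, here a nonzero one. If it killed the socle it would
be nilpotent, and so would that scalar. -/
theorem isIso_of_comp_top_ne_zero (b : ℤ) (m : ℕ) (e : 𝒮.V b m ⟶ 𝒮.V b m) {j : ℤ}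
    (f : 𝒮.V b m ⟶ 𝒮.S j) (he : e ≫ f ≠ 0) : IsIso e := by
  apply 𝒮.isIso_of_soc_comp_ne_zero
  intro h0
  obtain ⟨N, hN⟩ := 𝒮.isNilpotent_of_soc_comp e h0
  obtain ⟨f, rfl⟩ := 𝒮.eq_top_comp b m rfl f
  obtain ⟨g, hg⟩ := 𝒮.eq_top_comp b m rfl (e ≫ 𝒮.top b m rfl)
  obtain ⟨c, rfl⟩ := 𝒮.exists_eq_smul _ g
  have h1 : ∀ n : ℕ, ((show End (𝒮.V b m) from e) ^ n : End (𝒮.V b m)) ≫ 𝒮.top b m rfl =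
      c ^ n • 𝒮.top b m rfl := by
    intro n
    induction n with
    | zero => rw [pow_zero, pow_zero, one_smul]; exact Category.id_comp _
    | succ n ih =>
      rw [pow_succ', End.mul_def, Category.assoc, ← hg, Linear.comp_smul, Category.comp_id,
        Linear.comp_smul, ih, smul_smul, pow_succ']
  have h2 := h1 N
  rw [show (show End (𝒮.V b m) from e) ^ N = 0 from hN, zero_comp] at h2
  rcases smul_eq_zero.1 h2.symm with h3 | h3
  · have hc : c = 0 := eq_zero_of_pow_eq_zero h3
    apply he
    rw [← Category.assoc, ← hg, hc, zero_smul, comp_zero, zero_comp]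
  · exact 𝒮.top_ne_zero b m rfl h3

theorem not_isZero_V (a : ℤ) (n : ℕ) : ¬ IsZero (𝒮.V a n) := fun h ↦
  𝒮.soc_ne_zero a n (h.eq_of_tgt _ _)

/-- An idempotent that kills the socle is nilpotent, hence zero; one that does not kill it is
invertible, so the complementary summand vanishes. -/
theorem indecomposable_V (a : ℤ) (n : ℕ) : Indecomposable (𝒮.V a n) := by
  refine ⟨𝒮.not_isZero_V a n, fun Y Z i ↦ ?_⟩
  have key : ∀ (W : C) (j : W ⟶ 𝒮.V a n) (p : 𝒮.V a n ⟶ W), j ≫ p = 𝟙 W →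
      𝒮.soc a n ≫ p ≫ j = 0 → IsZero W := by
    intro W j p hjp h0
    obtain ⟨N, hN⟩ := 𝒮.isNilpotent_of_soc_comp (p ≫ j) h0
    have hid : IsIdempotentElem (M := End (𝒮.V a n)) (p ≫ j) := by
      change (p ≫ j) ≫ (p ≫ j) = p ≫ j
      simp [reassoc_of% hjp]
    have h1 : p ≫ j = 0 := by
      have := hid.pow_succ_eq N
      rw [pow_succ, hN, zero_mul] at this
      exact this.symm
    rw [IsZero.iff_id_eq_zero, ← hjp]
    calc j ≫ p = j ≫ (p ≫ j) ≫ p := by simp [reassoc_of% hjp]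
      _ = 0 := by rw [h1]; simp
  by_cases h : 𝒮.soc a n ≫ (i.hom ≫ biprod.fst) ≫ (biprod.inl ≫ i.inv) = 0
  · exact Or.inl (key _ _ _ (by simp) h)
  · have := 𝒮.isIso_of_soc_comp_ne_zero a n _ h
    right
    rw [IsZero.iff_id_eq_zero]
    have h2 : biprod.inr ≫ i.inv = 0 := by
      rw [← cancel_mono ((i.hom ≫ biprod.fst) ≫ (biprod.inl ≫ i.inv))]
      simp
    calc 𝟙 Z = (biprod.inr ≫ i.inv) ≫ i.hom ≫ biprod.snd := by simp
      _ = 0 := by rw [h2, zero_comp]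

/-- The objects isomorphic to one of the uniserial objects of the system. -/
def IsUniserial (X : C) : Prop := ∃ (a : ℤ) (n : ℕ), Nonempty (X ≅ 𝒮.V a n)

theorem isIso_of_isIso_comp {X Y : C} (hX : Indecomposable X) (hY : ¬ IsZero Y) (i : Y ⟶ X)
    (p : X ⟶ Y) [IsIso (i ≫ p)] : IsIso i := by
  exact (isIso_of_retract hX i (p ≫ inv (i ≫ p))
    (by rw [← Category.assoc, IsIso.hom_inv_id]) hY).1

/-- Extending step by step along the maps `ι` can only be stopped by a morphism from `X` to the top
of the stage reached. The alternative records this obstruction, which is the input for a lifting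
argument with a smaller length. -/
theorem extend_chain_or {a : ℤ} {X : C} (c : 𝒮.S a ⟶ X) (n : ℕ) :
    (∃ c' : 𝒮.V a n ⟶ X, 𝒮.soc a n ≫ c' = c) ∨ ∃ m < n, ∃ c' : 𝒮.V a m ⟶ X,
      𝒮.soc a m ≫ c' = c ∧ ∃ b : X ⟶ 𝒮.S (a + m), c' ≫ b ≠ 0 := by
  induction n with
  | zero => exact Or.inl ⟨inv (𝒮.soc a 0) ≫ c, by simp⟩
  | succ n ih =>
    rcases ih with ⟨c', hc'⟩ | ⟨m, hm, h⟩
    · rcases 𝒮.extend_or a n rfl c' with ⟨e, he⟩ | h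
      · exact Or.inl ⟨e, by rw [soc_succ, Category.assoc, he, hc']⟩
      · exact Or.inr ⟨n, n.lt_succ_self, c', hc', h⟩
    · exact Or.inr ⟨m, hm.trans n.lt_succ_self, h⟩

/-- Dual to `extend_chain_or`: lifting through the maps `π` can only be stopped by a morphism from a
brick to `X` that survives in the stage reached. -/
theorem lift_chain_or {j : ℤ} {X : C} (b : X ⟶ 𝒮.S j) (n : ℕ) :
    (∃ (a : ℤ) (_ : a + n = j) (l : X ⟶ 𝒮.V a n) (p : 𝒮.V a n ⟶ 𝒮.S j), l ≫ p = b) ∨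
      ∃ m < n, ∃ (a i : ℤ) (l : X ⟶ 𝒮.V a m) (c : 𝒮.S i ⟶ X), c ≫ l ≠ 0 := by
  induction n with
  | zero => exact Or.inl ⟨j, by simp, b ≫ 𝒮.soc j 0, inv (𝒮.soc j 0), by simp⟩
  | succ n ih =>
    rcases ih with ⟨a, ha, l, p, hlp⟩ | ⟨m, hm, h⟩
    · have ha' : a - 1 + 1 = a := by ring
      rcases 𝒮.lift_or ha' (𝒮.ses_soc_π (a - 1) ha' n) l with ⟨l', hl'⟩ | ⟨c, hc⟩
      · exact Or.inl ⟨a - 1, by push_cast; lia, l', 𝒮.π (a - 1) ha' n ≫ p, by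
          rw [← Category.assoc, hl', hlp]⟩
      · exact Or.inr ⟨n, n.lt_succ_self, a, a, l, c, hc⟩
    · exact Or.inr ⟨m, hm.trans n.lt_succ_self, h⟩

/-- If `b` lifts to a uniserial object of the same length as `V a m`, then this object is `V a m`,
and `c` followed by the lift is an endomorphism that is nonzero on the top. It is therefore
invertible, and `X` is isomorphic to `V a m`. A failed lift produces a nonzero composite through a
shorter uniserial object, to which `H` applies. -/
theorem isUniserial_of_comp_ne_zero_aux {X : C} (hX : Indecomposable X) {a j : ℤ} {m : ℕ}
    (c : 𝒮.V a m ⟶ X) (b : X ⟶ 𝒮.S j) (hcb : c ≫ b ≠ 0)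
    (H : ∀ n < m, ∀ (a i : ℤ) (l : X ⟶ 𝒮.V a n) (c : 𝒮.S i ⟶ X), c ≫ l ≠ 0 → 𝒮.IsUniserial X) :
    𝒮.IsUniserial X := by
  obtain ⟨g, hg, hgb⟩ := 𝒮.exists_top_comp_iso a m rfl (c ≫ b) hcb
  rcases 𝒮.lift_chain_or (b ≫ inv g) m with ⟨a', ha', l, p, hlp⟩ | ⟨n, hn, a, i, l, c, h⟩
  · obtain rfl : a' = a := by lia
    have : IsIso (c ≫ l) := by
      refine 𝒮.isIso_of_comp_top_ne_zero a' m (c ≫ l) p fun h0 ↦ hcb ?_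
      rw [Category.assoc, hlp, ← Category.assoc] at h0
      exact (cancel_mono (inv g)).1 (h0.trans zero_comp.symm)
    have := isIso_of_isIso_comp hX (𝒮.not_isZero_V a' m) c l
    exact ⟨a', m, ⟨(asIso c).symm⟩⟩
  · exact H n hn a i l c h

/-- An indecomposable object through which a nonzero morphism from a brick to a uniserial object
factors is uniserial. -/
theorem isUniserial_of_comp_ne_zero {X : C} (hX : Indecomposable X) {a j : ℤ} {n : ℕ}
    (c : 𝒮.S j ⟶ X) (b : X ⟶ 𝒮.V a n) (hcb : c ≫ b ≠ 0) : 𝒮.IsUniserial X := by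
  induction n using Nat.strong_induction_on generalizing a j with
  | _ n ih =>
  obtain ⟨g, hg, hgb⟩ := 𝒮.exists_iso_comp_soc a n (c ≫ b) hcb
  -- Extension from the socle alternates with lifting over the top. Each failure strictly shortens
  -- the uniserial object, so the induction on `n` ends.
  rcases 𝒮.extend_chain_or (inv g ≫ c) n with ⟨c', hc'⟩ | ⟨m, hm, c', -, b', hcb'⟩
  · have : IsIso (c' ≫ b) := by
      apply 𝒮.isIso_of_soc_comp_ne_zero
      rw [← Category.assoc, hc', Category.assoc, ← hgb, IsIso.inv_hom_id_assoc]
      exact 𝒮.soc_ne_zero a n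
    have := isIso_of_isIso_comp hX (𝒮.not_isZero_V a n) c' b
    exact ⟨a, n, ⟨(asIso c').symm⟩⟩
  · exact 𝒮.isUniserial_of_comp_ne_zero_aux hX c' b' hcb' fun n' hn' a i l c h ↦
      ih n' (hn'.trans hm) c l h

theorem isUniserial_of_comp_ne_zero' {X : C} (hX : Indecomposable X) {a j : ℤ} {n : ℕ}
    (c : 𝒮.V a n ⟶ X) (b : X ⟶ 𝒮.S j) (hcb : c ≫ b ≠ 0) : 𝒮.IsUniserial X :=
  𝒮.isUniserial_of_comp_ne_zero_aux hX c b hcb fun _ _ _ _ l c h ↦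
    𝒮.isUniserial_of_comp_ne_zero hX c l h

theorem exists_extend_chain {X : C} (hX : Indecomposable X) (hX' : ¬ 𝒮.IsUniserial X) {a : ℤ}
    (c : 𝒮.S a ⟶ X) (n : ℕ) : ∃ c' : 𝒮.V a n ⟶ X, 𝒮.soc a n ≫ c' = c := by
  rcases 𝒮.extend_chain_or c n with h | ⟨m, hm, c', -, b, hb⟩
  · exact h
  · exact (hX' (𝒮.isUniserial_of_comp_ne_zero' hX c' b hb)).elim

theorem exists_lift_π {X : C} (hX : Indecomposable X) (hX' : ¬ 𝒮.IsUniserial X) {a a' : ℤ}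
    (h : a + 1 = a') {n : ℕ} (f : X ⟶ 𝒮.V a' n) : ∃ l, l ≫ 𝒮.π a h n = f := by
  rcases 𝒮.lift_or h (𝒮.ses_soc_π a h n) f with h | ⟨c, hc⟩
  · exact h
  · exact (hX' (𝒮.isUniserial_of_comp_ne_zero hX c f hc)).elim

/-- A morphism to `V a (n + 2)` whose restriction to a subobject lands in `V a n` does not hit the
top, if the quotient by the subobject has no morphism which hits the top of a uniserial object of
length two. -/
theorem comp_top_eq_zero_of_lands {Z Y Q : C} {i : Z ⟶ Y} {p : Y ⟶ Q} (hs : Ses i p)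
    (hQ : ∀ (b j : ℤ) (f : Q ⟶ 𝒮.V b 1) (g : 𝒮.V b 1 ⟶ 𝒮.S j), f ≫ g = 0) {a : ℤ} {n : ℕ}
    (g : Y ⟶ 𝒮.V a (n + 1 + 1)) (g' : Z ⟶ 𝒮.V a n) (hg : i ≫ g = g' ≫ 𝒮.ι a n ≫ 𝒮.ι a (n + 1))
    {j : ℤ} (f : 𝒮.V a (n + 1 + 1) ⟶ 𝒮.S j) : g ≫ f = 0 := by
  induction n generalizing a j with
  | zero =>
    -- Dividing by the socle reduces the length by one. In this last case the image of `Z` has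
    -- become zero, so `g` factors over `Q`, where `hQ` applies.
    obtain ⟨f, rfl⟩ := (𝒮.ses_soc_π a rfl 1).desc f (𝒮.comp_top_succ_eq_zero a 1 _ _)
    have h1 : i ≫ g ≫ 𝒮.π a rfl 1 = 0 := by
      obtain ⟨e, he⟩ := 𝒮.exists_ι_comp_π a rfl 0
      rw [← Category.assoc, hg, Category.assoc, Category.assoc, he,
        reassoc_of% 𝒮.ι_zero_comp_π a rfl, zero_comp, comp_zero]
    obtain ⟨q, hq⟩ := hs.desc _ h1
    rw [← Category.assoc, ← hq, Category.assoc, hQ, comp_zero]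
  | succ n ih =>
    obtain ⟨f, rfl⟩ := (𝒮.ses_soc_π a rfl (n + 1 + 1)).desc f
      (𝒮.comp_top_succ_eq_zero a (n + 1 + 1) _ _)
    obtain ⟨e, he⟩ := 𝒮.exists_ι_comp_π a rfl (n + 1)
    obtain ⟨e', he'⟩ := 𝒮.exists_ι_comp_π a rfl n
    obtain ⟨e'', he''⟩ := (𝒮.ses_ι_top (a + 1) n rfl).lift (𝒮.ι (a + 1) n ≫ e)
      (by rw [Category.assoc, ι_comp_eq_zero])
    rw [← Category.assoc]
    refine ih (g ≫ 𝒮.π a rfl (n + 1 + 1)) (g' ≫ 𝒮.π a rfl n ≫ e' ≫ e'') ?_ f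
    rw [← Category.assoc, hg]
    simp only [Category.assoc]
    rw [he, reassoc_of% he', ← reassoc_of% he'']

/-- Passing from `Y` to the kernel `Z` removes exactly one layer of the target: dropping two would
contradict that `Q` never hits the top of a uniserial object of length two. -/
theorem exists_lift_hits_top {Z Y Q : C} {i : Z ⟶ Y} {p : Y ⟶ Q} (hs : Ses i p)
    (hQ : ∀ (b j : ℤ) (f : Q ⟶ 𝒮.V b 1) (g : 𝒮.V b 1 ⟶ 𝒮.S j), f ≫ g = 0) {a : ℤ} {n : ℕ}
    (g : Y ⟶ 𝒮.V a (n + 1)) (hi : i ≫ g ≫ 𝒮.top a (n + 1) rfl = 0)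
    (hg : g ≫ 𝒮.top a (n + 1) rfl ≠ 0) :
    ∃ g' : Z ⟶ 𝒮.V a n, g' ≫ 𝒮.ι a n = i ≫ g ∧ g' ≫ 𝒮.top a n rfl ≠ 0 := by
  obtain ⟨g', hg'⟩ := (𝒮.ses_ι_top a n rfl).lift (i ≫ g) (by rw [Category.assoc, hi])
  refine ⟨g', hg', fun h0 ↦ hg ?_⟩
  cases n with
  | zero =>
    have h1 : i ≫ g = 0 := by
      rw [← hg', (cancel_mono (𝒮.top a 0 rfl)).1 (h0.trans zero_comp.symm), zero_comp]
    obtain ⟨q, hq⟩ := hs.desc _ h1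
    rw [← hq, Category.assoc]
    exact (congrArg (p ≫ ·) (hQ a _ q (𝒮.top a 1 rfl))).trans comp_zero
  | succ n =>
    obtain ⟨g'', rfl⟩ := (𝒮.ses_ι_top a n rfl).lift g' h0
    exact 𝒮.comp_top_eq_zero_of_lands hs hQ g g'' (by rw [← hg', Category.assoc]) _

/-- Removing the top of the source removes exactly one layer of the target, by
`exists_lift_hits_top` applied with a brick as quotient. Hence the source cannot run out of layers
first. -/
theorem length_le_of_comp_top_ne_zero {a' a : ℤ} {m n : ℕ} (f : 𝒮.V a' m ⟶ 𝒮.V a n)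
    (hf : f ≫ 𝒮.top a n rfl ≠ 0) : n ≤ m := by
  induction m generalizing n with
  | zero =>
    cases n with
    | zero => exact le_rfl
    | succ n =>
      refine (hf ?_).elim
      rw [← cancel_epi (𝒮.soc a' 0), ← Category.assoc, 𝒮.comp_top_succ_eq_zero, comp_zero]
  | succ m ih =>
    cases n with
    | zero => exact Nat.zero_le _
    | succ n =>
      obtain ⟨g, -, hg⟩ := 𝒮.exists_lift_hits_top (𝒮.ses_ι_top a' m rfl)
        (fun b j f g ↦ 𝒮.comp_top_succ_eq_zero b 0 f g) f
        (𝒮.ι_comp_eq_zero a' m (f ≫ 𝒮.top a (n + 1) rfl)) hf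
      exact Nat.succ_le_succ (ih g hg)

/-- Extend the socle inclusion of the source to a morphism `c` from `V a n`. If this succeeds, `c ≫
f` is invertible on the socle, hence invertible. If it stops at some `l < n`, then `V a l` hits the
top of `V a n`, against the comparison of lengths. -/
theorem isIso_of_soc_top {a' a : ℤ} {m n : ℕ} (f : 𝒮.V a' m ⟶ 𝒮.V a n)
    (hs : 𝒮.soc a' m ≫ f ≠ 0) (ht : f ≫ 𝒮.top a n rfl ≠ 0) : IsIso f := by
  obtain ⟨g, hg, hgf⟩ := 𝒮.exists_iso_comp_soc a n _ hs
  rcases 𝒮.extend_chain_or (inv g ≫ 𝒮.soc a' m) n with ⟨c, hc⟩ | ⟨l, hl, c, -, b, hcb⟩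
  · have : IsIso (c ≫ f) := by
      apply 𝒮.isIso_of_soc_comp_ne_zero
      rw [← Category.assoc, hc, Category.assoc, ← hgf, IsIso.inv_hom_id_assoc]
      exact 𝒮.soc_ne_zero a n
    have := isIso_of_isIso_comp (𝒮.indecomposable_V a' m) (𝒮.not_isZero_V a n) c f
    exact IsIso.of_isIso_comp_left c f
  · obtain ⟨b, rfl⟩ := 𝒮.eq_top_comp a' m rfl b
    obtain ⟨u, hu, huf⟩ := 𝒮.exists_top_comp_iso a' m rfl _ ht
    have : n ≤ l := by
      apply 𝒮.length_le_of_comp_top_ne_zero (c ≫ f)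
      intro h0
      apply hcb
      rw [Category.assoc, ← huf, ← Category.assoc] at h0
      rw [← Category.assoc, (cancel_mono u).1 (h0.trans zero_comp.symm), zero_comp]
    omega

theorem length_eq_of_iso {a' a : ℤ} {m n : ℕ} (e : 𝒮.V a' m ≅ 𝒮.V a n) : m = n :=
  le_antisymm
    (𝒮.length_le_of_comp_top_ne_zero e.inv fun h ↦ 𝒮.top_ne_zero a' m rfl (by
      rwa [← cancel_epi e.inv, comp_zero]))
    (𝒮.length_le_of_comp_top_ne_zero e.hom fun h ↦ 𝒮.top_ne_zero a n rfl (by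
      rwa [← cancel_epi e.hom, comp_zero]))

/-- The right almost split property of uniserial objects. -/
theorem right_almost_split {X : C} (hX : Indecomposable X) {a a' : ℤ} (h : a + 1 = a') {n : ℕ}
    (f : X ⟶ 𝒮.V a' n) (hf : ¬ IsIso f) :
    (∃ l, l ≫ 𝒮.π a h n = f) ∨ ∃ (m : ℕ) (hm : n = m + 1) (l : X ⟶ 𝒮.V a' m),
      l ≫ 𝒮.ι a' m = f ≫ eqToHom (by rw [hm]) := by
  rcases 𝒮.lift_or h (𝒮.ses_soc_π a h n) f with hl | ⟨c, hc⟩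
  · exact Or.inl hl
  right
  -- When `f` does not lift, `X` is uniserial and `f` is nonzero on its socle. Not being invertible,
  -- `f` then misses the top and lands in the maximal subobject.
  obtain ⟨b, m, ⟨e⟩⟩ := 𝒮.isUniserial_of_comp_ne_zero hX c f hc
  obtain ⟨c', hc'⟩ := 𝒮.eq_comp_soc b m (c ≫ e.hom)
  have h1 : 𝒮.soc b m ≫ e.inv ≫ f ≠ 0 := by
    intro h0
    apply hc
    rw [← Category.comp_id c, ← e.hom_inv_id, ← Category.assoc c, ← hc', Category.assoc,
      Category.assoc, h0, comp_zero]
  have h2 : f ≫ 𝒮.top a' n rfl = 0 := by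
    by_contra h0
    have := 𝒮.isIso_of_soc_top (e.inv ≫ f) h1 (by
      rw [Category.assoc]
      exact fun h3 ↦ h0 ((cancel_epi e.inv).1 (h3.trans comp_zero.symm)))
    exact hf (IsIso.of_isIso_comp_left e.inv f)
  cases n with
  | zero =>
    refine (h1 ?_).elim
    rw [(cancel_mono (𝒮.top a' 0 rfl)).1 (h2.trans zero_comp.symm), comp_zero, comp_zero]
  | succ n =>
    obtain ⟨l, hl⟩ := (𝒮.ses_ι_top a' n rfl).lift f h2
    exact ⟨n, rfl, l, by simpa using hl⟩

/-- The left almost split property of uniserial objects. -/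
theorem left_almost_split {X : C} (hX : Indecomposable X) {a : ℤ} {n : ℕ}
    (f : 𝒮.V a n ⟶ X) (hf : ¬ IsIso f) :
    (∃ l, 𝒮.ι a n ≫ l = f) ∨ ∃ (m : ℕ) (hm : n = m + 1) (l : 𝒮.V (a + 1) m ⟶ X),
      𝒮.π a rfl m ≫ l = eqToHom (by rw [hm]) ≫ f := by
  rcases 𝒮.extend_or a n rfl f with hl | ⟨c, hc⟩
  · exact Or.inl hl
  right
  obtain ⟨b, m, ⟨e⟩⟩ := 𝒮.isUniserial_of_comp_ne_zero' hX f c hc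
  obtain ⟨c', hc'⟩ := 𝒮.eq_top_comp b m rfl (e.inv ≫ c)
  have h1 : (f ≫ e.hom) ≫ 𝒮.top b m rfl ≠ 0 := by
    intro h0
    apply hc
    rw [← Category.id_comp c, ← e.hom_inv_id, Category.assoc, ← hc', ← Category.assoc,
      ← Category.assoc, h0, zero_comp]
  have h2 : 𝒮.soc a n ≫ f = 0 := by
    by_contra h0
    have := 𝒮.isIso_of_soc_top (f ≫ e.hom) (by
      rw [← Category.assoc]
      exact fun h3 ↦ h0 ((cancel_mono e.hom).1 (h3.trans zero_comp.symm))) h1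
    exact hf (IsIso.of_isIso_comp_right f e.hom)
  cases n with
  | zero =>
    refine (h1 ?_).elim
    rw [(cancel_epi (𝒮.soc a 0)).1 (h2.trans comp_zero.symm), zero_comp, zero_comp]
  | succ n =>
    obtain ⟨l, hl⟩ := (𝒮.ses_soc_π a rfl n).desc f h2
    exact ⟨n, rfl, l, by simpa using hl⟩

end ARDuality.SimpleSystem

end Uniserial

/-! ### Periodic systems: objects between bricks are uniserial, and convexity. -/

section Periodic

variable {k : Type t} [Field k] [IsAlgClosed k] {C : Type u} [Category.{v} C] [Abelian C]
  [Linear k C] {T : ARDuality k C} (𝒮 : T.SimpleSystem)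

namespace ARDuality.SimpleSystem

theorem exists_comp_ne_zero_of_src {a : ℤ} {n : ℕ} {X : C} (f : 𝒮.V a n ⟶ X) (hf : f ≠ 0) :
    ∃ (j : ℤ) (c : 𝒮.S j ⟶ X), c ≠ 0 := by
  by_cases h0 : 𝒮.soc a n ≫ f = 0
  · cases n with
    | zero => exact (hf ((cancel_epi (𝒮.soc a 0)).1 (h0.trans comp_zero.symm))).elim
    | succ n =>
      obtain ⟨f', rfl⟩ := (𝒮.ses_soc_π a rfl n).desc f h0
      exact exists_comp_ne_zero_of_src f' fun h ↦ hf (by rw [h, comp_zero])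
  · exact ⟨a, _, h0⟩

theorem exists_comp_ne_zero_of_tgt {a : ℤ} {n : ℕ} {X : C} (f : X ⟶ 𝒮.V a n) (hf : f ≠ 0) :
    ∃ (j : ℤ) (c : X ⟶ 𝒮.S j), c ≠ 0 := by
  by_cases h0 : f ≫ 𝒮.top a n rfl = 0
  · cases n with
    | zero => exact (hf ((cancel_mono (𝒮.top a 0 rfl)).1 (h0.trans zero_comp.symm))).elim
    | succ n =>
      obtain ⟨f', rfl⟩ := (𝒮.ses_ι_top a n rfl).lift f h0
      exact exists_comp_ne_zero_of_tgt f' fun h ↦ hf (by rw [h, zero_comp])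
  · exact ⟨_, _, h0⟩

/-- The system has period `s`. -/
def HasPeriod (s : ℕ) : Prop := 0 < s ∧ ∀ a, Nonempty (𝒮.S (a + s) ≅ 𝒮.S a)

theorem nonempty_iso_pred {a b : ℤ} (h : Nonempty (𝒮.S (a + 1) ≅ 𝒮.S (b + 1))) :
    Nonempty (𝒮.S a ≅ 𝒮.S b) :=
  h.map fun e ↦ (𝒮.iso rfl).symm ≪≫ T.τ.mapIso e ≪≫ 𝒮.iso rfl

theorem nonempty_iso_succ {a b : ℤ} (h : Nonempty (𝒮.S a ≅ 𝒮.S b)) :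
    Nonempty (𝒮.S (a + 1) ≅ 𝒮.S (b + 1)) :=
  h.map fun e ↦ T.τ.preimageIso (𝒮.iso rfl ≪≫ e ≪≫ (𝒮.iso rfl).symm)

theorem nonempty_iso_add {a b : ℤ} (h : Nonempty (𝒮.S a ≅ 𝒮.S b)) (m : ℤ) :
    Nonempty (𝒮.S (a + m) ≅ 𝒮.S (b + m)) := by
  induction m using Int.induction_on with
  | zero => simpa using h
  | succ n ih => simpa only [add_assoc] using 𝒮.nonempty_iso_succ ih
  | pred n ih =>
    apply 𝒮.nonempty_iso_pred
    simpa only [add_assoc, sub_add_cancel] using ih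

/-- A period for which the bricks indexed by `0, …, s - 1` are pairwise non-isomorphic. -/
def HasMinimalPeriod (s : ℕ) : Prop :=
  𝒮.HasPeriod s ∧ ∀ i < s, ∀ j < s, Nonempty (𝒮.S i ≅ 𝒮.S j) → i = j

variable {𝒮} in
theorem HasPeriod.exists_minimal {s : ℕ} (h : 𝒮.HasPeriod s) : ∃ s, 𝒮.HasMinimalPeriod s := by
  classical
  have hex : ∃ s, 𝒮.HasPeriod s := ⟨s, h⟩
  refine ⟨Nat.find hex, Nat.find_spec hex, ?_⟩
  have key : ∀ i < Nat.find hex, ∀ j < i, ¬ Nonempty (𝒮.S i ≅ 𝒮.S j) := fun i hi j hj he ↦ by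
    refine Nat.find_min hex (m := i - j) (by omega) ⟨by omega, fun a ↦ ?_⟩
    have := 𝒮.nonempty_iso_add he (a - j)
    rwa [show (i : ℤ) + (a - j) = a + (i - j : ℕ) by push_cast [hj.le]; ring,
      add_sub_cancel] at this
  intro i hi j hj he
  by_contra hne
  rcases lt_or_gt_of_ne hne with h | h
  · exact key j hj i h (he.map Iso.symm)
  · exact key i hi j h he

variable {𝒮} {s : ℕ}

theorem HasPeriod.nonempty_iso (h : 𝒮.HasPeriod s) (a m : ℤ) :
    Nonempty (𝒮.S (a + s * m) ≅ 𝒮.S a) := by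
  induction m using Int.induction_on with
  | zero => rw [mul_zero, add_zero]; exact ⟨Iso.refl _⟩
  | succ n ih =>
    obtain ⟨e⟩ := ih
    obtain ⟨e'⟩ := h.2 (a + s * n)
    exact ⟨eqToIso (by congr 1; ring) ≪≫ e' ≪≫ e⟩
  | pred n ih =>
    obtain ⟨e⟩ := ih
    obtain ⟨e'⟩ := h.2 (a + s * (-n - 1))
    exact ⟨e'.symm ≪≫ eqToIso (by congr 1; ring) ≪≫ e⟩

theorem HasPeriod.exists_rep (h : 𝒮.HasPeriod s) (a : ℤ) :
    ∃ i < s, Nonempty (𝒮.S a ≅ 𝒮.S (i : ℕ)) := by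
  have hs : (0 : ℤ) < s := by exact_mod_cast h.1
  have h1 := Int.emod_nonneg a hs.ne'
  have h2 := Int.emod_lt_of_pos a hs
  refine ⟨(a % s).toNat, by omega, ?_⟩
  obtain ⟨e⟩ := h.nonempty_iso (a % s) (a / s)
  exact ⟨eqToIso (by rw [Int.emod_add_mul_ediv]) ≪≫ e ≪≫ eqToIso (by rw [Int.toNat_of_nonneg h1])⟩

variable (𝒮) in
/-- The dimension of `Hom(Y, S a)`. -/
noncomputable def dim (Y : C) (a : ℤ) : ℕ := Module.finrank k (Y ⟶ 𝒮.S a)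

theorem dim_congr (Y : C) {a b : ℤ} (h : Nonempty (𝒮.S a ≅ 𝒮.S b)) : 𝒮.dim Y a = 𝒮.dim Y b := by
  obtain ⟨e⟩ := h
  exact LinearEquiv.finrank_eq (Linear.homCongr k (Iso.refl Y) e)

variable (𝒮 s) in
/-- The total dimension of the morphisms to the bricks of one period. -/
noncomputable def totalDim (Y : C) : ℕ := ∑ j ∈ Finset.range s, 𝒮.dim Y j

theorem HasPeriod.sum_dim_add (h : 𝒮.HasPeriod s) (Y : C) (m : ℕ) :
    ∑ j ∈ Finset.range s, 𝒮.dim Y (j + m) = 𝒮.totalDim s Y := by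
  induction m with
  | zero => simp [totalDim]
  | succ m ih =>
    rw [← ih]
    have h1 := Finset.sum_range_succ (fun j : ℕ ↦ 𝒮.dim Y (j + m)) s
    have h2 := Finset.sum_range_succ' (fun j : ℕ ↦ 𝒮.dim Y (j + m)) s
    have h3 : 𝒮.dim Y ((s : ℤ) + m) = 𝒮.dim Y ((0 : ℕ) + m) := by
      apply dim_congr
      have := h.2 m
      rwa [add_comm, Nat.cast_zero, zero_add]
    have h4 : ∀ j : ℕ, 𝒮.dim Y (((j + 1 : ℕ) : ℤ) + m) = 𝒮.dim Y (j + (m + 1 : ℕ)) := by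
      intro j; congr 1; push_cast; ring
    simp only [h4] at h2
    omega

/-- The total over one period is invariant under translation, so a termwise inequality together with
the reverse inequality of totals is a termwise equality. -/
theorem HasPeriod.dim_eq_of_totalDim_le (h : 𝒮.HasPeriod s) {Y Z : C} (m : ℕ)
    (hle : ∀ a, 𝒮.dim Z a ≤ 𝒮.dim Y (a + m)) (htot : 𝒮.totalDim s Y ≤ 𝒮.totalDim s Z) (a : ℤ) :
    𝒮.dim Z a = 𝒮.dim Y (a + m) := by
  have heq : ∀ j ∈ Finset.range s, 𝒮.dim Z j = 𝒮.dim Y (j + m) :=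
    (Finset.sum_eq_sum_iff_of_le fun (j : ℕ) _ ↦ hle j).1
      (le_antisymm (Finset.sum_le_sum fun (j : ℕ) _ ↦ hle j)
        (by rw [h.sum_dim_add]; exact htot))
  obtain ⟨i, hi, he⟩ := h.exists_rep a
  rw [dim_congr Z he, heq i (Finset.mem_range.2 hi), dim_congr Y (𝒮.nonempty_iso_add he m)]

theorem exists_eq_smul_iso {a b : ℤ} (e : 𝒮.S a ≅ 𝒮.S b) (f : 𝒮.S a ⟶ 𝒮.S b) :
    ∃ c : k, f = c • e.hom := by
  obtain ⟨c, hc⟩ := 𝒮.exists_eq_smul a (f ≫ e.inv)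
  exact ⟨c, by rw [← cancel_mono e.inv, hc]; simp⟩

/-- A universal morphism from `Y` to a finite direct sum of bricks. -/
theorem HasMinimalPeriod.exists_universal (h : 𝒮.HasMinimalPeriod s) (Y : C) :
    ∃ (J : Type) (_ : Fintype J) (d : J → ℤ) (Q : C) (u : Y ⟶ Q) (inc : ∀ x, 𝒮.S (d x) ⟶ Q)
      (pr : ∀ x, Q ⟶ 𝒮.S (d x)), ∑ x, pr x ≫ inc x = 𝟙 Q ∧
      (∀ (a : ℤ) (f : Y ⟶ 𝒮.S a), ∃ f', u ≫ f' = f) ∧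
      ∀ a, Module.finrank k (𝒮.S a ⟶ Q) ≤ 𝒮.dim Y a := by
  classical
  have hfin := T.finite
  have : HasFiniteBiproducts C := HasFiniteBiproducts.of_hasFiniteProducts
  let J := Σ j : Fin s, Fin (𝒮.dim Y j)
  let B (j : Fin s) := Module.finBasis k (Y ⟶ 𝒮.S j)
  let Q := ⨁ fun x : J ↦ 𝒮.S (x.1 : ℕ)
  refine ⟨J, inferInstance, fun x ↦ (x.1 : ℕ), Q, biproduct.lift fun x ↦ B x.1 x.2,
    fun x ↦ biproduct.ι (fun x : J ↦ 𝒮.S (x.1 : ℕ)) x,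
    fun x ↦ biproduct.π (fun x : J ↦ 𝒮.S (x.1 : ℕ)) x, biproduct.total, fun a f ↦ ?_, fun a ↦ ?_⟩
  · obtain ⟨i, hi, ⟨e⟩⟩ := h.1.exists_rep a
    refine ⟨(∑ l, (B ⟨i, hi⟩).repr (f ≫ e.hom) l •
      biproduct.π (fun x : J ↦ 𝒮.S (x.1 : ℕ)) ⟨⟨i, hi⟩, l⟩) ≫ e.inv, ?_⟩
    rw [← Category.assoc, Preadditive.comp_sum]
    simp only [Linear.comp_smul, biproduct.lift_π]
    rw [(B ⟨i, hi⟩).sum_repr, Category.assoc, e.hom_inv_id, Category.comp_id]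
  · obtain ⟨i, hi, ⟨e⟩⟩ := h.1.exists_rep a
    rw [dim_congr Y ⟨e⟩]
    let φ : (Fin (𝒮.dim Y i) → k) →ₗ[k] (𝒮.S a ⟶ Q) :=
      ∑ l, (LinearMap.proj l).smulRight
        (e.hom ≫ biproduct.ι (fun x : J ↦ 𝒮.S (x.1 : ℕ)) ⟨⟨i, hi⟩, l⟩)
    have hφ : Function.Surjective φ := by
      intro f
      choose c hc using fun l : Fin (𝒮.dim Y i) ↦ exists_eq_smul_iso e
        (f ≫ biproduct.π (fun x : J ↦ 𝒮.S (x.1 : ℕ)) ⟨⟨i, hi⟩, l⟩)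
      refine ⟨c, ?_⟩
      have hφc : φ c = ∑ l, c l • (e.hom ≫ biproduct.ι (fun x : J ↦ 𝒮.S (x.1 : ℕ)) ⟨⟨i, hi⟩, l⟩) := by
        simp [φ, LinearMap.sum_apply]
      rw [hφc]
      refine biproduct.hom_ext _ _ fun ⟨⟨j, hj⟩, l⟩ ↦ ?_
      by_cases hij : i = j
      · subst hij
        rw [hc, Preadditive.sum_comp, Finset.sum_eq_single l]
        · simp
        · intro l' _ hl'
          rw [Linear.smul_comp, Category.assoc, biproduct.ι_π_ne, comp_zero, smul_zero]
          intro h'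
          exact hl' (eq_of_heq (Sigma.mk.inj h').2)
        · simp
      -- By minimality of the period, bricks with different indices below `s` are not isomorphic. So
      -- `Hom(S a, Q)` only sees the copies of the representative of `S a`.
      · have h1 : ∀ g : 𝒮.S a ⟶ 𝒮.S j, g = 0 := fun g ↦ by
          by_contra hg
          have := 𝒮.isIso g hg
          exact hij (h.2 i hi j hj ⟨e.symm ≪≫ asIso g⟩)
        exact (h1 _).trans (h1 _).symm
    have := LinearMap.finrank_le_finrank_of_surjective hφ
    simpa using this

variable (𝒮) in
/-- The indecomposable objects which are not uniserial, have a nonzero morphism to a brick, and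
receive a nonzero morphism which is killed by all morphisms to uniserial objects. -/
structure IsCritical (Y : C) : Prop where
  indecomposable : Indecomposable Y
  not_isUniserial : ¬ 𝒮.IsUniserial Y
  exists_ne_zero : ∃ (j : ℤ) (f : Y ⟶ 𝒮.S j), f ≠ 0
  exists_comp_eq_zero : ∃ (G : C) (g : G ⟶ Y), g ≠ 0 ∧
    ∀ (a : ℤ) (n : ℕ) (f : Y ⟶ 𝒮.V a n), g ≫ f = 0

variable (𝒮 s) in
/-- A critical object of minimal total dimension. -/
def IsMinimalCritical (Y : C) : Prop :=
  𝒮.IsCritical Y ∧ ∀ Z, 𝒮.IsCritical Z → 𝒮.totalDim s Y ≤ 𝒮.totalDim s Z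

theorem dim_le_of_retract {Y Z : C} (i : Y ⟶ Z) (p : Z ⟶ Y) (hip : i ≫ p = 𝟙 Y) (a : ℤ) :
    𝒮.dim Y a ≤ 𝒮.dim Z a := by
  have := T.finite Z (𝒮.S a)
  refine LinearMap.finrank_le_finrank_of_injective (f := Linear.leftComp k (𝒮.S a) p) ?_
  intro f g hfg
  have := congrArg (i ≫ ·) hfg
  simpa [reassoc_of% hip] using this

theorem surjective_of_dim_eq {Y Z : C} (i : Y ⟶ Z) (p : Z ⟶ Y) (hip : i ≫ p = 𝟙 Y) {a : ℤ}
    (h : 𝒮.dim Y a = 𝒮.dim Z a) (f : Z ⟶ 𝒮.S a) : ∃ g, p ≫ g = f := by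
  have := T.finite Z (𝒮.S a)
  have := T.finite Y (𝒮.S a)
  have hinj : Function.Injective (Linear.leftComp k (𝒮.S a) p) := by
    intro f g hfg
    have := congrArg (i ≫ ·) hfg
    simpa [reassoc_of% hip] using this
  exact (LinearMap.injective_iff_surjective_of_finrank_eq_finrank h).1 hinj f

/-- The universal morphism from a minimal critical object to a direct sum of bricks is an
epimorphism, and its kernel is again a minimal critical object. -/
theorem IsMinimalCritical.exists_ses (h : 𝒮.HasMinimalPeriod s) {Y : C}
    (hY : 𝒮.IsMinimalCritical s Y) : ∃ (Z Q : C) (i : Z ⟶ Y) (u : Y ⟶ Q), Ses i u ∧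
      𝒮.IsMinimalCritical s Z ∧ (∀ (a : ℤ) (f : Y ⟶ 𝒮.S a), ∃ f', u ≫ f' = f) ∧
      (∀ (b j : ℤ) (f : Q ⟶ 𝒮.V b 1) (g : 𝒮.V b 1 ⟶ 𝒮.S j), f ≫ g = 0) ∧
      ∀ (j : ℤ) (f : Q ⟶ 𝒮.S j), f ≠ 0 → Epi f := by
  have hfin := T.finite
  obtain ⟨J, _, d, Q, u, inc, pr, htot, huniv, hdim⟩ := h.exists_universal Y
  obtain ⟨hcrit, hmin⟩ := hY
  obtain ⟨Z, i, hses⟩ : ∃ (Z : C) (i : Z ⟶ Y), Ses i (factorThruImage u) :=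
    ⟨_, _, Ses.of_kernel _⟩
  have hiZ : ∀ (a : ℤ) (f : Y ⟶ 𝒮.S a), i ≫ f = 0 := fun a f ↦ by
    obtain ⟨f', rfl⟩ := huniv a f
    rw [← image.fac u, Category.assoc, ← Category.assoc, hses.w, zero_comp]
  have : Mono (T.τ.map (image.ι u)) := inferInstance
  -- `τ Q` is again a finite sum of bricks, so morphisms into it, and into its subobject `τ (image
  -- u)`, are detected by bricks.
  have hQ0 : ∀ {W : C} (w : W ⟶ T.τ.obj Q), (∀ (a : ℤ) (f : T.τ.obj Q ⟶ 𝒮.S a), w ≫ f = 0) →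
      w = 0 := by
    intro W w hw
    have h1 : ∀ x, w ≫ T.τ.map (pr x) = 0 := by
      intro x
      have h2 := hw (d x - 1) (T.τ.map (pr x) ≫ (𝒮.iso (sub_add_cancel _ _)).hom)
      rw [← Category.assoc] at h2
      exact (cancel_mono _).1 (h2.trans zero_comp.symm)
    rw [← Category.comp_id w, ← T.τ.map_id, ← htot, T.τ.map_sum, Preadditive.comp_sum]
    exact Finset.sum_eq_zero fun x _ ↦ by rw [T.τ.map_comp, ← Category.assoc, h1, zero_comp]
  have hP0 : ∀ {W : C} (w : W ⟶ T.τ.obj (image u)), (∀ (a : ℤ) (f : T.τ.obj Q ⟶ 𝒮.S a),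
      w ≫ T.τ.map (image.ι u) ≫ f = 0) → w = 0 := by
    intro W w hw
    have h1 := hQ0 (w ≫ T.τ.map (image.ι u)) fun a f ↦ by rw [Category.assoc, hw]
    exact (cancel_mono (T.τ.map (image.ι u))).1 (h1.trans zero_comp.symm)
  -- nonzero direct summands of the kernel have nonzero morphisms to bricks
  have hsummand : ∀ {Z' : C} (j : Z' ⟶ Z) (r : Z ⟶ Z'), j ≫ r = 𝟙 Z' → ¬ IsZero Z' →
      ∃ (a : ℤ) (f : Z' ⟶ 𝒮.S a), f ≠ 0 := by
    intro Z' j r hjr hZ'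
    by_contra! h0
    -- Without morphisms from `Z'` to bricks there is no obstruction to extending the retraction to
    -- `Y`. Then `Z'` is all of the indecomposable `Y`, which does have such a morphism.
    obtain ⟨e, he⟩ := T.exists_extend hses r fun w ↦ by
      rw [hP0 w fun a f ↦ h0 _ _, comp_zero]
    obtain ⟨h1, -⟩ := isIso_of_retract hcrit.indecomposable (j ≫ i) e
      (by rw [Category.assoc, he, hjr]) hZ'
    obtain ⟨a, f, hf⟩ := hcrit.exists_ne_zero
    apply hf
    rw [← cancel_epi (j ≫ i), h0 a ((j ≫ i) ≫ f), comp_zero]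
  obtain ⟨G, g, hg0, hg⟩ := hcrit.exists_comp_eq_zero
  obtain ⟨g', hg'⟩ := hses.lift g (by
    rw [← cancel_mono (image.ι u), Category.assoc, image.fac, zero_comp, ← Category.comp_id u,
      ← htot, Preadditive.comp_sum, Preadditive.comp_sum]
    refine Finset.sum_eq_zero fun x _ ↦ ?_
    have h1 : g ≫ u ≫ pr x = 0 := by
      rw [← cancel_mono (𝒮.soc (d x) 0), Category.assoc, hg, zero_comp]
    rw [← Category.assoc u, ← Category.assoc, h1, zero_comp])
  have hg'0 : g' ≠ 0 := by rintro rfl; exact hg0 (by rw [← hg', zero_comp])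
  obtain ⟨Z₁, j, p, hZ₁, hjp, hgp⟩ :=
    exists_indecomposable_summand_tgt k (fun X ↦ T.finite X X) Z g' hg'0
  have hkill : ∀ (a : ℤ) (n : ℕ) (f : Z₁ ⟶ 𝒮.V a n), (g' ≫ p) ≫ f = 0 := by
    -- After enlarging the target by `ι`, which dies in all bricks, the morphism extends to `Y`.
    -- There it is killed by `g`, and `ι` can be cancelled.
    intro a n f
    obtain ⟨e, he⟩ := T.exists_extend hses (p ≫ f ≫ 𝒮.ι a n) fun w ↦ by
      have : 𝒮.ι a n ≫ w = 0 := hP0 _ fun b f ↦ by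
        rw [Category.assoc, ι_comp_eq_zero]
      simp [this]
    rw [← cancel_mono (𝒮.ι a n), zero_comp]
    have := hg a (n + 1) e
    rw [← hg', Category.assoc, he] at this
    simpa using this
  have hcrit₁ : 𝒮.IsCritical Z₁ :=
    { indecomposable := hZ₁
      not_isUniserial := by
        rintro ⟨a, n, ⟨e⟩⟩
        exact hgp ((cancel_mono e.hom).1 ((hkill a n e.hom).trans zero_comp.symm))
      exists_ne_zero := hsummand j p hjp hZ₁.1
      exists_comp_eq_zero := ⟨G, g' ≫ p, hgp, hkill⟩ }
  -- comparison of dimensions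
  obtain ⟨η, hη⟩ := T.exists_class hses
  have hZP : ∀ a, 𝒮.dim Z a ≤ Module.finrank k (𝒮.S a ⟶ T.τ.obj (image u)) := by
    intro a
    rw [← Subspace.dual_finrank_eq]
    let φ : (Z ⟶ 𝒮.S a) →ₗ[k] Module.Dual k (𝒮.S a ⟶ T.τ.obj (image u)) :=
      { toFun := fun h ↦ η ∘ₗ Linear.leftComp k _ h
        map_add' := by intros; ext; simp
        map_smul' := by intros; ext; simp }
    refine LinearMap.finrank_le_finrank_of_injective (f := φ) ?_
    rw [← LinearMap.ker_eq_bot, LinearMap.ker_eq_bot']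
    intro h hh
    obtain ⟨e, he⟩ := (hη.2 _ h).2 fun w ↦ LinearMap.congr_fun hh w
    rw [← he, hiZ]
  have hPQ : ∀ a, Module.finrank k (𝒮.S a ⟶ T.τ.obj (image u)) ≤
      Module.finrank k (𝒮.S a ⟶ T.τ.obj Q) := fun a ↦
    LinearMap.finrank_le_finrank_of_injective
      (f := Linear.rightComp k (𝒮.S a) (T.τ.map (image.ι u))) fun f g hfg ↦
        (cancel_mono (T.τ.map (image.ι u))).1 hfg
  have hQY : ∀ a, Module.finrank k (𝒮.S a ⟶ T.τ.obj Q) ≤ 𝒮.dim Y (a + 1) := by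
    intro a
    refine le_trans (le_of_eq ?_) (hdim (a + 1))
    rw [LinearEquiv.finrank_eq (Linear.homCongr k (𝒮.iso rfl).symm (Iso.refl (T.τ.obj Q)))]
    exact (LinearEquiv.finrank_eq (LinearEquiv.ofBijective (T.τ.mapLinearMap k)
      ⟨T.τ.map_injective, T.τ.map_surjective⟩)).symm
  have hZ₁Z := fun a ↦ dim_le_of_retract (𝒮 := 𝒮) j p hjp a
  have hZY : ∀ a, 𝒮.dim Z a ≤ 𝒮.dim Y (a + (1 : ℕ)) := fun a ↦
    (hZP a).trans ((hPQ a).trans (hQY a))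
  -- Restriction of morphisms from `Y` to bricks is zero on `Z`, so `Hom(Z, S a)` embeds in the dual
  -- of `Hom(S a, τ (image u))`. The latter Hom space lies in `Hom(S a, τ Q) ≅ Hom(S (a + 1), Q)`.
  -- Minimality of `Y` turns the whole chain of inequalities into equalities.
  have heq := h.1.dim_eq_of_totalDim_le (Y := Y) (Z := Z₁) 1
    (fun a ↦ (hZ₁Z a).trans (hZY a)) (hmin Z₁ hcrit₁)
  have heq' : ∀ a, 𝒮.dim Z₁ a = 𝒮.dim Z a := fun a ↦
    le_antisymm (hZ₁Z a) ((hZY a).trans (heq a).ge)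
  have htot₁ : 𝒮.totalDim s Z₁ = 𝒮.totalDim s Y := by
    rw [← h.1.sum_dim_add Y 1]
    exact Finset.sum_congr rfl fun j _ ↦ heq j
  -- the kernel is indecomposable
  have hpj : p ≫ j = 𝟙 Z := by
    have h1 : Ses (kernel.ι p) p := by
      have : Epi p := ⟨fun f g hfg ↦ by simpa [reassoc_of% hjp] using congrArg (j ≫ ·) hfg⟩
      exact Ses.of_kernel p
    obtain ⟨r, hr⟩ := h1.lift (𝟙 Z - p ≫ j) (by simp [Preadditive.sub_comp, hjp])
    have hr' : kernel.ι p ≫ r = 𝟙 _ := by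
      have := h1.mono
      rw [← cancel_mono (kernel.ι p), Category.assoc, hr, Preadditive.comp_sub,
        reassoc_of% h1.w]
      simp
    have h2 : IsZero (kernel p) := by
      by_contra h3
      obtain ⟨a, f, hf⟩ := hsummand (kernel.ι p) r hr' h3
      obtain ⟨f', hf'⟩ := surjective_of_dim_eq j p hjp (heq' a) (r ≫ f)
      apply hf
      rw [← Category.id_comp f, ← hr', Category.assoc, ← hf', ← Category.assoc, h1.w, zero_comp]
    rw [h2.eq_of_tgt r 0, zero_comp] at hr
    exact (sub_eq_zero.1 hr.symm).symm
  -- the universal morphism is an epimorphism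
  have hlift : ∀ x, ∃ w : 𝒮.S (d x) ⟶ image u, w ≫ image.ι u = inc x := by
    intro x
    have hd := sub_add_cancel (d x) 1
    -- The equalities force every morphism from this brick to `τ Q` to factor through `τ (image u)`.
    -- Undoing `τ` shows that each inclusion of a summand of `Q` factors through the image.
    have hfr : Module.finrank k (𝒮.S (d x - 1) ⟶ T.τ.obj (image u)) =
        Module.finrank k (𝒮.S (d x - 1) ⟶ T.τ.obj Q) :=
      le_antisymm (hPQ _) ((hQY _).trans ((heq (d x - 1)).ge.trans ((heq' _).le.trans (hZP _))))
    have hinj : Function.Injective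
        (Linear.rightComp k (𝒮.S (d x - 1)) (T.τ.map (image.ι u))) := fun f g hfg ↦
      (cancel_mono (T.τ.map (image.ι u))).1 hfg
    obtain ⟨v, hv⟩ := (LinearMap.injective_iff_surjective_of_finrank_eq_finrank hfr).1 hinj
      ((𝒮.iso hd).inv ≫ T.τ.map (inc x))
    obtain ⟨w, hw⟩ := T.τ.map_surjective ((𝒮.iso hd).hom ≫ v)
    refine ⟨w, T.τ.map_injective ?_⟩
    have hv' : v ≫ T.τ.map (image.ι u) = (𝒮.iso hd).inv ≫ T.τ.map (inc x) := hv
    rw [T.τ.map_comp, hw, Category.assoc, hv', Iso.hom_inv_id_assoc]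
  choose w hw using hlift
  have hepi : Epi (image.ι u) := by
    refine ⟨fun f g hfg ↦ ?_⟩
    rw [← Category.id_comp f, ← Category.id_comp g, ← htot, Preadditive.sum_comp,
      Preadditive.sum_comp]
    exact Finset.sum_congr rfl fun x _ ↦ by simp [← hw, hfg]
  have huepi : Epi u := by
    rw [← image.fac u]
    exact epi_comp _ _
  have hu0 : ∀ {W : C} (f : Q ⟶ W), f ≠ 0 → ∃ x, inc x ≫ f ≠ 0 := by
    intro W f hf
    by_contra! h0
    apply hf
    rw [← Category.id_comp f, ← htot, Preadditive.sum_comp]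
    exact Finset.sum_eq_zero fun x _ ↦ by rw [Category.assoc, h0, comp_zero]
  have hji : Mono (j ≫ i) := by
    have := hses.mono
    have : Mono j := ⟨fun f g hfg ↦ by simpa [hjp] using congrArg (· ≫ p) hfg⟩
    exact mono_comp _ _
  refine ⟨Z₁, Q, j ≫ i, u, Ses.of_lift ?_ ?_, ⟨hcrit₁, fun Z' hZ' ↦ htot₁.le.trans (hmin Z' hZ')⟩,
    huniv, fun b l f g ↦ ?_, fun l f hf ↦ ?_⟩
  · rw [← image.fac u, Category.assoc, reassoc_of% hses.w, zero_comp, comp_zero]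
  · intro W x hx
    obtain ⟨y, rfl⟩ := hses.lift x (by
      rw [← cancel_mono (image.ι u), Category.assoc, image.fac, hx, zero_comp])
    exact ⟨y ≫ p, by rw [Category.assoc, reassoc_of% hpj]⟩
  · by_contra h0
    obtain ⟨x, hx⟩ := hu0 _ h0
    exact hx (by rw [← Category.assoc, 𝒮.comp_top_succ_eq_zero])
  · obtain ⟨x, hx⟩ := hu0 f hf
    have := 𝒮.isIso _ hx
    exact epi_of_epi (inc x) f

/-- Induction on the length: the kernel of the universal morphism is again minimal critical and maps
onto the maximal subobject `V a n`, while `Y` maps onto the top through that universal morphism. -/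
theorem IsMinimalCritical.epi (h : 𝒮.HasMinimalPeriod s) {Y : C}
    (hY : 𝒮.IsMinimalCritical s Y) {a : ℤ} {n : ℕ} (g : Y ⟶ 𝒮.V a n)
    (hg : g ≫ 𝒮.top a n rfl ≠ 0) : Epi g := by
  induction n generalizing Y a with
  | zero =>
    obtain ⟨Z, Q, i, u, hs, hZ, huniv, hQ, hQe⟩ := hY.exists_ses h
    obtain ⟨f, hf⟩ := huniv _ (g ≫ 𝒮.top a 0 rfl)
    have := hQe _ f (by rintro rfl; exact hg (by rw [← hf, comp_zero]))
    have := hs.epi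
    have h1 : g = (u ≫ f) ≫ inv (𝒮.top a 0 rfl) := by simp [hf]
    rw [h1]
    infer_instance
  | succ n ih =>
    obtain ⟨Z, Q, i, u, hs, hZ, huniv, hQ, hQe⟩ := hY.exists_ses h
    obtain ⟨f, hf⟩ := huniv _ (g ≫ 𝒮.top a (n + 1) rfl)
    have := hQe _ f (by rintro rfl; exact hg (by rw [← hf, comp_zero]))
    have := hs.epi
    obtain ⟨g', hg', hgt⟩ := 𝒮.exists_lift_hits_top hs hQ g
      (by rw [← hf, ← Category.assoc, hs.w, zero_comp]) hg
    have := ih hZ g' hgt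
    refine Preadditive.epi_of_cancel_zero _ fun {W} x hx ↦ ?_
    have h1 : 𝒮.ι a n ≫ x = 0 := by
      rw [← cancel_epi g', ← Category.assoc, hg', Category.assoc, hx, comp_zero, comp_zero]
    obtain ⟨x, rfl⟩ := (𝒮.ses_ι_top a n rfl).desc x h1
    have h2 : x = 0 := by
      rw [← Category.assoc, ← hf] at hx
      exact (cancel_epi (u ≫ f)).1 (hx.trans comp_zero.symm)
    rw [h2, comp_zero]

/-- A critical object and a non-uniserial indecomposable object which receives a nonzero morphism
from a brick do not coexist. -/
theorem IsCritical.isUniserial (hs : ∃ s, 𝒮.HasPeriod s) {Y X : C} (hY : 𝒮.IsCritical Y)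
    (hX : Indecomposable X) {j : ℤ} (c : 𝒮.S j ⟶ X) (hc : c ≠ 0) : 𝒮.IsUniserial X := by
  classical
  obtain ⟨s, hs⟩ := hs
  obtain ⟨s, h⟩ := hs.exists_minimal
  by_contra hX'
  obtain ⟨Y, hY⟩ : ∃ Y, 𝒮.IsMinimalCritical s Y := by
    have hex : ∃ n Y, 𝒮.IsCritical Y ∧ 𝒮.totalDim s Y = n := ⟨_, Y, hY, rfl⟩
    obtain ⟨Z, hZ, hn⟩ := Nat.find_spec hex
    exact ⟨Z, hZ, fun Z' hZ' ↦ hn.le.trans (Nat.find_min' hex ⟨Z', hZ', rfl⟩)⟩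
  obtain ⟨t, f₀, hf₀⟩ := hY.1.exists_ne_zero
  -- The critical object `Y` is not uniserial, so nothing obstructs lifting. Morphisms to uniserial
  -- objects of every length with top `S t` arise, and all of them are epimorphisms.
  have hstep : ∀ (M : ℕ) (f : Y ⟶ 𝒮.V (t - M) M), ∃ f' : Y ⟶ 𝒮.V (t - (M + 1 : ℕ)) (M + 1),
      f' ≫ 𝒮.π _ (by push_cast; ring) M = f := fun M f ↦
    𝒮.exists_lift_π hY.1.indecomposable hY.1.not_isUniserial _ f
  choose l hl using hstep
  let F : ∀ M : ℕ, Y ⟶ 𝒮.V (t - M) M := fun M ↦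
    Nat.rec (motive := fun M ↦ Y ⟶ 𝒮.V (t - M) M)
      (f₀ ≫ eqToHom (by simp) ≫ 𝒮.soc (t - (0 : ℕ)) 0) (fun M f ↦ l M f) M
  have hF : ∀ M, F (M + 1) ≫ 𝒮.π _ (by push_cast; ring) M = F M := fun M ↦ hl M (F M)
  have hFtop : ∀ M, F M ≫ 𝒮.top _ M rfl ≠ 0 := by
    intro M
    induction M with
    | zero =>
      intro h0
      have h1 : F 0 = 0 := (cancel_mono (𝒮.top _ 0 rfl)).1 (h0.trans zero_comp.symm)
      apply hf₀
      have h2 : f₀ ≫ eqToHom (by simp) ≫ 𝒮.soc (t - (0 : ℕ)) 0 = 0 := h1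
      rw [← Category.assoc] at h2
      exact (cancel_mono (eqToHom (by simp : 𝒮.S t = 𝒮.S (t - (0 : ℕ))))).1
        (((cancel_mono (𝒮.soc (t - (0 : ℕ)) 0)).1 (h2.trans zero_comp.symm)).trans zero_comp.symm)
    | succ M ih =>
      intro h0
      apply ih
      rw [← hF M, Category.assoc]
      obtain ⟨g, hg⟩ := 𝒮.eq_top_comp _ (M + 1) rfl
        (𝒮.π (t - (M + 1 : ℕ)) (by push_cast; ring) M ≫ 𝒮.top (t - M) M rfl)
      rw [← hg, ← Category.assoc, h0, zero_comp]
  -- The morphisms that factor through `F M` form an increasing chain in the finite-dimensional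
  -- space `Hom(Y, X)`, which stabilizes.
  let W : ℕ →o Submodule k (Y ⟶ X) :=
    ⟨fun M ↦ LinearMap.range (Linear.leftComp k X (F M)), monotone_nat_of_le_succ fun M ↦ by
      rintro _ ⟨g, rfl⟩
      exact ⟨𝒮.π _ (by push_cast; ring) M ≫ g, by simp [← hF M]⟩⟩
  have := T.finite Y X
  obtain ⟨N, hN⟩ := monotone_stabilizes_iff_noetherian.2
    (inferInstance : IsNoetherian k (Y ⟶ X)) W
  obtain ⟨M, hM, ⟨e⟩⟩ : ∃ M ≥ N, Nonempty (𝒮.S (t - (M + 1 : ℕ)) ≅ 𝒮.S j) := by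
    obtain ⟨i, hi, ⟨e⟩⟩ := h.1.exists_rep (t - (N + 1 : ℕ) - j)
    have h1 := 𝒮.nonempty_iso_add ⟨e⟩ (j - i)
    obtain ⟨e'⟩ := h1
    exact ⟨N + i, by omega, ⟨eqToIso (by congr 1; push_cast; ring) ≪≫ e' ≪≫
      eqToIso (by congr 1; ring)⟩⟩
  -- `M` is beyond stabilization and, by periodicity, such that `V (t - (M + 1)) (M + 1)` has socle
  -- `S j` up to isomorphism. So `c` extends to it. By stabilization the extension factors through
  -- `π` and kills the socle, forcing `c = 0`.
  obtain ⟨c', hc'⟩ := 𝒮.exists_extend_chain hX hX' (e.hom ≫ c) (M + 1)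
  have h1 : F (M + 1) ≫ c' ∈ W (M + 1) := ⟨c', rfl⟩
  rw [← hN (M + 1) (by omega), hN M hM] at h1
  obtain ⟨d, hd⟩ := h1
  have := hY.epi h (F (M + 1)) (hFtop (M + 1))
  have h2 : c' = 𝒮.π _ (by push_cast; ring) M ≫ d := by
    rw [← cancel_epi (F (M + 1)), ← Category.assoc, hF]
    exact hd.symm
  apply hc
  rw [← cancel_epi e.hom, ← hc', h2, ← Category.assoc, 𝒮.soc_comp_π, zero_comp, comp_zero]

/-- An indecomposable object between two bricks is uniserial. -/
theorem isUniserial_of_ne_zero (hs : ∃ s, 𝒮.HasPeriod s) {X : C} (hX : Indecomposable X)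
    {i j : ℤ} (c : 𝒮.S i ⟶ X) (hc : c ≠ 0) (b : X ⟶ 𝒮.S j) (hb : b ≠ 0) : 𝒮.IsUniserial X := by
  by_contra hX'
  -- A counterexample `X` is critical with `c` as the killed morphism, and it also receives a
  -- nonzero morphism from a brick.
  exact hX' (IsCritical.isUniserial hs (Y := X) ⟨hX, hX', ⟨j, b, hb⟩, 𝒮.S i, c, hc, fun a n f ↦ by
    by_contra h0
    exact hX' (𝒮.isUniserial_of_comp_ne_zero hX c f h0)⟩ hX c hc)

-- If a path leaves the uniserial objects, the first object outside receives a nonzero morphism from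
-- a brick, so critical objects do not exist. Then being non-uniserial with a nonzero morphism to a
-- brick propagates backwards along the path up to its uniserial start, a contradiction. The last
-- object outside before the path returns would have this property.
variable (𝒮) in
theorem isConvex_isUniserial (hs : ∃ s, 𝒮.HasPeriod s) :
    IsConvex (C := C) 𝒮.IsUniserial := by
  classical
  intro n X hX h0 hn
  by_contra! hne
  -- the first index for which the object is not uniserial
  obtain ⟨X', hX', hX'u, j, c, hc⟩ : ∃ X' : C, Indecomposable X' ∧ ¬ 𝒮.IsUniserial X' ∧
      ∃ (j : ℤ) (c : 𝒮.S j ⟶ X'), c ≠ 0 := by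
    by_contra! hno
    obtain ⟨i, hi⟩ := hne
    apply hi
    induction i using Fin.induction with
    | zero => exact h0
    | succ i ih =>
      by_cases hu : 𝒮.IsUniserial (X i.castSucc)
      · obtain ⟨a, m, ⟨e⟩⟩ := hu
        by_contra hi'
        obtain ⟨f, hf⟩ := hX.2 i
        obtain ⟨j, c, hc⟩ := 𝒮.exists_comp_ne_zero_of_src (e.inv ≫ f)
          (fun h ↦ hf ((cancel_epi e.inv).1 (h.trans comp_zero.symm)))
        exact hc (hno _ (hX.1 _) hi' j c)
      · exact (hu (ih hu)).elim
  have hstep : ∀ (Y Z : C) (f : Y ⟶ Z), f ≠ 0 → Indecomposable Y → Indecomposable Z →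
      ¬ 𝒮.IsUniserial Z → (∃ (j : ℤ) (b : Z ⟶ 𝒮.S j), b ≠ 0) →
      ¬ 𝒮.IsUniserial Y ∧ ∃ (j : ℤ) (b : Y ⟶ 𝒮.S j), b ≠ 0 := by
    rintro Y Z f hf hY hZ hZu ⟨j', b, hb⟩
    refine ⟨?_, ?_⟩
    · rintro ⟨a, m, ⟨e⟩⟩
      obtain ⟨i, c, hc⟩ := 𝒮.exists_comp_ne_zero_of_src (e.inv ≫ f)
        (fun h ↦ hf ((cancel_epi e.inv).1 (h.trans comp_zero.symm)))
      exact hZu (isUniserial_of_ne_zero hs hZ c hc b hb)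
    · by_contra! hno
      refine hX'u (IsCritical.isUniserial hs (Y := Z) ⟨hZ, hZu, ⟨j', b, hb⟩, Y, f, hf,
        fun a m g ↦ ?_⟩ hX' c hc)
      by_contra hg
      obtain ⟨l, d, hd⟩ := 𝒮.exists_comp_ne_zero_of_tgt _ hg
      exact hd (hno l d)
  have hall : ∀ i : Fin (n + 1), ¬ 𝒮.IsUniserial (X i) →
      (∃ (j : ℤ) (b : X i ⟶ 𝒮.S j), b ≠ 0) → False := by
    intro i
    induction i using Fin.induction with
    | zero => exact fun h _ ↦ h h0
    | succ i ih =>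
      intro h1 h2
      obtain ⟨f, hf⟩ := hX.2 i
      obtain ⟨h3, h4⟩ := hstep _ _ f hf (hX.1 _) (hX.1 _) h1 h2
      exact ih h3 h4
  have hlast : ∀ i : Fin (n + 1), 𝒮.IsUniserial (X i) := by
    intro i
    induction i using Fin.reverseInduction with
    | last => exact hn
    | cast i ih =>
      by_contra hi
      obtain ⟨a, m, ⟨e⟩⟩ := ih
      obtain ⟨f, hf⟩ := hX.2 i
      obtain ⟨l, d, hd⟩ := 𝒮.exists_comp_ne_zero_of_tgt (f ≫ e.hom)
        (fun h ↦ hf ((cancel_mono e.hom).1 (h.trans zero_comp.symm)))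
      exact hall _ hi ⟨l, d, hd⟩
  obtain ⟨i, hi⟩ := hne
  exact hi (hlast i)

end ARDuality.SimpleSystem

end Periodic

/-! ### The radical of a linear category. -/

section Radical

variable {k : Type t} [Field k] [IsAlgClosed k] {C : Type u} [Category.{v} C] [Preadditive C]
  [Linear k C] [HasBinaryBiproducts C] [HasTrivialIdempotents C]

theorem comp_mem_rad {X Y Z : C} {f : X ⟶ Y} (hf : f ∈ rad k X Y) (g : Y ⟶ Z) :
    f ≫ g ∈ rad k X Z := fun h ↦ by
  have := hf (g ≫ h)
  rwa [← Category.assoc] at this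

/-- The inverse is `1 + g (1 - f g)⁻¹ f`. This gives the left-right symmetry of the one-sided
definition of the radical. -/
theorem isIso_one_sub_comp_comm {X Y : C} (f : X ⟶ Y) (g : Y ⟶ X) [IsIso (𝟙 X - f ≫ g)] :
    IsIso (𝟙 Y - g ≫ f) := by
  refine ⟨𝟙 Y + g ≫ inv (𝟙 X - f ≫ g) ≫ f, ?_, ?_⟩
  · have h1 : f ≫ g ≫ inv (𝟙 X - f ≫ g) = inv (𝟙 X - f ≫ g) - 𝟙 X := by
      have := IsIso.hom_inv_id (𝟙 X - f ≫ g)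
      rw [Preadditive.sub_comp, Category.id_comp, Category.assoc] at this
      exact eq_sub_of_add_eq' (sub_eq_iff_eq_add.1 this).symm
    simp only [Preadditive.sub_comp, Preadditive.comp_add, Category.id_comp, Category.comp_id,
      Category.assoc]
    rw [reassoc_of% h1]
    simp only [Preadditive.sub_comp, Preadditive.comp_sub, Category.id_comp]
    abel
  · have h1 : inv (𝟙 X - f ≫ g) ≫ f ≫ g = inv (𝟙 X - f ≫ g) - 𝟙 X := by
      have := IsIso.inv_hom_id (𝟙 X - f ≫ g)
      rw [Preadditive.comp_sub, Category.comp_id] at this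
      exact eq_sub_of_add_eq' (sub_eq_iff_eq_add.1 this).symm
    simp only [Preadditive.comp_sub, Preadditive.add_comp, Category.id_comp, Category.comp_id,
      Category.assoc]
    rw [reassoc_of% h1]
    simp only [Preadditive.sub_comp, Preadditive.comp_sub, Category.id_comp]
    abel

theorem comp_mem_rad' {X Y Z : C} (g : X ⟶ Y) {f : Y ⟶ Z} (hf : f ∈ rad k Y Z) :
    g ≫ f ∈ rad k X Z := fun h ↦ by
  have := hf (h ≫ g)
  rw [← Category.assoc] at this
  have := isIso_one_sub_comp_comm (f ≫ h) g
  rwa [← Category.assoc] at this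

theorem not_isIso_of_mem_rad {X Y : C} (hX : ¬ IsZero X) {f : X ⟶ Y} (hf : f ∈ rad k X Y) :
    ¬ IsIso f := fun _ ↦ by
  have := hf (inv f)
  rw [IsIso.hom_inv_id, sub_self] at this
  exact hX ((IsZero.iff_id_eq_zero X).2 ((cancel_mono (0 : X ⟶ X)).1 (by simp)))

theorem not_isSplitEpi_of_mem_rad {X Y : C} (hY : ¬ IsZero Y) {f : X ⟶ Y} (hf : f ∈ rad k X Y) :
    ¬ IsSplitEpi f := fun h ↦
  not_isIso_of_mem_rad hY (comp_mem_rad' (section_ f) hf) (by rw [IsSplitEpi.id]; infer_instance)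

theorem mem_rad_of_not_isSplitMono {X Y : C} (hX : Indecomposable X) [Module.Finite k (X ⟶ X)]
    {f : X ⟶ Y} (hf : ¬ IsSplitMono f) : f ∈ rad k X Y := fun g ↦ by
  rcases isIso_or_isNilpotent k hX (f ≫ g) with h | h
  · exact (hf ⟨⟨g ≫ inv (f ≫ g), by rw [← Category.assoc, IsIso.hom_inv_id]⟩⟩).elim
  · have : IsUnit (1 - (show End X from f ≫ g)) := h.isUnit_one_sub
    exact (isUnit_iff_isIso _).1 this

theorem mem_rad_of_not_isSplitEpi {X Y : C} (hY : Indecomposable Y) [Module.Finite k (Y ⟶ Y)]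
    {f : X ⟶ Y} (hf : ¬ IsSplitEpi f) : f ∈ rad k X Y := fun g ↦ by
  have : IsIso (𝟙 Y - g ≫ f) := by
    rcases isIso_or_isNilpotent k hY (g ≫ f) with h | h
    · exact (hf ⟨⟨inv (g ≫ f) ≫ g, by rw [Category.assoc, IsIso.inv_hom_id]⟩⟩).elim
    · have : IsUnit (1 - (show End Y from g ≫ f)) := h.isUnit_one_sub
      exact (isUnit_iff_isIso _).1 this
  exact isIso_one_sub_comp_comm g f

theorem mem_rad_of_not_isIso {X Y : C} (hX : Indecomposable X) (hY : Indecomposable Y)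
    [Module.Finite k (X ⟶ X)] {f : X ⟶ Y} (hf : ¬ IsIso f) : f ∈ rad k X Y := by
  refine mem_rad_of_not_isSplitMono hX fun h ↦ hf ?_
  exact (isIso_of_retract hY f (retraction f) (IsSplitMono.id f) hX.1).1

theorem isIso_left_or_right {X : C} (hX : Indecomposable X) [Module.Finite k (X ⟶ X)]
    (f g : X ⟶ X) (h : f + g = 𝟙 X) : IsIso f ∨ IsIso g := by
  rcases isIso_or_isNilpotent k hX f with hf | hf
  · exact Or.inl hf
  · right
    have h1 : IsUnit (1 - (show End X from f)) := hf.isUnit_one_sub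
    rw [← eq_sub_iff_add_eq'] at h
    rw [h]
    exact (isUnit_iff_isIso _).1 h1

variable (k) in
/-- Up to isomorphism, an object has finitely many indecomposable direct summands. -/
theorem exists_list_summands [HasZeroObject C] (hfin : ∀ X : C, Module.Finite k (X ⟶ X)) (X : C) :
    ∃ L : List C, ∀ (Y : C) (i : Y ⟶ X) (p : X ⟶ Y), Indecomposable Y → i ≫ p = 𝟙 Y →
      ∃ Z ∈ L, Nonempty (Y ≅ Z) := by
  refine induction_indecomposable k hfin (P := fun X ↦ ∃ L : List C, ∀ (Y : C) (i : Y ⟶ X)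
    (p : X ⟶ Y), Indecomposable Y → i ≫ p = 𝟙 Y → ∃ Z ∈ L, Nonempty (Y ≅ Z)) ?_ ?_ ?_ ?_ X
  · rintro X X' e ⟨L, h⟩
    exact ⟨L, fun Y i p hY hip ↦ h Y (i ≫ e.inv) (e.hom ≫ p) hY (by simp [hip])⟩
  · intro X hX
    refine ⟨[], fun Y i p hY hip ↦ (hY.1 ?_).elim⟩
    rw [IsZero.iff_id_eq_zero, ← hip, hX.eq_of_tgt i 0, zero_comp]
  · intro X hX
    refine ⟨[X], fun Y i p hY hip ↦ ⟨X, by simp, ?_⟩⟩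
    have := (isIso_of_retract hX i p hip hY.1).1
    exact ⟨asIso i⟩
  · rintro X X' ⟨L, hL⟩ ⟨L', hL'⟩
    refine ⟨L ++ L', fun Y i p hY hip ↦ ?_⟩
    have := hfin Y
    rcases isIso_left_or_right (k := k) hY ((i ≫ biprod.fst) ≫ biprod.inl ≫ p)
      ((i ≫ biprod.snd) ≫ biprod.inr ≫ p) (by
        rw [← hip]
        have := congrArg (fun q ↦ i ≫ q ≫ p) (biprod.total (X := X) (Y := X'))
        simpa only [Preadditive.add_comp, Preadditive.comp_add, Category.assoc, Category.id_comp]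
          using this) with h | h
    · obtain ⟨Z, hZ, e⟩ := hL Y (i ≫ biprod.fst) (biprod.inl ≫ p ≫
        inv ((i ≫ biprod.fst) ≫ biprod.inl ≫ p)) hY
        (by simpa only [Category.assoc] using
          IsIso.hom_inv_id ((i ≫ biprod.fst) ≫ biprod.inl ≫ p))
      exact ⟨Z, by simp [hZ], e⟩
    · obtain ⟨Z, hZ, e⟩ := hL' Y (i ≫ biprod.snd) (biprod.inr ≫ p ≫
        inv ((i ≫ biprod.snd) ≫ biprod.inr ≫ p)) hY
        (by simpa only [Category.assoc] using
          IsIso.hom_inv_id ((i ≫ biprod.snd) ≫ biprod.inr ≫ p))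
      exact ⟨Z, by simp [hZ], e⟩

end Radical

/-! ### Indecomposability under equivalences. -/

section Equivalence

variable {C : Type*} [Category* C] [Preadditive C] [HasBinaryBiproducts C]
  {D : Type*} [Category* D] [Preadditive D] [HasBinaryBiproducts D]

theorem not_isZero_map (F : C ⥤ D) [F.Faithful] [F.PreservesZeroMorphisms] {X : C}
    (hX : ¬ IsZero X) : ¬ IsZero (F.obj X) := fun h ↦ hX (by
  rw [IsZero.iff_id_eq_zero] at h ⊢
  apply F.map_injective
  rw [F.map_id, h, F.map_zero])

theorem indecomposable_map (F : C ⥤ D) [F.IsEquivalence] [F.Additive] {X : C}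
    (hX : Indecomposable X) : Indecomposable (F.obj X) := by
  refine ⟨not_isZero_map F hX.1, fun Y Z e ↦ ?_⟩
  have : F.asEquivalence.functor.Additive := inferInstanceAs F.Additive
  have : F.inv.Additive := F.asEquivalence.inverse_additive
  have : PreservesBinaryBiproducts F.inv :=
    preservesBinaryBiproducts_of_preservesBiproducts F.inv
  have h := hX.2 (F.inv.obj Y) (F.inv.obj Z) (F.asEquivalence.unitIso.app X ≪≫
    F.inv.mapIso e ≪≫ F.inv.mapBiprod Y Z)
  by_contra! hYZ
  rcases h with h | h
  · exact not_isZero_map F.inv hYZ.1 h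
  · exact not_isZero_map F.inv hYZ.2 h

theorem indecomposable_of_iso {X Y : C} (e : X ≅ Y) (hX : Indecomposable X) : Indecomposable Y :=
  ⟨fun h ↦ hX.1 (h.of_iso e), fun Z W i ↦ hX.2 Z W (e ≪≫ i)⟩

end Equivalence

/-! ### From a periodic object to a periodic system of bricks. -/

namespace ARDuality

variable {k : Type t} [Field k] [IsAlgClosed k] {C : Type u} [Category.{v} C] [Abelian C]
  [Linear k C] (T : ARDuality k C)

/-- The iterates of the Auslander-Reiten translation. -/
def iter : ℕ → C ⥤ C
  | 0 => 𝟭 C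
  | n + 1 => iter n ⋙ T.τ

instance (n : ℕ) : (T.iter n).IsEquivalence := by
  induction n with
  | zero => exact inferInstanceAs (𝟭 C).IsEquivalence
  | succ n ih => exact inferInstanceAs (T.iter n ⋙ T.τ).IsEquivalence

instance (n : ℕ) : (T.iter n).Additive := by
  induction n with
  | zero => exact inferInstanceAs (𝟭 C).Additive
  | succ n ih => exact inferInstanceAs (T.iter n ⋙ T.τ).Additive

instance (n : ℕ) : (T.iter n).Linear k := by
  induction n with
  | zero => exact inferInstanceAs ((𝟭 C).Linear k)
  | succ n ih => exact inferInstanceAs ((T.iter n ⋙ T.τ).Linear k)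

/-- The comparison of iterates. -/
def iterAdd (m : ℕ) : ∀ n : ℕ, T.iter (m + n) ≅ T.iter m ⋙ T.iter n
  | 0 => (Functor.rightUnitor _).symm
  | n + 1 => Functor.isoWhiskerRight (iterAdd m n) T.τ

/-- The comparison of iterates on objects. -/
def iterIso (m n : ℕ) (X : C) : (T.iter (m + n)).obj X ≅ (T.iter n).obj ((T.iter m).obj X) :=
  (T.iterAdd m n).app X

/-- Iterates commute. -/
def iterComm (m n : ℕ) (X : C) :
    (T.iter m).obj ((T.iter n).obj X) ≅ (T.iter n).obj ((T.iter m).obj X) :=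
  (T.iterIso n m X).symm ≪≫ eqToIso (by rw [add_comm]) ≪≫ T.iterIso m n X

/-- `X` is periodic with period `n`. -/
def Periodic (n : ℕ) (X : C) : Prop := 0 < n ∧ Nonempty ((T.iter n).obj X ≅ X)

variable {T}

theorem Periodic.mul {n : ℕ} {X : C} (h : T.Periodic n X) (m : ℕ) :
    Nonempty ((T.iter (n * m)).obj X ≅ X) := by
  induction m with
  | zero => exact ⟨Iso.refl _⟩
  | succ m ih =>
    obtain ⟨e⟩ := ih
    obtain ⟨e'⟩ := h.2
    exact ⟨T.iterIso _ _ X ≪≫ (T.iter n).mapIso e ≪≫ e'⟩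

theorem Periodic.add {n : ℕ} {X : C} (h : T.Periodic n X) (m l : ℕ) :
    Nonempty ((T.iter (n * m + l)).obj X ≅ (T.iter l).obj X) :=
  (h.mul m).map fun e ↦ T.iterIso _ _ X ≪≫ (T.iter l).mapIso e

theorem Periodic.exists_rep {n : ℕ} {X : C} (h : T.Periodic n X) (m : ℕ) :
    ∃ a < n, Nonempty ((T.iter m).obj X ≅ (T.iter a).obj X) := by
  refine ⟨m % n, Nat.mod_lt _ h.1, ?_⟩
  have := h.add (m / n) (m % n)
  rwa [Nat.div_add_mod] at this

/-- The objects `τ^(n m) Y` are all summands of `X`, which has only finitely many indecomposable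
summands up to isomorphism; two of them must agree. -/
theorem periodic_of_retract {n : ℕ} {X Y : C} (hX : T.Periodic n X) (hY : Indecomposable Y)
    (i : Y ⟶ X) (p : X ⟶ Y) (hip : i ≫ p = 𝟙 Y) : ∃ m, T.Periodic m Y := by
  obtain ⟨L, hL⟩ := exists_list_summands k (fun X ↦ T.finite X X) X
  have h1 : ∀ m : ℕ, ∃ z : Fin L.length, Nonempty ((T.iter (n * m)).obj Y ≅ L.get z) := by
    intro m
    obtain ⟨e⟩ := hX.mul m
    obtain ⟨Z, hZ, h⟩ := hL _ ((T.iter (n * m)).map i ≫ e.hom) (e.inv ≫ (T.iter (n * m)).map p)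
      (indecomposable_map _ hY) (by simp [← Functor.map_comp, hip])
    obtain ⟨z, rfl⟩ := List.get_of_mem hZ
    exact ⟨z, h⟩
  choose z hz using h1
  obtain ⟨a, b, hab, hzab⟩ := Finite.exists_ne_map_eq_of_infinite z
  wlog hlt : a < b generalizing a b
  · exact this b a hab.symm hzab.symm (by omega)
  obtain ⟨e⟩ := hz a
  obtain ⟨e'⟩ := hz b
  refine ⟨n * (b - a), Nat.mul_pos hX.1 (by omega), ⟨(T.iter (n * a)).preimageIso ?_⟩⟩
  refine (T.iterIso _ _ _).symm ≪≫ eqToIso ?_ ≪≫ e' ≪≫ eqToIso (by rw [hzab]) ≪≫ e.symm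
  rw [← mul_add, Nat.sub_add_cancel hlt.le]

variable (T) in
/-- The total dimension of the morphisms from the `τ`-orbit of `E`. -/
noncomputable def fromDim (r : ℕ) (E X : C) : ℕ :=
  ∑ a ∈ Finset.range r, Module.finrank k ((T.iter a).obj E ⟶ X)

variable (T) in
/-- The total dimension of the morphisms to the `τ`-orbit of `E`. -/
noncomputable def toDim (r : ℕ) (E X : C) : ℕ :=
  ∑ a ∈ Finset.range r, Module.finrank k (X ⟶ (T.iter a).obj E)

theorem finrank_map (F : C ⥤ C) [F.IsEquivalence] [F.Additive] [F.Linear k] (X Y : C) :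
    Module.finrank k (F.obj X ⟶ F.obj Y) = Module.finrank k (X ⟶ Y) :=
  (LinearEquiv.finrank_eq (LinearEquiv.ofBijective (F.mapLinearMap k)
    ⟨F.map_injective, F.map_surjective⟩)).symm

theorem Periodic.fromDim_iter {r : ℕ} {E : C} (hE : T.Periodic r E) (X : C) (m : ℕ) :
    T.fromDim r E ((T.iter m).obj X) = T.fromDim r E X := by
  induction m with
  | zero => rfl
  | succ m ih =>
    rw [← ih]
    obtain ⟨e⟩ := hE.2
    have h1 := Finset.sum_range_succ
      (fun a : ℕ ↦ Module.finrank k ((T.iter a).obj E ⟶ (T.iter (m + 1)).obj X)) r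
    have h2 := Finset.sum_range_succ'
      (fun a : ℕ ↦ Module.finrank k ((T.iter a).obj E ⟶ (T.iter (m + 1)).obj X)) r
    have h3 : ∀ a : ℕ, Module.finrank k ((T.iter (a + 1)).obj E ⟶ (T.iter (m + 1)).obj X) =
      Module.finrank k ((T.iter a).obj E ⟶ (T.iter m).obj X) := fun a ↦ finrank_map T.τ _ _
    have h4 : Module.finrank k ((T.iter r).obj E ⟶ (T.iter (m + 1)).obj X) =
        Module.finrank k ((T.iter 0).obj E ⟶ (T.iter (m + 1)).obj X) :=
      LinearEquiv.finrank_eq (Linear.homCongr k e (Iso.refl _))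
    simp only [h3] at h2
    rw [fromDim, fromDim]
    omega

theorem Periodic.toDim_iter {r : ℕ} {E : C} (hE : T.Periodic r E) (X : C) (m : ℕ) :
    T.toDim r E ((T.iter m).obj X) = T.toDim r E X := by
  induction m with
  | zero => rfl
  | succ m ih =>
    rw [← ih]
    obtain ⟨e⟩ := hE.2
    have h1 := Finset.sum_range_succ
      (fun a : ℕ ↦ Module.finrank k ((T.iter (m + 1)).obj X ⟶ (T.iter a).obj E)) r
    have h2 := Finset.sum_range_succ'
      (fun a : ℕ ↦ Module.finrank k ((T.iter (m + 1)).obj X ⟶ (T.iter a).obj E)) r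
    have h3 : ∀ a : ℕ, Module.finrank k ((T.iter (m + 1)).obj X ⟶ (T.iter (a + 1)).obj E) =
      Module.finrank k ((T.iter m).obj X ⟶ (T.iter a).obj E) := fun a ↦ finrank_map T.τ _ _
    have h4 : Module.finrank k ((T.iter (m + 1)).obj X ⟶ (T.iter r).obj E) =
        Module.finrank k ((T.iter (m + 1)).obj X ⟶ (T.iter 0).obj E) :=
      LinearEquiv.finrank_eq (Linear.homCongr k (Iso.refl _) e)
    simp only [h3] at h2
    rw [toDim, toDim]
    omega

/-- Equality of the dimensions makes every morphism from the orbit of `E` to `I` factor through `J`,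
in particular the epimorphism `p`. `mono_of_toDim_le` is dual. -/
theorem Periodic.epi_of_fromDim_le {r : ℕ} {E : C} (hE : T.Periodic r E) {I J : C} (i : J ⟶ I)
    [Mono i] (h : T.fromDim r E I ≤ T.fromDim r E J) {x : ℕ} (p : (T.iter x).obj E ⟶ I) [Epi p] :
    Epi i := by
  have hfin := T.finite
  have hinj : ∀ a, Function.Injective (Linear.rightComp k ((T.iter a).obj E) i) :=
    fun a f g hfg ↦ (cancel_mono i).1 hfg
  have hle : ∀ a ∈ Finset.range r, Module.finrank k ((T.iter a).obj E ⟶ J) ≤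
      Module.finrank k ((T.iter a).obj E ⟶ I) := fun a _ ↦
    LinearMap.finrank_le_finrank_of_injective (hinj a)
  have heq := (Finset.sum_eq_sum_iff_of_le hle).1 (le_antisymm (Finset.sum_le_sum hle) h)
  obtain ⟨a, ha, ⟨e⟩⟩ := hE.exists_rep x
  obtain ⟨q, hq⟩ := (LinearMap.injective_iff_surjective_of_finrank_eq_finrank
    (heq a (Finset.mem_range.2 ha))).1 (hinj a) (e.inv ≫ p)
  have hq' : q ≫ i = e.inv ≫ p := hq
  have : Epi (q ≫ i) := by rw [hq']; infer_instance
  exact epi_of_epi q i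

theorem Periodic.mono_of_toDim_le {r : ℕ} {E : C} (hE : T.Periodic r E) {I J : C} (p : I ⟶ J)
    [Epi p] (h : T.toDim r E I ≤ T.toDim r E J) {x : ℕ} (i : I ⟶ (T.iter x).obj E) [Mono i] :
    Mono p := by
  have hfin := T.finite
  have hinj : ∀ a, Function.Injective (Linear.leftComp k ((T.iter a).obj E) p) :=
    fun a f g hfg ↦ (cancel_epi p).1 hfg
  have hle : ∀ a ∈ Finset.range r, Module.finrank k (J ⟶ (T.iter a).obj E) ≤
      Module.finrank k (I ⟶ (T.iter a).obj E) := fun a _ ↦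
    LinearMap.finrank_le_finrank_of_injective (hinj a)
  have heq := (Finset.sum_eq_sum_iff_of_le hle).1 (le_antisymm (Finset.sum_le_sum hle) h)
  obtain ⟨a, ha, ⟨e⟩⟩ := hE.exists_rep x
  obtain ⟨q, hq⟩ := (LinearMap.injective_iff_surjective_of_finrank_eq_finrank
    (heq a (Finset.mem_range.2 ha))).1 (hinj a) (i ≫ e.hom)
  have hq' : p ≫ q = i ≫ e.hom := hq
  have : Mono (p ≫ q) := by rw [hq']; infer_instance
  exact mono_of_mono p q

variable (T) in
/-- Periodic nonzero objects which are both a quotient and a subobject of objects of the `τ`-orbit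
of `E`. -/
structure IsPiece (E I : C) : Prop where
  not_isZero : ¬ IsZero I
  periodic : ∃ n, T.Periodic n I
  exists_epi : ∃ (x : ℕ) (p : (T.iter x).obj E ⟶ I), Epi p
  exists_mono : ∃ (x : ℕ) (i : I ⟶ (T.iter x).obj E), Mono i

variable (T) in
/-- A piece of minimal dimension. -/
def IsMinimalPiece (r : ℕ) (E I : C) : Prop :=
  T.IsPiece E I ∧ ∀ J, T.IsPiece E J → T.fromDim r E I ≤ T.fromDim r E J

/-- The object `E` is itself a piece, and a nonzero summand of a piece is a piece of no larger
dimension. -/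
theorem exists_minimalPiece {r : ℕ} {E : C} (hE : Indecomposable E) (hr : T.Periodic r E) :
    ∃ I, T.IsMinimalPiece r E I ∧ Indecomposable I := by
  classical
  have hfin := T.finite
  have hex : ∃ n I, T.IsPiece E I ∧ T.fromDim r E I = n :=
    ⟨_, E, ⟨hE.1, ⟨r, hr⟩, ⟨0, 𝟙 E, inferInstanceAs (Epi (𝟙 E))⟩,
      ⟨0, 𝟙 E, inferInstanceAs (Mono (𝟙 E))⟩⟩, rfl⟩
  obtain ⟨I, hI, hn⟩ := Nat.find_spec hex
  have hmin : ∀ J, T.IsPiece E J → T.fromDim r E I ≤ T.fromDim r E J := fun J hJ ↦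
    hn.le.trans (Nat.find_min' hex ⟨J, hJ, rfl⟩)
  obtain ⟨X, i, p, hX, hip, -⟩ := exists_indecomposable_summand_tgt k (fun X ↦ T.finite X X) I
    (𝟙 I) (fun h ↦ hI.not_isZero ((IsZero.iff_id_eq_zero I).2 h))
  have hi : Mono i := ⟨fun f g hfg ↦ by simpa [hip] using congrArg (· ≫ p) hfg⟩
  have hp : Epi p := ⟨fun f g hfg ↦ by simpa [reassoc_of% hip] using congrArg (i ≫ ·) hfg⟩
  obtain ⟨n, hn⟩ := hI.periodic
  obtain ⟨x, q, hq⟩ := hI.exists_epi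
  obtain ⟨y, j, hj⟩ := hI.exists_mono
  refine ⟨X, ⟨⟨hX.1, periodic_of_retract hn hX i p hip, ⟨x, q ≫ p, epi_comp _ _⟩,
    ⟨y, i ≫ j, mono_comp _ _⟩⟩, fun J hJ ↦ le_trans ?_ (hmin J hJ)⟩, hX⟩
  exact Finset.sum_le_sum fun a _ ↦ LinearMap.finrank_le_finrank_of_injective
    (f := Linear.rightComp k ((T.iter a).obj E) i) fun f g hfg ↦ (cancel_mono i).1 hfg

theorem mono_smul {X Y : C} (f : X ⟶ Y) [Mono f] {c : k} (hc : c ≠ 0) : Mono (c • f) := by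
  refine Preadditive.mono_of_cancel_zero _ fun {Z} g hg ↦ ?_
  rw [Linear.comp_smul] at hg
  have h1 : g ≫ f = 0 := (smul_eq_zero.1 hg).resolve_left hc
  exact (cancel_mono f).1 (h1.trans zero_comp.symm)

/-- The twisted action of `τ^n` on `W` is linear and injective, hence has an eigenvector `g` with
nonzero eigenvalue. The image of `g` is then isomorphic to its translate by `τ^n`, so it is a piece.
Minimality, compared through morphisms from and to the orbit of `E`, makes `g` an epimorphism and
then a monomorphism. -/
theorem IsMinimalPiece.exists_isIso {r : ℕ} {E : C} (hr : T.Periodic r E) {I : C}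
    (hI : T.IsMinimalPiece r E I) {n m : ℕ} (hn : 0 < n) (φ : (T.iter n).obj I ≅ I)
    (ψ : (T.iter n).obj ((T.iter m).obj I) ≅ (T.iter m).obj I)
    (W : Submodule k (I ⟶ (T.iter m).obj I)) (hW0 : W ≠ ⊥)
    (hW : ∀ g ∈ W, φ.inv ≫ (T.iter n).map g ≫ ψ.hom ∈ W) : ∃ g ∈ W, IsIso g := by
  have hfin := T.finite
  let σ : (I ⟶ (T.iter m).obj I) →ₗ[k] (I ⟶ (T.iter m).obj I) :=
    { toFun := fun g ↦ φ.inv ≫ (T.iter n).map g ≫ ψ.hom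
      map_add' := by intros; simp [Functor.map_add]
      map_smul' := by intros; simp [Functor.map_smul] }
  have hσ : ∀ g, σ g = 0 → g = 0 := by
    intro g hg
    have h1 : (T.iter n).map g ≫ ψ.hom = 0 := (cancel_epi φ.inv).1 (hg.trans comp_zero.symm)
    apply (T.iter n).map_injective
    rw [Functor.map_zero]
    exact (cancel_mono ψ.hom).1 (h1.trans zero_comp.symm)
  have : Nontrivial W := Submodule.nontrivial_iff_ne_bot.2 hW0
  obtain ⟨c, hc⟩ := Module.End.exists_eigenvalue (σ.restrict hW)
  obtain ⟨⟨g, hgW⟩, hg⟩ := hc.exists_hasEigenvector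
  have hg0 : g ≠ 0 := fun h ↦ hg.2 (Subtype.ext h)
  have hσg : φ.inv ≫ (T.iter n).map g ≫ ψ.hom = c • g := congrArg Subtype.val hg.apply_eq_smul
  have hc0 : c ≠ 0 := by
    rintro rfl
    exact hg0 (hσ g (hσg.trans (zero_smul _ _)))
  refine ⟨g, hgW, ?_⟩
  obtain ⟨hpiece, hmin⟩ := hI
  obtain ⟨x, p, hp⟩ := hpiece.exists_epi
  obtain ⟨y, i, hi⟩ := hpiece.exists_mono
  have hJ : T.IsPiece E (image g) := by
    refine ⟨fun h0 ↦ hg0 (by rw [← image.fac g, h0.eq_of_tgt (factorThruImage g) 0, zero_comp]),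
      ⟨n, hn, ⟨?_⟩⟩, ⟨x, p ≫ factorThruImage g, epi_comp _ _⟩,
      ⟨y + m, image.ι g ≫ (T.iter m).map i ≫ (T.iterIso y m E).inv, mono_comp _ _⟩⟩
    have : StrongEpi (φ.inv ≫ (T.iter n).map (factorThruImage g)) :=
      strongEpi_of_epi _
    have := mono_smul ((T.iter n).map (image.ι g) ≫ ψ.hom) (inv_ne_zero hc0)
    refine image.isoStrongEpiMono (φ.inv ≫ (T.iter n).map (factorThruImage g))
      (c⁻¹ • ((T.iter n).map (image.ι g) ≫ ψ.hom)) ?_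
    rw [Linear.comp_smul, Category.assoc, ← Functor.map_comp_assoc, image.fac, hσg, smul_smul,
      inv_mul_cancel₀ hc0, one_smul]
  have h1 : Epi (image.ι g) := by
    refine hr.epi_of_fromDim_le (image.ι g) ?_
      ((T.iterIso x m E).hom ≫ (T.iter m).map p)
    rw [hr.fromDim_iter]
    exact hmin _ hJ
  have h2 : Epi g := by rw [← image.fac g]; exact epi_comp _ _
  have h3 : Mono g := hr.mono_of_toDim_le g (hr.toDim_iter I m).ge i
  exact isIso_of_mono_of_epi g

/-- Applied to the full Hom space, the eigenvector argument gives an isomorphism `g`. Applied to the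
radical of `End I`, it would give an invertible radical element, so this radical is zero. The
nonzero endomorphism `f ≫ inv g` is therefore invertible. -/
theorem IsMinimalPiece.isIso {r : ℕ} {E : C} (hr : T.Periodic r E) {I : C}
    (hI : T.IsMinimalPiece r E I) (hI' : Indecomposable I) {m : ℕ} (f : I ⟶ (T.iter m).obj I)
    (hf : f ≠ 0) : IsIso f := by
  have hfin := T.finite
  obtain ⟨n, hn, ⟨φ⟩⟩ := hI.1.periodic
  obtain ⟨g, -, hg⟩ := hI.exists_isIso hr hn φ (T.iterComm n m I ≪≫ (T.iter m).mapIso φ) ⊤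
    (fun h ↦ hf ((Submodule.mem_bot k).1 (h ▸ Submodule.mem_top))) (fun _ _ ↦ Submodule.mem_top)
  have hrad : rad k I I = ⊥ := by
    by_contra h0
    obtain ⟨h, hh, hi⟩ := hI.exists_isIso hr (m := 0) hn φ φ (rad k I I) h0 fun (h : I ⟶ I) hh ↦ by
      refine mem_rad_of_not_isIso (X := I) (Y := I) hI' hI'
        fun (hi : IsIso (φ.inv ≫ (T.iter n).map h ≫ φ.hom)) ↦ not_isIso_of_mem_rad hI'.1 hh ?_
      have : IsIso ((T.iter n).map h ≫ φ.hom) := IsIso.of_isIso_comp_left φ.inv _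
      have : IsIso ((T.iter n).map h) := IsIso.of_isIso_comp_right _ φ.hom
      exact isIso_of_reflects_iso h (T.iter n)
    exact not_isIso_of_mem_rad hI'.1 hh hi
  have h1 : IsIso (f ≫ inv g) := by
    by_contra h2
    have h3 := mem_rad_of_not_isIso (k := k) hI' hI' h2
    rw [hrad, Submodule.mem_bot] at h3
    exact hf ((cancel_mono (inv g)).1 (h3.trans zero_comp.symm))
  exact IsIso.of_isIso_comp_right f (inv g)

/-- A periodic indecomposable object is uniserial with respect to some periodic system of
bricks. -/
theorem exists_simpleSystem {r : ℕ} {E : C} (hE : Indecomposable E) (hr : T.Periodic r E) :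
    ∃ 𝒮 : T.SimpleSystem, (∃ s, 𝒮.HasPeriod s) ∧ 𝒮.IsUniserial E := by
  obtain ⟨I, hI, hI'⟩ := exists_minimalPiece hE hr
  obtain ⟨n, hn⟩ := hI.1.periodic
  have hn0 : (0 : ℤ) < n := by exact_mod_cast hn.1
  -- The brick with index `a` is `τ` iterated `-a mod n` times, the sign reflecting that `τ` lowers
  -- the index. When the residue wraps around, periodicity of `I` closes the cycle.
  have hmod : ∀ a b : ℤ, a + 1 = b → ((-b) % n).toNat + 1 = ((-a) % n).toNat ∨
      ((-b) % n).toNat + 1 = n ∧ ((-a) % n).toNat = 0 := by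
    rintro a b rfl
    have h1 := Int.emod_nonneg (-(a + 1)) hn0.ne'
    have h2 := Int.emod_lt_of_pos (-(a + 1)) hn0
    have h3 : (-a) % n = ((-(a + 1)) % n + 1) % n := by
      rw [Int.emod_add_emod]; congr 1; ring
    rcases lt_or_eq_of_le (Int.add_one_le_iff.2 h2) with h4 | h4
    · rw [Int.emod_eq_of_lt (by omega) h4] at h3; omega
    · rw [h4, Int.emod_self] at h3; omega
  have hiso : ∀ (i j : ℕ) (f : (T.iter i).obj I ⟶ (T.iter j).obj I), f ≠ 0 → IsIso f := by
    intro i j f hf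
    obtain ⟨m, hm⟩ : ∃ m, n * m + j ≥ i := ⟨i, by
      have := Nat.mul_le_mul_right i hn.1; omega⟩
    obtain ⟨e⟩ := hn.add m j
    obtain ⟨l, hl⟩ := Nat.exists_eq_add_of_le hm
    let e' : (T.iter j).obj I ≅ (T.iter i).obj ((T.iter l).obj I) :=
      e.symm ≪≫ eqToIso (by rw [hl, add_comm]) ≪≫ T.iterIso l i I
    obtain ⟨g, hg⟩ := (T.iter i).map_surjective (f ≫ e'.hom)
    have hg0 : g ≠ 0 := by
      rintro rfl
      rw [Functor.map_zero] at hg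
      exact hf ((cancel_mono e'.hom).1 (hg.symm.trans zero_comp.symm))
    have := hI.isIso hr hI' g hg0
    have : IsIso (f ≫ e'.hom) := by rw [← hg]; infer_instance
    exact IsIso.of_isIso_comp_right f e'.hom
  have hshift : ∀ {a b : ℤ} (_ : a + 1 = b),
      Nonempty (T.τ.obj ((T.iter ((-b) % n).toNat).obj I) ≅ (T.iter ((-a) % n).toNat).obj I) := by
    intro a b h
    rcases hmod a b h with h1 | ⟨h1, h2⟩
    · rw [← h1]; exact ⟨Iso.refl _⟩
    · rw [h2]
      obtain ⟨e⟩ := hn.2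
      rw [← h1] at e
      exact ⟨e⟩
  let 𝒮 : T.SimpleSystem :=
    { S := fun a ↦ (T.iter ((-a) % n).toNat).obj I
      iso := fun h ↦ (hshift h).some
      not_isZero := fun a ↦ not_isZero_map _ hI'.1
      isIso := fun f hf ↦ hiso _ _ f hf }
  have hper : 𝒮.HasPeriod n := ⟨hn.1, fun a ↦ ⟨eqToIso (by
    change (T.iter ((-(a + n)) % n).toNat).obj I = (T.iter ((-a) % n).toNat).obj I
    congr 3
    rw [neg_add, ← sub_eq_add_neg, Int.sub_emod_right])⟩⟩
  have hS : ∀ m : ℕ, Nonempty ((T.iter m).obj I ≅ 𝒮.S (-m)) := by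
    intro m
    obtain ⟨e⟩ := hn.add (m / n) (m % n)
    refine ⟨eqToIso (by rw [Nat.div_add_mod]) ≪≫ e ≪≫ eqToIso ?_⟩
    change _ = (T.iter ((-(-(m : ℤ))) % n).toNat).obj I
    rw [neg_neg, ← Int.natCast_mod, Int.toNat_natCast]
  refine ⟨𝒮, ⟨n, hper⟩, ?_⟩
  obtain ⟨x, p, hp⟩ := hI.1.exists_epi
  obtain ⟨y, i, hi⟩ := hI.1.exists_mono
  have hp0 : p ≠ 0 := by rintro rfl; exact hI'.1 (IsZero.of_epi_eq_zero (0 : (T.iter x).obj E ⟶ I) rfl)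
  have hi0 : i ≠ 0 := by rintro rfl; exact hI'.1 (IsZero.of_mono_eq_zero (0 : I ⟶ (T.iter y).obj E) rfl)
  have hret : ∀ x, ∃ m, Nonempty ((T.iter m).obj ((T.iter x).obj E) ≅ E) := by
    intro x
    obtain ⟨m, hm⟩ : ∃ m, r * x = x + m := Nat.exists_eq_add_of_le
      (by have := Nat.mul_le_mul_right x hr.1; omega)
    obtain ⟨e⟩ := hr.mul x
    exact ⟨m, ⟨(T.iterIso x m E).symm ≪≫ eqToIso (by rw [hm]) ≪≫ e⟩⟩
  obtain ⟨m, ⟨e⟩⟩ := hret x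
  obtain ⟨m', ⟨e'⟩⟩ := hret y
  obtain ⟨d⟩ := hS m
  obtain ⟨d'⟩ := hS m'
  -- Translating back to `E` the monomorphism from `I` and the epimorphism to `I` places `E` between
  -- two bricks.
  refine SimpleSystem.isUniserial_of_ne_zero ⟨n, hper⟩ hE
    (d'.inv ≫ (T.iter m').map i ≫ e'.hom) ?_ (e.inv ≫ (T.iter m).map p ≫ d.hom) ?_
  · intro h
    have h1 := (cancel_epi d'.inv).1 (h.trans comp_zero.symm)
    have h2 := (cancel_mono e'.hom).1 (h1.trans zero_comp.symm)
    exact hi0 ((T.iter m').map_injective (h2.trans (Functor.map_zero _ _ _).symm))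
  · intro h
    have h1 := (cancel_epi e.inv).1 (h.trans comp_zero.symm)
    have h2 := (cancel_mono d.hom).1 (h1.trans zero_comp.symm)
    exact hp0 ((T.iter m).map_injective (h2.trans (Functor.map_zero _ _ _).symm))

end ARDuality

/-! ### Effacing extensions and criteria for hereditary categories. -/

section Effaceable

variable {B : Type u} [Category.{v} B] [Abelian B]

/-- A morphism in the derived category from an object to a shifted object is killed by an
epimorphism. -/
theorem exists_epi_single_comp_eq_zero [HasDerivedCategory.{w} B] {X Y : B} {n : ℤ} (hn : 0 ≠ n)
    (f : (DerivedCategory.singleFunctor B 0).obj X ⟶ (DerivedCategory.singleFunctor B n).obj Y) :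
    ∃ (X' : B) (p : X' ⟶ X), Epi p ∧ (DerivedCategory.singleFunctor B 0).map p ≫ f = 0 := by
  let e := DerivedCategory.singleFunctorIsoCompQ B 0
  let e' := DerivedCategory.singleFunctorIsoCompQ B n
  -- Represent the morphism by a roof with apex `K`. The degree zero cycles of `K` map onto `H⁰(K) ≅
  -- X`, and their composite to a complex concentrated in degree `n ≠ 0` is zero.
  obtain ⟨K, (s : K ⟶ (HomologicalComplex.single B (ComplexShape.up ℤ) 0).obj X), hs,
    (g : K ⟶ (HomologicalComplex.single B (ComplexShape.up ℤ) n).obj Y), hg⟩ :=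
    DerivedCategory.right_fac (e.inv.app X ≫ f ≫ e'.hom.app Y)
  have hqs : QuasiIso s := (DerivedCategory.isIso_Q_map_iff_quasiIso (φ := s)).1 hs
  let φ : (HomologicalComplex.single B (ComplexShape.up ℤ) 0).obj (K.cycles 0) ⟶ K :=
    HomologicalComplex.mkHomFromSingle (K.iCycles 0) (by simp)
  obtain ⟨p, hp⟩ := (HomologicalComplex.single B (ComplexShape.up ℤ) 0).map_surjective (φ ≫ s)
  refine ⟨K.cycles 0, p, ?_, ?_⟩
  · have h1 : HomologicalComplex.cyclesMap φ 0 =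
        (HomologicalComplex.singleObjCyclesSelfIso (ComplexShape.up ℤ) 0 (K.cycles 0)).hom := by
      rw [← cancel_mono (K.iCycles 0), HomologicalComplex.cyclesMap_i]
      simp [φ, HomologicalComplex.singleObjCyclesSelfIso_hom]
    have h2 : Epi (HomologicalComplex.homologyMap φ 0) := by
      have h3 := HomologicalComplex.homologyπ_naturality φ 0
      have : Epi (HomologicalComplex.cyclesMap φ 0 ≫ K.homologyπ 0) := by
        rw [h1]; infer_instance
      rw [← h3] at this
      exact epi_of_epi (HomologicalComplex.homologyπ _ 0) (HomologicalComplex.homologyMap φ 0)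
    have h3 : Epi (HomologicalComplex.homologyMap
        ((HomologicalComplex.single B (ComplexShape.up ℤ) 0).map p) 0) := by
      rw [hp, HomologicalComplex.homologyMap_comp]
      exact epi_comp _ _
    have h4 := HomologicalComplex.singleObjHomologySelfIso_hom_naturality (ComplexShape.up ℤ) 0 p
    have h5 : Epi ((HomologicalComplex.singleObjHomologySelfIso (ComplexShape.up ℤ) 0
        (K.cycles 0)).hom ≫ p) := by
      rw [← h4]; exact epi_comp _ _
    exact epi_of_epi (HomologicalComplex.singleObjHomologySelfIso (ComplexShape.up ℤ) 0
        (K.cycles 0)).hom p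
  · have h1 : φ ≫ g = 0 := by
      refine HomologicalComplex.hom_ext _ _ fun i ↦ ?_
      by_cases hi : i = 0
      · subst hi
        exact (HomologicalComplex.isZero_single_obj_X (ComplexShape.up ℤ) n Y 0 hn).eq_of_tgt _ _
      · exact (HomologicalComplex.isZero_single_obj_X (ComplexShape.up ℤ) 0 _ i hi).eq_of_src _ _
    have h2 : (CochainComplex.singleFunctor B 0 ⋙ DerivedCategory.Q).map p ≫
        e.inv.app X ≫ f ≫ e'.hom.app Y = 0 := by
      have h3 : (CochainComplex.singleFunctor B 0 ⋙ DerivedCategory.Q).map p =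
          DerivedCategory.Q.map φ ≫ DerivedCategory.Q.map s :=
        (congrArg DerivedCategory.Q.map hp).trans (DerivedCategory.Q.map_comp φ s)
      have h4 : DerivedCategory.Q.map φ ≫ DerivedCategory.Q.map g = 0 :=
        (DerivedCategory.Q.map_comp φ g).symm.trans
          ((congrArg DerivedCategory.Q.map h1).trans (DerivedCategory.Q.map_zero _ _))
      refine (congrArg₂ (· ≫ ·) h3 hg).trans ((Category.assoc _ _ _).trans ?_)
      exact (congrArg (DerivedCategory.Q.map φ ≫ ·)
        (IsIso.hom_inv_id_assoc (DerivedCategory.Q.map s) (DerivedCategory.Q.map g))).trans h4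
    have h5 := e.inv.naturality p
    rw [← cancel_epi (e.inv.app _), ← cancel_mono (e'.hom.app Y), Category.assoc, Category.assoc,
      comp_zero, zero_comp, ← reassoc_of% h5]
    exact h2

open Abelian in
theorem exists_epi_mk₀_comp_eq_zero [HasExt.{w} B] {X Y : B} {n : ℕ} (hn : n ≠ 0)
    (α : Ext X Y n) :
    ∃ (X' : B) (p : X' ⟶ X), Epi p ∧ (Ext.mk₀ p).comp α (zero_add n) = 0 := by
  let := HasDerivedCategory.standard B
  let e := (DerivedCategory.singleFunctors B).shiftIso (n : ℤ) (-n) 0 (by simp)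
  obtain ⟨X', p, hp, h⟩ := exists_epi_single_comp_eq_zero (n := -(n : ℤ)) (by lia)
    (α.hom ≫ e.hom.app Y)
  refine ⟨X', p, hp, ?_⟩
  apply Ext.ext
  rw [Ext.comp_hom, Ext.mk₀_hom, ShiftedHom.mk₀_comp, Ext.zero_hom]
  rw [← Category.assoc] at h
  exact (cancel_mono (e.hom.app Y)).1 (h.trans zero_comp.symm)

open Abelian in
/-- Over a hereditary category all higher extensions vanish. -/
theorem IsHereditary.subsingleton_ext [HasExt.{w} B] (hB : IsHereditary B) (X Y : B) (n : ℕ)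
    (hn : 2 ≤ n) : Subsingleton (Ext X Y n) := by
  induction n, hn using Nat.le_induction generalizing X with
  | base =>
    have h := hB X Y
    let := HasExt.standard B
    exact @Function.Injective.subsingleton _ _ _
      (Ext.chgUniv.{w, max u v} (X := X) (Y := Y) (n := 2)).symm.injective h
  | succ n hn ih =>
    refine subsingleton_of_forall_eq 0 fun α ↦ ?_
    -- Dimension shifting: an extension killed by `p` comes from an extension of `kernel p` of
    -- degree one less.
    obtain ⟨X', p, hp, h⟩ := exists_epi_mk₀_comp_eq_zero n.succ_ne_zero α
    have hS : (ShortComplex.mk (kernel.ι p) p (kernel.condition p)).ShortExact :=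
      { exact := ShortComplex.exact_kernel p }
    obtain ⟨x, rfl⟩ := Ext.contravariant_sequence_exact₃ hS Y α h (add_comm 1 n)
    rw [(ih _).elim x 0, Ext.comp_zero]

open Abelian in
/-- An abelian category is hereditary if extensions of a subobject always come from extensions of
the ambient object. -/
theorem isHereditary_of_exists_ses
    (h : ∀ {L K' K X : B} (i : L ⟶ K') (p : K' ⟶ K) (_ : Ses i p) (j : K ⟶ X) [Mono j],
      ∃ (E : B) (i' : L ⟶ E) (p' : E ⟶ X) (b : K' ⟶ E), Ses i' p' ∧ i ≫ b = i' ∧ b ≫ p' = p ≫ j) :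
    IsHereditary B := by
  have := HasExt.standard B
  intro X Y
  refine subsingleton_of_forall_eq 0 fun α ↦ ?_
  obtain ⟨X', p, hp, hα⟩ := exists_epi_mk₀_comp_eq_zero two_ne_zero α
  have hS : (ShortComplex.mk (kernel.ι p) p (kernel.condition p)).ShortExact :=
    { exact := ShortComplex.exact_kernel p }
  obtain ⟨x, rfl⟩ := Ext.contravariant_sequence_exact₃ hS Y α hα (add_comm 1 1)
  obtain ⟨K', q, hq, hx⟩ := exists_epi_mk₀_comp_eq_zero one_ne_zero x
  have hS' : (ShortComplex.mk (kernel.ι q) q (kernel.condition q)).ShortExact :=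
    { exact := ShortComplex.exact_kernel q }
  obtain ⟨y, rfl⟩ := Ext.contravariant_sequence_exact₃ hS' Y x hx (add_zero 1)
  obtain ⟨E, i', p', b, hE, h1, h2⟩ := h (kernel.ι q) q (Ses.of_kernel q) (kernel.ι p)
  let ψ : ShortComplex.mk (kernel.ι q) q (kernel.condition q) ⟶ ShortComplex.mk i' p' hE.w :=
    { τ₁ := 𝟙 _
      τ₂ := b
      τ₃ := kernel.ι p
      comm₁₂ := by simpa using h1.symm
      comm₂₃ := h2 }
  -- `α` is a product of the extension classes of `p` and `q` with `y`. By hypothesis the class of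
  -- `q` is restricted from `X` along `kernel.ι p`, and the class of `p` followed by `kernel.ι p`
  -- vanishes.
  have h3 := ShortComplex.ShortExact.extClass_naturality hS' hE.2 ψ
  have h4 : hS'.extClass = (Ext.mk₀ (kernel.ι p)).comp hE.2.extClass (zero_add 1) := by
    simpa [ψ] using h3
  rw [h4, Ext.comp_assoc _ _ _ (zero_add 1) (add_zero 1) (by norm_num)]
  exact hS.extClass_comp_assoc _

end Effaceable

/-! ### Hereditary t-structures: purity and degree of indecomposables. -/

section HereditaryTStructure

variable {D : Type u} [Category.{v} D] [Preadditive D] [HasZeroObject D] [HasShift D ℤ]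
  [∀ n : ℤ, (shiftFunctor D n).Additive] [Pretriangulated D] (t : TStructure D)

/-- An object is pure of degree `n` if it is the shift by `-n` of an object of the heart. -/
def IsPure (n : ℤ) : ObjectProperty D := fun X ↦ t.IsGE X n ∧ t.IsLE X n

theorem exists_pure_triangle (X : D) (a b : ℤ) (hab : a ≤ b) [t.IsGE X a] [t.IsLE X b] :
    ∃ (X' X'' : D) (f : X' ⟶ X) (g : X ⟶ X'') (h : X'' ⟶ X'⟦(1 : ℤ)⟧),
      Triangle.mk f g h ∈ distTriang D ∧ IsPure t a X' ∧ t.IsGE X'' (a + 1) ∧ t.IsLE X'' b := by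
  obtain ⟨X', X'', h1, h2, f, g, h, hT⟩ := t.exists_triangle X a (a + 1) rfl
  have h1 : t.IsLE X' a := ⟨h1⟩
  have h2 : t.IsGE X'' (a + 1) := ⟨h2⟩
  have h3 : t.IsLE (X'⟦(1 : ℤ)⟧) (a - 1) := t.isLE_shift _ a 1 (a - 1)
  have h4 : t.IsGE (X''⟦(-1 : ℤ)⟧) (a + 2) := t.isGE_shift _ (a + 1) (-1) (a + 2)
  have h5 : t.IsLE (X'⟦(1 : ℤ)⟧) b := t.isLE_of_le _ (a - 1) b
  have h6 : t.IsGE (X''⟦(-1 : ℤ)⟧) a := t.isGE_of_ge _ a (a + 2)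
  exact ⟨X', X'', f, g, h, hT, ⟨t.isGE₂ _ (inv_rot_of_distTriang _ hT) a h6 ‹t.IsGE X a›, h1⟩, h2,
    t.isLE₂ _ (rot_of_distTriang _ hT) b ‹t.IsLE X b› h5⟩

theorem induction_pure (P : ObjectProperty D) (a : ℤ) (N : ℕ)
    (hp : ∀ (n : ℤ) (X : D), a ≤ n → n ≤ a + N → IsPure t n X → P X)
    (hext : ∀ T ∈ distTriang D, P T.obj₁ → P T.obj₃ → P T.obj₂)
    (X : D) (h1 : t.IsGE X a) (h2 : t.IsLE X (a + N)) : P X := by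
  induction N generalizing a X with
  | zero => exact hp a X le_rfl (by simp) ⟨h1, by simpa using h2⟩
  | succ N ih =>
    obtain ⟨X', X'', f, g, h, hT, hX', h3, h4⟩ :=
      exists_pure_triangle t X a (a + (N + 1 : ℕ)) (by lia)
    refine hext _ hT (hp a X' le_rfl (by lia) hX') (ih (a + 1) ?_ X'' h3 ?_)
    · exact fun n Y h h' ↦ hp n Y (by lia) (by push_cast; lia)
    · exact t.isLE_of_le _ (a + (N + 1 : ℕ)) _ (by push_cast; lia)

/-- A bounded t-structure whose heart has no extensions of degree at least two, and split
idempotents. -/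
structure IsHereditaryTStructure : Prop where
  exists_isGE (X : D) : ∃ a, t.IsGE X a
  exists_isLE (X : D) : ∃ a, t.IsLE X a
  eq_zero {m n : ℤ} {X Y : D} (hX : IsPure t n X) (hY : IsPure t m Y) (h : m + 2 ≤ n)
    (f : X ⟶ Y) : f = 0
  splits {n : ℤ} {X : D} (hX : IsPure t n X) (e : X ⟶ X) (he : e ≫ e = e) :
    ∃ (Y : D) (i : Y ⟶ X) (p : X ⟶ Y), i ≫ p = 𝟙 Y ∧ p ≫ i = e

variable {t}

namespace IsHereditaryTStructure

theorem induction (ht : IsHereditaryTStructure t) (P : ObjectProperty D)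
    (hp : ∀ (n : ℤ) (X : D), IsPure t n X → P X)
    (hext : ∀ T ∈ distTriang D, P T.obj₁ → P T.obj₃ → P T.obj₂) (X : D) : P X := by
  obtain ⟨a, ha⟩ := ht.exists_isGE X
  obtain ⟨b, hb⟩ := ht.exists_isLE X
  refine induction_pure t P a (b - a).toNat (fun n X _ _ ↦ hp n X) hext X ha ?_
  exact t.isLE_of_le _ b _ (by lia)

theorem finite_hom {k : Type*} [Field k] [Linear k D] (ht : IsHereditaryTStructure t)
    (h : ∀ (m n : ℤ) (X Y : D), IsPure t m X → IsPure t n Y → Module.Finite k (X ⟶ Y)) (X Y : D) :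
    Module.Finite k (X ⟶ Y) := by
  have key {M₁ M₂ M₃ : Type v} [AddCommGroup M₁] [AddCommGroup M₂] [AddCommGroup M₃] [Module k M₁]
      [Module k M₂] [Module k M₃] (f : M₁ →ₗ[k] M₂) (g : M₂ →ₗ[k] M₃)
      (hfg : Function.Exact f g) (_ : Module.Finite k M₁) (_ : Module.Finite k M₃) :
      Module.Finite k M₂ := by
    have := isNoetherian_of_isNoetherianRing_of_finite k M₁
    have := isNoetherian_of_isNoetherianRing_of_finite k M₃
    have : IsNoetherian k M₂ := 
      isNoetherian_of_range_eq_ker f g (LinearMap.exact_iff.1 hfg).symm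
    infer_instance
  have h1 (m : ℤ) (X : D) (hX : IsPure t m X) : Module.Finite k (X ⟶ Y) := by
    refine ht.induction (fun Y ↦ Module.Finite k (X ⟶ Y)) (fun n Y hY ↦ h m n X Y hX hY) ?_ Y
    intro T hT h1 h3
    refine key (Linear.rightComp k X T.mor₁) (Linear.rightComp k X T.mor₂)
      (fun x ↦ ⟨fun hx ↦ ?_, ?_⟩) h1 h3
    · obtain ⟨y, hy⟩ := T.coyoneda_exact₂ hT x hx
      exact ⟨y, hy.symm⟩
    · rintro ⟨y, rfl⟩
      simp [comp_distTriang_mor_zero₁₂ _ hT]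
  refine ht.induction (fun X ↦ Module.Finite k (X ⟶ Y)) h1 ?_ X
  intro T hT h1 h3
  refine key (Linear.leftComp k Y T.mor₂) (Linear.leftComp k Y T.mor₁)
    (fun x ↦ ⟨fun hx ↦ ?_, ?_⟩) h3 h1
  · obtain ⟨y, hy⟩ := T.yoneda_exact₂ hT x hx
    exact ⟨y, hy.symm⟩
  · rintro ⟨y, rfl⟩
    simp [comp_distTriang_mor_zero₁₂_assoc _ hT]

/-- Dévissage along the truncation triangles of both objects reduces to the pure case. -/
theorem hom_eq_zero (ht : IsHereditaryTStructure t) {m n : ℤ} {X Y : D} [hX : t.IsGE X n]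
    [hY : t.IsLE Y m] (h : m + 2 ≤ n) (f : X ⟶ Y) : f = 0 := by
  obtain ⟨b, hb⟩ := ht.exists_isLE X
  obtain ⟨a, ha⟩ := ht.exists_isGE Y
  have h1 (n' : ℤ) (X : D) (hn' : n ≤ n') (hX : IsPure t n' X) : ∀ f : X ⟶ Y, f = 0 := by
    refine induction_pure t (fun Y ↦ ∀ f : X ⟶ Y, f = 0) (min a m) (m - min a m).toNat ?_ ?_ Y
      (t.isGE_of_ge _ _ a) (t.isLE_of_le _ m _ (by lia))
    · exact fun m' Y _ _ hY ↦ ht.eq_zero hX hY (by lia)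
    · intro T hT h1 h3 f
      obtain ⟨y, rfl⟩ := T.coyoneda_exact₂ hT f (h3 _)
      rw [h1 y, zero_comp]
  refine induction_pure t (fun X ↦ ∀ f : X ⟶ Y, f = 0) n (b - n).toNat
    (fun n' X hn' _ hX ↦ h1 n' X hn' hX) ?_ X hX (t.isLE_of_le _ b _ (by lia)) f
  intro T hT h1 h3 f
  obtain ⟨y, rfl⟩ := T.yoneda_exact₂ hT f (h1 _)
  rw [h3 y, comp_zero]

/-- Indecomposable objects are pure. -/
theorem exists_isPure (ht : IsHereditaryTStructure t) {X : D} (hX : Indecomposable X) :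
    ∃ n, IsPure t n X := by
  obtain ⟨a, ha⟩ := ht.exists_isGE X
  obtain ⟨b, hb⟩ := ht.exists_isLE X
  have h2 : t.IsLE X (a + (b - a).toNat) := t.isLE_of_le _ b _ (by lia)
  generalize (b - a).toNat = N at h2
  induction N generalizing a with
  | zero => exact ⟨a, ha, by simpa using h2⟩
  | succ N ih =>
    obtain ⟨X', X'', f, g, h, hT, hX', h3, h4⟩ :=
      exists_pure_triangle t X a (a + (N + 1 : ℕ)) (by lia)
    have h5 : t.IsLE X' a := hX'.2
    have h6 : t.IsLE (X'⟦(1 : ℤ)⟧) (a - 1) := t.isLE_shift _ a 1 (a - 1)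
    -- The connecting morphism goes from degrees at least `a + 1` to degrees at most `a - 1`. A gap
    -- of two makes it zero, so the truncation triangle splits.
    obtain ⟨e, -, -⟩ := exists_iso_binaryBiproduct_of_distTriang _ hT
      (ht.hom_eq_zero (m := a - 1) (n := a + 1) (by lia) h : h = 0)
    rcases hX.2 X' X'' e with h0 | h0
    · have : IsIso g := (Triangle.isZero₁_iff_isIso₂ _ hT).1 h0
      refine ih (a + 1) (t.isGE_of_iso (asIso g).symm _) ?_
      exact t.isLE_of_le _ (a + (N + 1 : ℕ)) _ (by push_cast; lia)
    · have : IsIso f := (Triangle.isZero₃_iff_isIso₁ _ hT).1 h0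
      have := hX'.1
      exact ⟨a, t.isGE_of_iso (asIso f) _, t.isLE_of_iso (asIso f) _⟩

/-- Indecomposables are pure, so splitting idempotents of pure objects suffices; idempotent
completeness of the whole category is not required. -/
theorem hasTrivialIdempotents (ht : IsHereditaryTStructure t) : HasTrivialIdempotents D where
  eq_zero_or_eq_one {X} hX e he := by
    obtain ⟨n, hn⟩ := ht.exists_isPure hX
    obtain ⟨Y, i, p, hip, hpi⟩ := ht.splits hn e he
    obtain ⟨Z, j, q, hjq, hqj⟩ := ht.splits hn (𝟙 X - e) (by
      simp [Preadditive.sub_comp, Preadditive.comp_sub, he])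
    exact eq_zero_or_eq_one_of_splitting hX i p j q hip hpi hjq hqj

end IsHereditaryTStructure

/-- A degree on the indecomposable objects which does not decrease along nonzero morphisms and
is compatible with the shift. -/
structure IsDegree (deg : D → ℤ) : Prop where
  le {X Y : D} (hX : Indecomposable X) (hY : Indecomposable Y) (f : X ⟶ Y) (hf : f ≠ 0) :
    deg X ≤ deg Y
  shift {X : D} (hX : Indecomposable X) (hX' : Indecomposable (X⟦(1 : ℤ)⟧)) :
    deg (X⟦(1 : ℤ)⟧) = deg X + 1

theorem IsPure.eq {m n : ℤ} {X : D} (hX : ¬ IsZero X) (h : IsPure t m X) (h' : IsPure t n X) :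
    m = n := by
  obtain ⟨h1, h2⟩ := h
  obtain ⟨h3, h4⟩ := h'
  by_contra hne
  rcases lt_or_gt_of_ne hne with h | h
  · exact hX (t.isZero X m n)
  · exact hX (t.isZero X n m)

theorem IsHereditaryTStructure.exists_isDegree (ht : IsHereditaryTStructure t) :
    ∃ deg : D → ℤ, IsDegree deg := by
  classical
  -- The sign makes the degree grow under the shift, since a pure object of degree `n` is the shift
  -- by `-n` of a heart object. The value `0` is a default off the pure objects.
  let deg (X : D) : ℤ := if h : ∃ n, IsPure t n X then - h.choose else 0
  have hdeg {X : D} (hX : Indecomposable X) : IsPure t (- deg X) X := by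
    have h := ht.exists_isPure hX
    simp only [deg, dif_pos h, neg_neg]
    exact h.choose_spec
  refine ⟨deg, ⟨fun {X Y} hX hY f hf ↦ ?_, fun {X} hX hX' ↦ ?_⟩⟩
  · by_contra! hlt
    have := (hdeg hX).2
    have := (hdeg hY).1
    exact hf (t.zero f (- deg X) (- deg Y))
  · have h1 := (hdeg hX).1
    have h2 := (hdeg hX).2
    have := IsPure.eq hX'.1 (hdeg hX') (n := - deg X - 1)
      ⟨t.isGE_shift _ (- deg X) 1 _, t.isLE_shift _ (- deg X) 1 _⟩
    lia

end HereditaryTStructure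

/-! ### The standard t-structure on the bounded derived category. -/

section BoundedDerivedCategory

variable {A : Type u} [Category.{v} A] [Abelian A] [HasDerivedCategory.{w} A]

open DerivedCategory DerivedCategory.TStructure

theorem exists_iso_singleFunctor_of_isPure {n : ℤ} {X : DerivedCategory A} (hX : IsPure t n X) :
    ∃ Y : A, Nonempty (X ≅ (singleFunctor A n).obj Y) := by
  have := hX.1
  have := hX.2
  exact exists_iso_singleFunctor_obj_of_isGE_of_isLE X n

/-- Morphisms between shifts of objects of the abelian category are extensions. -/
theorem exists_ext_injection {k : Type*} [Field k] [Linear k A] [HasExt.{max u v} A]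
    {m n : ℤ} (X Y : A) (i : ℕ) (h : n + i = m) :
    ∃ f : ((singleFunctor A m).obj X ⟶ (singleFunctor A n).obj Y) →ₗ[k]
      Abelian.Ext.{max u v} X Y i, Function.Injective f := by
  let e : ((singleFunctor A m).obj X)⟦m⟧ ≅ (singleFunctor A 0).obj X :=
    ((singleFunctors A).shiftIso m 0 m (by lia)).app X
  let e' : ((singleFunctor A n).obj Y)⟦m⟧ ≅ ((singleFunctor A 0).obj Y)⟦(i : ℤ)⟧ :=
    ((singleFunctors A).shiftIso m (-i) n (by lia)).app Y ≪≫
      (((singleFunctors A).shiftIso (i : ℤ) (-i) 0 (by lia)).app Y).symm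
  let f₁ := (shiftFunctor (DerivedCategory A) m).mapLinearMap k
    (X := (singleFunctor A m).obj X) (Y := (singleFunctor A n).obj Y)
  let f₂ := Linear.homCongr k e e'
  let f₃ : _ ≃ₗ[k] Abelian.Ext.{max u v} X Y i := Abelian.Ext.homLinearEquiv.symm
  exact ⟨f₃.toLinearMap ∘ₗ f₂.toLinearMap ∘ₗ f₁, f₃.injective.comp (f₂.injective.comp
    (shiftFunctor (DerivedCategory A) m).map_injective)⟩

theorem exists_ext_injection_bounded (k : Type*) [Field k] [Linear k A] [HasExt.{max u v} A]
    {m n : ℤ} {X Y : Bounded A} (hX : IsPure t.onBounded m X) (hY : IsPure t.onBounded n Y)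
    (i : ℕ) (h : n + i = m) :
    ∃ (X' Y' : A) (f : (X ⟶ Y) →ₗ[k] Abelian.Ext.{max u v} X' Y' i), Function.Injective f := by
  obtain ⟨X', ⟨e⟩⟩ := exists_iso_singleFunctor_of_isPure (X := X.obj)
    ⟨⟨hX.1.ge⟩, ⟨hX.2.le⟩⟩
  obtain ⟨Y', ⟨e'⟩⟩ := exists_iso_singleFunctor_of_isPure (X := Y.obj)
    ⟨⟨hY.1.ge⟩, ⟨hY.2.le⟩⟩
  obtain ⟨f, hf⟩ := exists_ext_injection (k := k) X' Y' i h
  let g := (Bounded.ι (C := A)).mapLinearMap k (X := X) (Y := Y)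
  let e'' := Linear.homCongr k e e'
  exact ⟨X', Y', f ∘ₗ e''.toLinearMap ∘ₗ g,
    hf.comp (e''.injective.comp (Bounded.ι (C := A)).map_injective)⟩

/-- Morphisms between pure objects of degrees `n ≥ m` embed in `Ext` of degree `n - m`, which
vanishes from degree two on. Idempotents of pure objects split because they split in `A`. -/
theorem isHereditaryTStructure_onBounded (k : Type*) [Field k] [Linear k A]
    (hA : IsHereditary A) : IsHereditaryTStructure (t (C := A)).onBounded where
  exists_isGE X := by
    obtain ⟨a, ha⟩ := X.2.1
    exact ⟨a, ⟨ha.ge⟩⟩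
  exists_isLE X := by
    obtain ⟨a, ha⟩ := X.2.2
    exact ⟨a, ⟨ha.le⟩⟩
  eq_zero {m n X Y} hX hY h f := by
    have := HasExt.standard A
    obtain ⟨X', Y', g, hg⟩ := exists_ext_injection_bounded k hX hY (n - m).toNat (by lia)
    have := hA.subsingleton_ext X' Y' (n - m).toNat (by lia)
    exact hg (Subsingleton.elim _ _)
  splits {n X} hX e he := by
    obtain ⟨X', ⟨φ⟩⟩ := exists_iso_singleFunctor_of_isPure (X := X.obj)
      ⟨⟨hX.1.ge⟩, ⟨hX.2.le⟩⟩
    obtain ⟨e', he'⟩ := (singleFunctor A n).map_surjective (φ.inv ≫ (Bounded.ι (C := A)).map e ≫ φ.hom)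
    have hidem : e' ≫ e' = e' := by
      apply (singleFunctor A n).map_injective
      rw [Functor.map_comp, he']
      simp only [Category.assoc, Iso.hom_inv_id_assoc]
      rw [← Functor.map_comp_assoc, he]
    obtain ⟨Y', i, p, hip, hpi⟩ := IsIdempotentComplete.idempotents_split X' e' hidem
    let Y : Bounded A := ⟨(singleFunctor A n).obj Y', ⟨n, inferInstance⟩, ⟨n, inferInstance⟩⟩
    refine ⟨Y, ObjectProperty.homMk ((singleFunctor A n).map i ≫ φ.inv),
      ObjectProperty.homMk (φ.hom ≫ (singleFunctor A n).map p), ?_, ?_⟩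
    · apply (Bounded.ι (C := A)).map_injective
      simp [← Functor.map_comp, hip, Y]
    · apply (Bounded.ι (C := A)).map_injective
      simp [← Functor.map_comp_assoc, hpi, he']

theorem finite_hom_bounded {k : Type*} [Field k] [Linear k A] (hA : IsHereditary A)
    (hfin : IsExtFinite k A) (X Y : Bounded A) : Module.Finite k (X ⟶ Y) := by
  refine (isHereditaryTStructure_onBounded k hA).finite_hom (fun m n X Y hX hY ↦ ?_) X Y
  rcases lt_or_ge m n with hmn | hmn
  · have := hX.2
    have := hY.1
    have : Subsingleton (X ⟶ Y) :=
      subsingleton_of_forall_eq 0 fun f ↦ (t (C := A)).onBounded.zero f m n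
    infer_instance
  · have := HasExt.standard A
    obtain ⟨X', Y', g, hg⟩ := exists_ext_injection_bounded k hX hY (m - n).toNat (by lia)
    have := hfin X' Y' (m - n).toNat
    exact Module.Finite.of_injective g hg

instance {k : Type*} [Field k] [Linear k A] (n : ℤ) : (shiftFunctor (Bounded A) n).Linear k where
  map_smul {X Y} f r := by
    apply (Bounded.ι (C := A)).map_injective
    have h (g : X ⟶ Y) := ((Bounded.ι (C := A)).commShiftIso n).hom.naturality g
    dsimp only [Functor.comp_map] at h
    rw [← cancel_mono (((Bounded.ι (C := A)).commShiftIso n).hom.app Y), h]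
    rw [Functor.map_smul (Bounded.ι (C := A)), Functor.map_smul, Functor.map_smul,
      Linear.comp_smul, Linear.smul_comp, h]

end BoundedDerivedCategory

/-! ### Serre duality as a duality between first extensions and morphisms to the translation. -/

section Serre

variable {k : Type t} [Field k] {D : Type u} [Category.{v} D] [Preadditive D] [Linear k D]

namespace SerreFunctor

variable (S : SerreFunctor k D)

theorem eq_of_duality {X Y : D} (x y : Y ⟶ S.S.functor.obj X)
    (h : ∀ f : X ⟶ Y, S.duality X Y f x = S.duality X Y f y) : x = y := by
  rw [← sub_eq_zero]
  refine (Module.forall_dual_apply_eq_zero_iff k _).1 fun φ ↦ ?_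
  obtain ⟨f, rfl⟩ := (S.duality X Y).surjective φ
  rw [map_sub, h f, sub_self]

theorem exists_duality_ne_zero {X Y : D} (f : X ⟶ Y) (hf : f ≠ 0) :
    ∃ g : Y ⟶ S.S.functor.obj X, S.duality X Y f g ≠ 0 := by
  by_contra! h
  exact hf ((S.duality X Y).map_eq_zero_iff.1 (LinearMap.ext h))

theorem exists_ne_zero {X Y : D} (f : X ⟶ Y) (hf : f ≠ 0) :
    ∃ g : Y ⟶ S.S.functor.obj X, g ≠ 0 := by
  obtain ⟨g, hg⟩ := S.exists_duality_ne_zero f hf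
  exact ⟨g, by rintro rfl; exact hg (map_zero _)⟩

/-- Additivity is forced by the pairing: it is nondegenerate and `naturality_left` expresses `S f`
through composition with `f`. Linearity follows in the same way. -/
instance : S.S.functor.Additive where
  map_add {X Y f g} := by
    have key (Z : D) (φ : Z ⟶ S.S.functor.obj X) :
        φ ≫ S.S.functor.map (f + g) = φ ≫ (S.S.functor.map f + S.S.functor.map g) :=
      S.eq_of_duality _ _ fun h ↦ by
        rw [← S.naturality_left, Preadditive.add_comp, Preadditive.comp_add, map_add, map_add,
          LinearMap.add_apply, S.naturality_left, S.naturality_left]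
    simpa using key _ (𝟙 _)

instance : S.S.functor.Linear k where
  map_smul {X Y} f r := by
    have key (Z : D) (φ : Z ⟶ S.S.functor.obj X) :
        φ ≫ S.S.functor.map (r • f) = φ ≫ (r • S.S.functor.map f) :=
      S.eq_of_duality _ _ fun h ↦ by
        rw [← S.naturality_left, Linear.smul_comp, Linear.comp_smul, map_smul, map_smul,
          LinearMap.smul_apply, S.naturality_left]
    simpa using key _ (𝟙 _)

variable [HasZeroObject D] [HasShift D ℤ] [∀ n : ℤ, (shiftFunctor D n).Additive]
  [∀ n : ℤ, (shiftFunctor D n).Linear k] [Pretriangulated D]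

/-- The Auslander-Reiten translation as a functor. -/
noncomputable def tauFunctor : D ⥤ D := S.S.functor ⋙ shiftFunctor D (-1 : ℤ)

instance : S.tauFunctor.IsEquivalence :=
  inferInstanceAs (S.S.functor ⋙ shiftFunctor D (-1 : ℤ)).IsEquivalence

instance : S.tauFunctor.Additive :=
  inferInstanceAs (S.S.functor ⋙ shiftFunctor D (-1 : ℤ)).Additive

instance : S.tauFunctor.Linear k :=
  inferInstanceAs ((S.S.functor ⋙ shiftFunctor D (-1 : ℤ)).Linear k)

/-- The shift of the Auslander-Reiten translation is the Serre functor. -/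
noncomputable def tauShiftIso : S.tauFunctor ⋙ shiftFunctor D (1 : ℤ) ≅ S.S.functor :=
  Functor.isoWhiskerLeft S.S.functor (shiftEquiv D (1 : ℤ)).counitIso ≪≫ Functor.rightUnitor _

/-- Morphisms to the Auslander-Reiten translation, in terms of the Serre functor. -/
noncomputable def homTau (X Y : D) :
    (X ⟶ S.tauFunctor.obj Y) ≃ₗ[k] (X⟦(1 : ℤ)⟧ ⟶ S.S.functor.obj Y) :=
  LinearEquiv.ofBijective (Linear.rightComp k _ (S.tauShiftIso.hom.app Y) ∘ₗ
    (shiftFunctor D (1 : ℤ)).mapLinearMap k) (by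
      constructor
      · intro f g h
        exact (shiftFunctor D (1 : ℤ)).map_injective ((cancel_mono (S.tauShiftIso.hom.app Y)).1 h)
      · intro g
        obtain ⟨f, hf⟩ := (shiftFunctor D (1 : ℤ)).map_surjective (g ≫ S.tauShiftIso.inv.app Y)
        exact ⟨f, by simp [hf]⟩)

/-- Auslander-Reiten duality: first extensions are dual to morphisms to the translation. -/
noncomputable def extDual (X Y : D) :
    (Y ⟶ X⟦(1 : ℤ)⟧) ≃ₗ[k] Module.Dual k (X ⟶ S.tauFunctor.obj Y) :=
  S.duality Y (X⟦(1 : ℤ)⟧) ≪≫ₗ (S.homTau X Y).dualMap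

theorem extDual_apply {X Y : D} (δ : Y ⟶ X⟦(1 : ℤ)⟧) (f : X ⟶ S.tauFunctor.obj Y) :
    S.extDual X Y δ f = S.duality Y (X⟦(1 : ℤ)⟧) δ (f⟦(1 : ℤ)⟧' ≫ S.tauShiftIso.hom.app Y) := rfl

theorem extDual_comp {X Y Y' : D} (g : Y' ⟶ Y) (δ : Y ⟶ X⟦(1 : ℤ)⟧)
    (f : X ⟶ S.tauFunctor.obj Y') :
    S.extDual X Y' (g ≫ δ) f = S.extDual X Y δ (f ≫ S.tauFunctor.map g) := by
  have := S.tauShiftIso.hom.naturality g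
  dsimp only [Functor.comp_map] at this
  rw [extDual_apply, extDual_apply, S.naturality_left, Functor.map_comp, Category.assoc,
    Category.assoc, this]

theorem extDual_comp_shift {X X' Y : D} (δ : Y ⟶ X⟦(1 : ℤ)⟧) (g : X ⟶ X')
    (f : X' ⟶ S.tauFunctor.obj Y) :
    S.extDual X' Y (δ ≫ g⟦(1 : ℤ)⟧') f = S.extDual X Y δ (g ≫ f) := by
  rw [extDual_apply, extDual_apply, S.naturality_right, Functor.map_comp, Category.assoc]

theorem forall_eq_zero_iff (X Y : D) :
    (∀ f : Y ⟶ X⟦(1 : ℤ)⟧, f = 0) ↔ ∀ f : X ⟶ S.tauFunctor.obj Y, f = 0 := by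
  constructor
  · intro h f
    refine (Module.forall_dual_apply_eq_zero_iff k f).1 fun φ ↦ ?_
    obtain ⟨δ, rfl⟩ := (S.extDual X Y).surjective φ
    rw [h δ, map_zero, LinearMap.zero_apply]
  · intro h δ
    refine (S.extDual X Y).map_eq_zero_iff.1 (LinearMap.ext fun f ↦ ?_)
    rw [h f, map_zero, map_zero]

end SerreFunctor

end Serre

/-! ### Paths of nonzero morphisms. -/

section Reachability

variable {D : Type u} [Category.{v} D] [Preadditive D] [HasBinaryBiproducts D]

/-- There is a nonzero morphism between the indecomposable objects `X` and `Y`. -/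
def HomStep (X Y : D) : Prop := Indecomposable X ∧ Indecomposable Y ∧ ∃ f : X ⟶ Y, f ≠ 0

/-- There is a path of nonzero morphisms between indecomposable objects from `X` to `Y`. -/
def Reaches : D → D → Prop := Relation.ReflTransGen HomStep

theorem HomStep.of_iso {X Y : D} (e : X ≅ Y) (hX : Indecomposable X) : HomStep X Y :=
  ⟨hX, indecomposable_of_iso e hX, e.hom, fun h ↦ hX.1 ((IsZero.iff_id_eq_zero X).2 (by
    rw [← e.hom_inv_id, h, zero_comp]))⟩

theorem HomStep.map {D' : Type*} [Category* D'] [Preadditive D'] [HasBinaryBiproducts D']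
    (F : D ⥤ D') [F.IsEquivalence] [F.Additive] {X Y : D} (h : HomStep X Y) :
    HomStep (F.obj X) (F.obj Y) := by
  obtain ⟨hX, hY, f, hf⟩ := h
  exact ⟨indecomposable_map F hX, indecomposable_map F hY, F.map f, fun h ↦
    hf (F.map_injective (by rw [h, F.map_zero]))⟩

theorem Reaches.map {D' : Type*} [Category* D'] [Preadditive D'] [HasBinaryBiproducts D']
    (F : D ⥤ D') [F.IsEquivalence] [F.Additive] {X Y : D} (h : Reaches X Y) :
    Reaches (F.obj X) (F.obj Y) :=
  Relation.ReflTransGen.lift (p := HomStep) F.obj (fun _ _ h ↦ HomStep.map F h) _ _ h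

/-- `Y` is reachable from some object of `K`. -/
def ReachableFrom (K : ObjectProperty D) (Y : D) : Prop := ∃ X, K X ∧ Reaches X Y

/-- A class of indecomposable objects any two of which are connected by a path. -/
structure IsStronglyConnected (K : ObjectProperty D) : Prop where
  indecomposable {X : D} (hX : K X) : Indecomposable X
  of_iso {X Y : D} (e : X ≅ Y) (hX : K X) : K Y
  reaches {X Y : D} (hX : K X) (hY : K Y) : Reaches X Y

namespace IsStronglyConnected

variable {K : ObjectProperty D} (hK : IsStronglyConnected K)

include hK

theorem indecomposable_of_reachable {X : D} (h : ReachableFrom K X) : Indecomposable X := by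
  obtain ⟨Y, hY, h⟩ := h
  rcases Relation.ReflTransGen.cases_tail h with h | ⟨Z, -, h⟩
  · exact h ▸ hK.indecomposable hY
  · exact h.2.1

end IsStronglyConnected

theorem ReachableFrom.step {K : ObjectProperty D} {X Y : D} (h : ReachableFrom K X)
    (h' : HomStep X Y) : ReachableFrom K Y := by
  obtain ⟨Z, hZ, h⟩ := h
  exact ⟨Z, hZ, h.tail h'⟩

end Reachability

/-! ### The t-structure of reachable objects, its invariance and the degree argument. -/

section PathTStructure

variable {k : Type t} [Field k] [IsAlgClosed k] {D : Type u} [Category.{v} D] [Preadditive D]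
  [Linear k D] [HasZeroObject D] [HasShift D ℤ] [∀ n : ℤ, (shiftFunctor D n).Additive]
  [∀ n : ℤ, (shiftFunctor D n).Linear k] [Pretriangulated D]

/-- The objects without nonzero morphisms to indecomposable objects which cannot be reached
from `K`. -/
def reachableAisle (K : ObjectProperty D) : ObjectProperty D := fun X ↦
  ∀ Z, Indecomposable Z → ¬ ReachableFrom K Z → ∀ f : X ⟶ Z, f = 0

/-- The objects without nonzero morphisms from objects which can be reached from `K`. -/
def reachableCoaisle (K : ObjectProperty D) : ObjectProperty D := fun X ↦
  ∀ Y, ReachableFrom K Y → ∀ f : Y ⟶ X, f = 0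

instance (K : ObjectProperty D) : (reachableAisle K).IsClosedUnderIsomorphisms where
  of_iso e h Z hZ hZ' f := by
    rw [← cancel_epi e.hom, comp_zero]; exact h Z hZ hZ' _

instance (K : ObjectProperty D) : (reachableCoaisle K).IsClosedUnderIsomorphisms where
  of_iso e h Y hY f := by
    rw [← cancel_mono e.inv, zero_comp]; exact h Y hY _

theorem reachableAisle_biprod {K : ObjectProperty D} {X Y : D} (hX : reachableAisle K X)
    (hY : reachableAisle K Y) : reachableAisle K (X ⊞ Y) := fun Z hZ hZ' f ↦ by
  ext
  · simpa using hX Z hZ hZ' _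
  · simpa using hY Z hZ hZ' _

theorem reachableCoaisle_biprod {K : ObjectProperty D} {X Y : D} (hX : reachableCoaisle K X)
    (hY : reachableCoaisle K Y) : reachableCoaisle K (X ⊞ Y) := fun Z hZ f ↦ by
  ext
  · simpa using hX Z hZ _
  · simpa using hY Z hZ _

theorem reachableAisle_iff {K : ObjectProperty D} {X : D} (hX : Indecomposable X) :
    reachableAisle K X ↔ ReachableFrom K X := by
  refine ⟨fun h ↦ ?_, fun h Z hZ hZ' f ↦ ?_⟩
  · by_contra h'
    exact hX.1 ((IsZero.iff_id_eq_zero X).2 (h X hX h' _))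
  · by_contra hf
    exact hZ' (h.step ⟨hX, hZ, f, hf⟩)

/-- A nonzero morphism would be nonzero into an indecomposable summand of the target. If this
summand is reachable, it cannot embed in an object of the coaisle; if not, it receives nothing from
the aisle. -/
theorem hom_eq_zero_of_reachableAisle (hfin : ∀ X Y : D, Module.Finite k (X ⟶ Y))
    {K : ObjectProperty D} {X Y : D} (hX : reachableAisle K X) (hY : reachableCoaisle K Y)
    (f : X ⟶ Y) : f = 0 := by
  by_contra hf
  obtain ⟨Z, i, p, hZ, hip, hfp⟩ :=
    exists_indecomposable_summand_tgt k (fun X ↦ hfin X X) Y f hf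
  by_cases h : ReachableFrom K Z
  · have := hY Z h i
    rw [this, zero_comp] at hip
    exact hZ.1 ((IsZero.iff_id_eq_zero Z).2 hip.symm)
  · exact hfp (hX Z hZ h _)

/-- Each indecomposable lies in the aisle or in the coaisle, according to whether it is reachable.
Hence truncation is a direct sum decomposition. -/
theorem exists_decomposition (hfin : ∀ X Y : D, Module.Finite k (X ⟶ Y))
    {K : ObjectProperty D} (hK : IsStronglyConnected K) (X : D) :
    ∃ X' X'', reachableAisle K X' ∧ reachableCoaisle K X'' ∧ Nonempty (X ≅ X' ⊞ X'') := by
  refine induction_indecomposable k (fun X ↦ hfin X X) (P := fun X ↦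
    ∃ X' X'', reachableAisle K X' ∧ reachableCoaisle K X'' ∧ Nonempty (X ≅ X' ⊞ X'')) ?_ ?_ ?_ ?_ X
  · rintro X Y e ⟨X', X'', h, h', ⟨e'⟩⟩
    exact ⟨X', X'', h, h', ⟨e.symm ≪≫ e'⟩⟩
  · intro X hX
    exact ⟨X, X, fun Z _ _ f ↦ hX.eq_of_src _ _, fun Z _ f ↦ hX.eq_of_tgt _ _,
      ⟨hX.iso (by rw [biprod_isZero_iff]; exact ⟨hX, hX⟩)⟩⟩
  · intro X hX
    obtain ⟨O, hO⟩ := HasZeroObject.zero (C := D)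
    by_cases h : ReachableFrom K X
    · exact ⟨X, O, (reachableAisle_iff hX).2 h, fun Z _ f ↦ hO.eq_of_tgt _ _,
        ⟨{ hom := biprod.inl, inv := biprod.fst
           inv_hom_id := biprod.hom_ext' _ _ (by simp) (hO.eq_of_src _ _) }⟩⟩
    · refine ⟨O, X, fun Z _ _ f ↦ hO.eq_of_src _ _, fun Y hY f ↦ ?_,
        ⟨{ hom := biprod.inr, inv := biprod.snd
           inv_hom_id := biprod.hom_ext' _ _ (hO.eq_of_src _ _) (by simp) }⟩⟩
      by_contra hf
      exact h (hY.step ⟨hK.indecomposable_of_reachable hY, hX, f, hf⟩)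
  · rintro X Y ⟨X', X'', h1, h2, ⟨e⟩⟩ ⟨Y', Y'', h3, h4, ⟨e'⟩⟩
    refine ⟨X' ⊞ Y', X'' ⊞ Y'', reachableAisle_biprod h1 h3, reachableCoaisle_biprod h2 h4,
      ⟨biprod.mapIso e e' ≪≫
        { hom := biprod.lift (biprod.map biprod.fst biprod.fst) (biprod.map biprod.snd biprod.snd)
          inv := biprod.lift (biprod.map biprod.fst biprod.fst) (biprod.map biprod.snd biprod.snd)
          hom_inv_id := ?_
          inv_hom_id := ?_ }⟩⟩ <;> ext <;> simp

variable (S : SerreFunctor k D)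

/-- The reachable objects are closed under the shift. -/
theorem ReachableFrom.shift {K : ObjectProperty D} (hK : IsStronglyConnected K)
    (hτ : ∀ X, K X → K (S.tau X)) {X : D} (h : ReachableFrom K X) :
    ReachableFrom K (X⟦(1 : ℤ)⟧) := by
  obtain ⟨Y, hY, h⟩ := h
  have hYi := hK.indecomposable hY
  have h1 : Reaches ((S.tau Y)⟦(1 : ℤ)⟧) (Y⟦(1 : ℤ)⟧) :=
    (hK.reaches (hτ Y hY) hY).map (shiftFunctor D (1 : ℤ))
  -- Serre duality applied to `𝟙 Y` gives a nonzero morphism to `S Y ≅ (τ Y)[1]`. As `τ Y` and `Y`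
  -- both lie in `K`, the path continues to `Y[1]` and then to `X[1]`.
  have h2 : HomStep Y ((S.tau Y)⟦(1 : ℤ)⟧) := by
    obtain ⟨f, hf⟩ := S.exists_ne_zero (𝟙 Y) fun h ↦ hYi.1 ((IsZero.iff_id_eq_zero Y).2 h)
    let e := S.tauShiftIso.app Y
    refine ⟨hYi, ?_, f ≫ e.inv, fun h ↦ hf ?_⟩
    · exact indecomposable_map (shiftFunctor D (1 : ℤ)) (hK.indecomposable (hτ Y hY))
    · exact (cancel_mono e.inv).1 (h.trans zero_comp.symm)
  exact ⟨Y, hY, (Relation.ReflTransGen.head h2 h1).trans (h.map (shiftFunctor D (1 : ℤ)))⟩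

/-- The t-structure whose aisle is given by the objects which can be reached from `K`. -/
structure IsReachabilityTStructure (K : ObjectProperty D) (T : TStructure D) : Prop where
  isLE_iff (X : D) : T.IsLE X 0 ↔ reachableAisle K X
  isGE_iff (X : D) : T.IsGE X 1 ↔ reachableCoaisle K X

theorem exists_tStructure (hfin : ∀ X Y : D, Module.Finite k (X ⟶ Y)) {K : ObjectProperty D}
    (hK : IsStronglyConnected K) (hτ : ∀ X, K X → K (S.tau X)) :
    ∃ T : TStructure D, IsReachabilityTStructure K T := by
  let T : TStructure D :=
    { le := fun n X ↦ reachableAisle K (X⟦n⟧)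
      -- The coaisle is orthogonal to `D^{≤ 0}`, so it is `D^{≥ 1}`; hence the shift by `n - 1`.
      ge := fun n X ↦ reachableCoaisle K (X⟦n - 1⟧)
      le_isClosedUnderIsomorphisms := fun n ↦ ⟨fun e h ↦
        (reachableAisle K).prop_of_iso ((shiftFunctor D n).mapIso e) h⟩
      ge_isClosedUnderIsomorphisms := fun n ↦ ⟨fun e h ↦
        (reachableCoaisle K).prop_of_iso ((shiftFunctor D (n - 1)).mapIso e) h⟩
      le_shift := fun n a n' h X hX ↦
        (reachableAisle K).prop_of_iso ((shiftFunctorAdd' D a n' n h).app X) hX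
      ge_shift := fun n a n' h X hX ↦ (reachableCoaisle K).prop_of_iso
        ((shiftFunctorAdd' D a (n' - 1) (n - 1) (by lia)).app X) hX
      zero' := fun X Y f hX hY ↦ by
        have hX := (reachableAisle K).prop_of_iso ((shiftFunctorZero D ℤ).app X) hX
        have hY := (reachableCoaisle K).prop_of_iso ((shiftFunctorZero D ℤ).app Y) hY
        exact hom_eq_zero_of_reachableAisle hfin hX hY f
      le_zero_le := fun X hX Z hZ hZ' f ↦ by
        have hX := (reachableAisle K).prop_of_iso ((shiftFunctorZero D ℤ).app X) hX
        let e : (Z⟦(-1 : ℤ)⟧)⟦(1 : ℤ)⟧ ≅ Z := (shiftEquiv D (1 : ℤ)).counitIso.app Z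
        have hZ1 := indecomposable_map (shiftFunctor D (-1 : ℤ)) hZ
        obtain ⟨g, hg⟩ := (shiftFunctor D (1 : ℤ)).map_surjective (f ≫ e.inv)
        rw [hX _ hZ1 (fun h ↦ hZ' ?_) g, Functor.map_zero] at hg
        · exact (cancel_mono e.inv).1 (hg.symm.trans zero_comp.symm)
        · exact (h.shift S hK hτ).step (.of_iso e (indecomposable_map _ hZ1))
      ge_one_le := fun X hX Y hY f ↦ by
        let e : X⟦(1 : ℤ) - 1⟧ ≅ (X⟦(0 : ℤ) - 1⟧)⟦(1 : ℤ)⟧ :=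
          (shiftFunctorAdd' D ((0 : ℤ) - 1) 1 (1 - 1) (by lia)).app X
        have h := hX _ (hY.shift S hK hτ) (f⟦(1 : ℤ)⟧' ≫ e.inv)
        apply (shiftFunctor D (1 : ℤ)).map_injective
        rw [Functor.map_zero]
        exact (cancel_mono e.inv).1 (h.trans zero_comp.symm)
      exists_triangle_zero_one := fun X ↦ by
        obtain ⟨X', X'', h', h'', ⟨e⟩⟩ := exists_decomposition hfin hK X
        refine ⟨X', X'', (reachableAisle K).prop_of_iso ((shiftFunctorZero D ℤ).symm.app X') h',
          (reachableCoaisle K).prop_of_iso ((shiftFunctorZero D ℤ).symm.app X'') h'',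
          biprod.inl ≫ e.inv, e.hom ≫ biprod.snd, 0, ?_⟩
        refine isomorphic_distinguished _ (binaryBiproductTriangle_distinguished X' X'') _
          (Triangle.isoMk _ _ (Iso.refl _) e (Iso.refl _) ?_ ?_ ?_)
        · change (biprod.inl ≫ e.inv) ≫ e.hom = 𝟙 X' ≫ biprod.inl
          simp
        · change (e.hom ≫ biprod.snd) ≫ 𝟙 X'' = e.hom ≫ biprod.snd
          simp
        · change (0 : X'' ⟶ X'⟦(1 : ℤ)⟧) ≫ _ = 𝟙 X'' ≫ 0
          exact zero_comp.trans comp_zero.symm }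
  refine ⟨T, fun X ↦ ?_, fun X ↦ ?_⟩
  · rw [← T.le_iff_isLE]
    exact (reachableAisle K).prop_iff_of_iso ((shiftFunctorZero D ℤ).app X)
  · rw [← T.ge_iff_isGE]
    exact (reachableCoaisle K).prop_iff_of_iso ((shiftFunctorZero D ℤ).app X)

/-- A class of objects which is invariant under the Auslander-Reiten translation. -/
def IsTauStable (K : ObjectProperty D) : Prop := ∀ X, K (S.tau X) ↔ K X

variable {S}

theorem reachableFrom_tau_iff {K : ObjectProperty D} (hK : IsStronglyConnected K)
    (hτ : IsTauStable S K) {X : D} (hX : Indecomposable X) :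
    ReachableFrom K (S.tau X) ↔ ReachableFrom K X := by
  constructor
  · rintro ⟨Y, hY, h⟩
    let F := S.tauFunctor.asEquivalence
    have : S.tauFunctor.inv.Additive := by
      have : F.functor.Additive := inferInstanceAs S.tauFunctor.Additive
      exact F.inverse_additive
    have h1 : Reaches (S.tauFunctor.inv.obj Y) (S.tauFunctor.inv.obj (S.tau X)) :=
      h.map S.tauFunctor.inv
    have e : S.tauFunctor.inv.obj (S.tau X) ≅ X := (F.unitIso.app X).symm
    refine ⟨S.tauFunctor.inv.obj Y, (hτ _).1 (hK.of_iso (F.counitIso.app Y).symm hY),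
      h1.tail (.of_iso e (indecomposable_of_iso e.symm hX))⟩
  · rintro ⟨Y, hY, h⟩
    exact ⟨S.tau Y, (hτ Y).2 hY, h.map S.tauFunctor⟩

theorem forall_indecomposable_tau {P : D → Prop} (h : ∀ X, Indecomposable X → P (S.tau X))
    (hiso : ∀ {X Y} (_ : X ≅ Y), Indecomposable X → P X → P Y) (X : D) (hX : Indecomposable X) : P X := by
  let F := S.tauFunctor.asEquivalence
  have : S.tauFunctor.inv.Additive := by
    have : F.functor.Additive := inferInstanceAs S.tauFunctor.Additive
    exact F.inverse_additive
  have h1 := indecomposable_map S.tauFunctor.inv hX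
  exact hiso (F.counitIso.app X) (indecomposable_map S.tauFunctor h1) (h _ h1)

theorem reachableAisle_tau_iff {K : ObjectProperty D} (hK : IsStronglyConnected K)
    (hτ : IsTauStable S K) (X : D) : reachableAisle K (S.tau X) ↔ reachableAisle K X := by
  constructor
  · intro h Z hZ hZ' f
    apply S.tauFunctor.map_injective
    rw [Functor.map_zero]
    exact h _ (indecomposable_map S.tauFunctor hZ)
      (fun h ↦ hZ' ((reachableFrom_tau_iff hK hτ hZ).1 h)) _
  · intro h
    refine forall_indecomposable_tau (S := S) (fun Z hZ hZ' f ↦ ?_) (fun e hY h hZ' f ↦ ?_)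
    · obtain ⟨g, rfl⟩ : ∃ g : X ⟶ Z, S.tauFunctor.map g = f := S.tauFunctor.map_surjective f
      rw [h Z hZ (fun h ↦ hZ' ((reachableFrom_tau_iff hK hτ hZ).2 h)) g]
      exact S.tauFunctor.map_zero _ _
    · rw [← cancel_mono e.inv, zero_comp]
      exact h (fun h ↦ hZ' (h.step (.of_iso e hY))) _

/-- Duality replaces morphisms from `X[-1]` to `Z` by morphisms from `Z` to `τ X`. This removes the
shift, so the invariance of `D^{≤ -1}` under `τ` needs no commutation of `τ` with the shift. -/
theorem reachableAisle_shift_iff (S : SerreFunctor k D) {K : ObjectProperty D} (X : D) :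
    reachableAisle K (X⟦(-1 : ℤ)⟧) ↔
      ∀ Z, Indecomposable Z → ¬ ReachableFrom K Z → ∀ f : Z ⟶ S.tau X, f = 0 := by
  refine forall_congr' fun Z ↦ imp_congr_right fun _ ↦ imp_congr_right fun _ ↦ ?_
  refine Iff.trans ?_ (S.forall_eq_zero_iff Z X)
  let e : (X⟦(-1 : ℤ)⟧)⟦(1 : ℤ)⟧ ≅ X := (shiftEquiv D (1 : ℤ)).counitIso.app X
  constructor
  · intro h f
    obtain ⟨g, hg⟩ := (shiftFunctor D (1 : ℤ)).map_surjective (e.hom ≫ f)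
    rw [h g, Functor.map_zero] at hg
    exact (cancel_epi e.hom).1 (hg.symm.trans comp_zero.symm)
  · intro h f
    apply (shiftFunctor D (1 : ℤ)).map_injective
    rw [Functor.map_zero]
    exact (cancel_epi e.inv).1 ((h _).trans comp_zero.symm)

theorem reachableAisle_shift_tau_iff {K : ObjectProperty D} (hK : IsStronglyConnected K)
    (hτ : IsTauStable S K) (X : D) :
    reachableAisle K ((S.tau X)⟦(-1 : ℤ)⟧) ↔ reachableAisle K (X⟦(-1 : ℤ)⟧) := by
  rw [reachableAisle_shift_iff S, reachableAisle_shift_iff S]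
  constructor
  · intro h Z hZ hZ' f
    apply S.tauFunctor.map_injective
    rw [Functor.map_zero]
    exact h _ (indecomposable_map S.tauFunctor hZ)
      (fun h ↦ hZ' ((reachableFrom_tau_iff hK hτ hZ).1 h)) _
  · intro h
    refine forall_indecomposable_tau (S := S) (fun Z hZ hZ' f ↦ ?_) (fun e hY h hZ' f ↦ ?_)
    · obtain ⟨g, rfl⟩ : ∃ g : Z ⟶ S.tau X, S.tauFunctor.map g = f :=
        S.tauFunctor.map_surjective f
      rw [h Z hZ (fun h ↦ hZ' ((reachableFrom_tau_iff hK hτ hZ).2 h)) g]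
      exact S.tauFunctor.map_zero _ _
    · rw [← cancel_epi e.hom, comp_zero]
      exact h (fun h ↦ hZ' (h.step (.of_iso e hY))) _

namespace IsReachabilityTStructure

variable {K : ObjectProperty D} {T : TStructure D}

theorem isTauInvariant (hT : IsReachabilityTStructure K T) (hK : IsStronglyConnected K)
    (hτ : IsTauStable S K) : IsTauInvariant S T := by
  have h1 (X : D) : T.IsLE (S.tau X) (-1) ↔ T.IsLE X (-1) := by
    rw [← T.isLE_shift_iff _ (-1) (-1) 0, ← T.isLE_shift_iff X (-1) (-1) 0, hT.isLE_iff,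
      hT.isLE_iff, reachableAisle_shift_tau_iff hK hτ]
  intro X
  rw [T.le_iff_isLE, T.le_iff_isLE, T.ge_iff_isGE, T.ge_iff_isGE]
  refine ⟨?_, ?_⟩
  · rw [hT.isLE_iff, hT.isLE_iff, reachableAisle_tau_iff hK hτ]
  · rw [T.isGE_iff_orthogonal (-1) 0 (by lia), T.isGE_iff_orthogonal (-1) 0 (by lia)]
    constructor
    · intro h Y f hY
      let e : S.tau (S.tauFunctor.objPreimage Y) ≅ Y := S.tauFunctor.objObjPreimageIso Y
      obtain ⟨g, hg⟩ : ∃ g : S.tauFunctor.objPreimage Y ⟶ X, S.tauFunctor.map g = e.hom ≫ f :=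
        S.tauFunctor.map_surjective _
      rw [h _ g ((h1 _).1 (T.isLE_of_iso e.symm (-1)))] at hg
      exact (cancel_epi e.hom).1
        (hg.symm.trans ((S.tauFunctor.map_zero _ _).trans comp_zero.symm))
    · intro h Y f hY
      apply S.tauFunctor.map_injective
      rw [Functor.map_zero]
      exact h _ _ ((h1 _).2 hY)

theorem isGE_zero_iff (hT : IsReachabilityTStructure K T) (X : D) :
    T.IsGE X 0 ↔ ∀ Y, ReachableFrom K Y → ∀ f : Y ⟶ X⟦(-1 : ℤ)⟧, f = 0 := by
  rw [← T.isGE_shift_iff X 0 (-1) 1, hT.isGE_iff]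
  rfl

/-- Being reachable puts `Y` in `D^{≤ 0}`. If `Y` were not in `D^{≥ 0}`, then `Y[-1]` would be
reachable, hence also `Z[-1]` from `K` and so from `Z` itself. The degree forbids a path from `Z` to
`Z[-1]`. -/
theorem heart_of_path (hT : IsReachabilityTStructure K T) (hK : IsStronglyConnected K)
    {deg : D → ℤ} (hdeg : IsDegree deg) {X Y Z : D} (hX : K X) (hZ : K Z) (hXY : Reaches X Y)
    (hYZ : Reaches Y Z) : T.heart Y := by
  have hYr : ReachableFrom K Y := ⟨X, hX, hXY⟩
  have hY := hK.indecomposable_of_reachable hYr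
  rw [T.mem_heart_iff, hT.isLE_iff, hT.isGE_zero_iff]
  refine ⟨(reachableAisle_iff hY).2 hYr, fun W hW f ↦ ?_⟩
  by_contra hf
  have h1 : ReachableFrom K (Y⟦(-1 : ℤ)⟧) := hW.step
    ⟨hK.indecomposable_of_reachable hW, indecomposable_map _ hY, f, hf⟩
  obtain ⟨X', hX', h1⟩ := h1
  have h2 : Reaches X' (Z⟦(-1 : ℤ)⟧) := h1.trans (hYZ.map (shiftFunctor D (-1 : ℤ)))
  have h3 : Reaches Z (Z⟦(-1 : ℤ)⟧) := (hK.reaches hZ hX').trans h2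
  have h4 : deg Z ≤ deg (Z⟦(-1 : ℤ)⟧) := by
    generalize Z⟦(-1 : ℤ)⟧ = W at h3
    induction h3 with
    | refl => exact le_rfl
    | tail _ h ih => exact ih.trans (hdeg.le h.1 h.2.1 _ h.2.2.choose_spec)
  have hZi := hK.indecomposable hZ
  have hZ1 := indecomposable_map (shiftFunctor D (-1 : ℤ)) hZi
  have hZ2 := indecomposable_map (shiftFunctor D (1 : ℤ)) hZ1
  -- Isomorphic indecomposables have the same degree by comparing along both directions; this is
  -- needed to identify the degree of `Z[-1][1]` with that of `Z`.
  obtain ⟨-, -, g, hg⟩ := HomStep.of_iso ((shiftEquiv D (1 : ℤ)).counitIso.app Z) hZ2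
  obtain ⟨-, -, g', hg'⟩ := HomStep.of_iso ((shiftEquiv D (1 : ℤ)).counitIso.app Z).symm hZi
  have h5 := hdeg.le hZ2 hZi g hg
  have h6 := hdeg.le hZi hZ2 g' hg'
  have h7 := hdeg.shift hZ1 hZ2
  lia

theorem le_heart (hT : IsReachabilityTStructure K T) (hK : IsStronglyConnected K)
    {deg : D → ℤ} (hdeg : IsDegree deg) : K ≤ T.heart := fun _ hX ↦
  hT.heart_of_path hK hdeg hX hX Relation.ReflTransGen.refl Relation.ReflTransGen.refl

end IsReachabilityTStructure

end PathTStructure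

/-! ### Auslander-Reiten duality and heredity of the heart. -/

section HeartDuality

variable {k : Type t} [Field k] {D : Type u} [Category.{v} D] [Preadditive D]
  [Linear k D] [HasZeroObject D] [HasShift D ℤ] [∀ n : ℤ, (shiftFunctor D n).Additive]
  [∀ n : ℤ, (shiftFunctor D n).Linear k] [Pretriangulated D] [IsTriangulated D]
  {S : SerreFunctor k D} {T : TStructure D}

theorem ses_of_distTriang {X Y Z : T.heart.FullSubcategory} {i : X ⟶ Y} {p : Y ⟶ Z}
    {δ : T.heart.ι.obj Z ⟶ (T.heart.ι.obj X)⟦(1 : ℤ)⟧}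
    (h : Triangle.mk (T.heart.ι.map i) (T.heart.ι.map p) δ ∈ distTriang D) : Ses i p := by
  have h1 := AbelianSubcategory.isLimitKernelForkOfDistTriang (heart_hom_shift_eq_zero T) i p δ h
  have h2 := AbelianSubcategory.isColimitCokernelCoforkOfDistTriang
    (heart_hom_shift_eq_zero T) i p δ h
  have : Mono i := Fork.IsLimit.mono h1
  have : Epi p := Cofork.IsColimit.epi h2
  refine Ses.of_lift ?_ fun W x hx ↦ ?_
  · exact T.heart.ι.map_injective ((T.heart.ι.map_comp i p).trans
      ((comp_distTriang_mor_zero₁₂ _ h).trans (T.heart.ι.map_zero _ _).symm))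
  · exact ⟨_, (KernelFork.IsLimit.lift' h1 x hx).2⟩

theorem exists_heart_map_eq {X Y : T.heart.FullSubcategory}
    (f : T.heart.ι.obj X ⟶ T.heart.ι.obj Y) : ∃ g : X ⟶ Y, T.heart.ι.map g = f :=
  ⟨ObjectProperty.homMk f, rfl⟩

/-- An epimorphism of the heart completes to a triangle with first object in the heart. That object
is also a kernel of `p`, so it can be replaced by `X`. -/
theorem Ses.exists_distTriang {X Y Z : T.heart.FullSubcategory} {i : X ⟶ Y} {p : Y ⟶ Z}
    (h : Ses i p) : ∃ δ : T.heart.ι.obj Z ⟶ (T.heart.ι.obj X)⟦(1 : ℤ)⟧,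
      Triangle.mk (T.heart.ι.map i) (T.heart.ι.map p) δ ∈ distTriang D := by
  have := h.epi
  have := h.mono
  obtain ⟨X', i', δ, hT⟩ := AbelianSubcategory.exists_distinguished_triangle_of_epi
    (heart_hom_shift_eq_zero T) (heart_admissible T) p
  have h' := ses_of_distTriang hT
  have := h'.mono
  obtain ⟨a, ha⟩ := h'.lift i h.w
  obtain ⟨b, hb⟩ := h.lift i' h'.w
  let e : X ≅ X' :=
    { hom := a
      inv := b
      hom_inv_id := by rw [← cancel_mono i, Category.assoc, hb, ha, Category.id_comp]
      inv_hom_id := by rw [← cancel_mono i', Category.assoc, ha, hb, Category.id_comp] }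
  let e' := T.heart.ι.mapIso e
  refine ⟨δ ≫ e'.inv⟦(1 : ℤ)⟧', isomorphic_distinguished _ hT _
    (Triangle.isoMk _ _ e' (Iso.refl _) (Iso.refl _) ?_ ?_ ?_)⟩
  · change T.heart.ι.map i ≫ 𝟙 _ = T.heart.ι.map a ≫ T.heart.ι.map i'
    rw [← Functor.map_comp, ha, Category.comp_id]
  · change T.heart.ι.map p ≫ 𝟙 _ = 𝟙 _ ≫ T.heart.ι.map p
    rw [Category.comp_id, Category.id_comp]
  · change (δ ≫ e'.inv⟦(1 : ℤ)⟧') ≫ e'.hom⟦(1 : ℤ)⟧' = 𝟙 _ ≫ δ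
    rw [Category.assoc, ← Functor.map_comp, e'.inv_hom_id, CategoryTheory.Functor.map_id, Category.comp_id,
      Category.id_comp]

theorem exists_heart_triangle {X Z : T.heart.FullSubcategory}
    (δ : T.heart.ι.obj Z ⟶ (T.heart.ι.obj X)⟦(1 : ℤ)⟧) :
    ∃ (Y : T.heart.FullSubcategory) (i : X ⟶ Y) (p : Y ⟶ Z),
      Triangle.mk (T.heart.ι.map i) (T.heart.ι.map p) δ ∈ distTriang D := by
  obtain ⟨Y, f, g, hY⟩ := distinguished_cocone_triangle₂ δ
  exact ⟨⟨Y, heart_of_distTriang T _ hY X.property Z.property⟩, ObjectProperty.homMk f,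
    ObjectProperty.homMk g, hY⟩

theorem heart_tau_iff (hT : IsTauInvariant S T) (X : D) : T.heart (S.tau X) ↔ T.heart X := by
  rw [T.mem_heart_iff, T.mem_heart_iff, ← T.le_iff_isLE, ← T.ge_iff_isGE, ← T.le_iff_isLE,
    ← T.ge_iff_isGE, (hT X).1, (hT X).2]

/-- The Auslander-Reiten translation on the heart of a `τ`-invariant t-structure. -/
noncomputable def heartTau (hT : IsTauInvariant S T) :
    T.heart.FullSubcategory ⥤ T.heart.FullSubcategory :=
  T.heart.lift (T.heart.ι ⋙ S.tauFunctor) fun X ↦ (heart_tau_iff hT _).2 X.property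

theorem heartTau_isEquivalence (hT : IsTauInvariant S T) : (heartTau hT).IsEquivalence where
  faithful :=
    have : (T.heart.ι ⋙ S.tauFunctor).Faithful := inferInstance
    Functor.Faithful.of_comp_iso (T.heart.liftCompιIso (T.heart.ι ⋙ S.tauFunctor)
      fun X ↦ (heart_tau_iff hT _).2 X.property)
  full :=
    have : (T.heart.ι ⋙ S.tauFunctor).Full := inferInstance
    Functor.Full.of_comp_faithful_iso (T.heart.liftCompιIso (T.heart.ι ⋙ S.tauFunctor)
      fun X ↦ (heart_tau_iff hT _).2 X.property)
  essSurj := ⟨fun Y ↦ by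
    let e : S.tau (S.tauFunctor.objPreimage Y.obj) ≅ Y.obj := S.tauFunctor.objObjPreimageIso Y.obj
    exact ⟨⟨_, (heart_tau_iff hT _).1 (T.heart.prop_of_iso e.symm Y.property)⟩,
      ⟨T.heart.isoMk e⟩⟩⟩

/-- The obstructions to lifting and to extending are the composites of `δ` with the given morphism
on either side. Naturality of `extDual` in both variables translates their vanishing into the two
conditions on `η`. -/
theorem isExtClass_of_distTriang (hT : IsTauInvariant S T) {X Y Z : T.heart.FullSubcategory}
    {i : X ⟶ Y} {p : Y ⟶ Z} {δ : T.heart.ι.obj Z ⟶ (T.heart.ι.obj X)⟦(1 : ℤ)⟧}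
    (h : Triangle.mk (T.heart.ι.map i) (T.heart.ι.map p) δ ∈ distTriang D)
    (η : Module.Dual k (X ⟶ (heartTau hT).obj Z))
    (hη : ∀ f : X ⟶ (heartTau hT).obj Z,
      η f = S.extDual (T.heart.ι.obj X) (T.heart.ι.obj Z) δ (T.heart.ι.map f)) :
    IsExtClass k (heartTau hT) i p η := by
  constructor
  · intro W g
    have h1 : (∃ l, l ≫ p = g) ↔ T.heart.ι.map g ≫ δ = 0 := by
      constructor
      · rintro ⟨l, rfl⟩
        rw [Functor.map_comp, Category.assoc]
        have := comp_distTriang_mor_zero₂₃ _ h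
        exact (congrArg (T.heart.ι.map l ≫ ·) this).trans comp_zero
      · intro hg
        obtain ⟨l, hl⟩ := Triangle.coyoneda_exact₃ _ h _ hg
        obtain ⟨l, rfl⟩ := exists_heart_map_eq (X := W) (Y := Y) l
        exact ⟨l, T.heart.ι.map_injective ((T.heart.ι.map_comp l p).trans hl.symm)⟩
    rw [h1, ← (S.extDual _ _).map_eq_zero_iff]
    constructor
    · intro hg f
      rw [hη, Functor.map_comp]
      exact (S.extDual_comp _ δ (T.heart.ι.map f)).symm.trans (by rw [hg]; rfl)
    · intro hg
      refine LinearMap.ext fun f ↦ (S.extDual_comp _ δ f).trans ?_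
      obtain ⟨f, rfl⟩ : ∃ f' : X ⟶ (heartTau hT).obj W, T.heart.ι.map f' = f :=
        exists_heart_map_eq (X := X) (Y := (heartTau hT).obj W) _
      have := hg f
      rw [hη, Functor.map_comp] at this
      exact this
  · intro W g
    have h1 : (∃ e, i ≫ e = g) ↔ δ ≫ (T.heart.ι.map g)⟦(1 : ℤ)⟧' = 0 := by
      constructor
      · rintro ⟨e, rfl⟩
        rw [Functor.map_comp, Functor.map_comp, ← Category.assoc]
        have := comp_distTriang_mor_zero₃₁ _ h
        exact (congrArg (· ≫ (T.heart.ι.map e)⟦(1 : ℤ)⟧') this).trans zero_comp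
      · intro hg
        obtain ⟨e, he⟩ := Triangle.yoneda_exact₃ _ (rot_of_distTriang _ h) _ hg
        obtain ⟨e, rfl⟩ := (shiftFunctor D (1 : ℤ)).map_surjective e
        obtain ⟨e, rfl⟩ := exists_heart_map_eq (X := Y) (Y := W) e
        refine ⟨-e, T.heart.ι.map_injective ((shiftFunctor D (1 : ℤ)).map_injective ?_)⟩
        refine Eq.trans ?_ he.symm
        change (T.heart.ι.map (i ≫ (-e)))⟦(1 : ℤ)⟧' = (-(T.heart.ι.map i)⟦(1 : ℤ)⟧') ≫ _
        rw [Functor.map_comp, Functor.map_neg, Preadditive.comp_neg, Functor.map_neg,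
          Functor.map_comp]
        exact (Preadditive.neg_comp _ _).symm
    rw [h1, ← (S.extDual _ _).map_eq_zero_iff]
    constructor
    · intro hg f
      rw [hη, Functor.map_comp]
      exact (S.extDual_comp_shift δ _ (T.heart.ι.map f)).symm.trans (by rw [hg]; rfl)
    · intro hg
      refine LinearMap.ext fun f ↦ (S.extDual_comp_shift δ _ f).trans ?_
      obtain ⟨f, rfl⟩ : ∃ f' : W ⟶ (heartTau hT).obj Z, T.heart.ι.map f' = f :=
        exists_heart_map_eq (X := W) (Y := (heartTau hT).obj Z) _
      have := hg f
      rw [hη, Functor.map_comp] at this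
      exact this

/-- The heart of a `τ`-invariant t-structure has Auslander-Reiten duality. -/
noncomputable def heartDuality (hT : IsTauInvariant S T)
    (hfin : ∀ X Y : D, Module.Finite k (X ⟶ Y)) : ARDuality k T.heart.FullSubcategory where
  τ := heartTau hT
  isEquivalence := heartTau_isEquivalence hT
  additive := ⟨fun {X Y f g} ↦ T.heart.ι.map_injective
    (S.tauFunctor.map_add (f := T.heart.ι.map f) (g := T.heart.ι.map g))⟩
  linear := ⟨fun {X Y} f r ↦ T.heart.ι.map_injective
    (S.tauFunctor.map_smul r (T.heart.ι.map f))⟩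
  finite X Y := by
    have := hfin (T.heart.ι.obj X) (T.heart.ι.obj Y)
    exact Module.Finite.of_injective (T.heart.ι.mapLinearMap k (X := X) (Y := Y))
      T.heart.ι.map_injective
  exists_class {X Y Z i p} h := by
    obtain ⟨δ, hδ⟩ := h.exists_distTriang
    exact ⟨S.extDual _ _ δ ∘ₗ T.heart.ι.mapLinearMap k (X := X) (Y := (heartTau hT).obj Z),
      isExtClass_of_distTriang hT hδ _ fun f ↦ rfl⟩
  exists_extension X Z η := by
    let e : (X ⟶ (heartTau hT).obj Z) ≃ₗ[k] (T.heart.ι.obj X ⟶ S.tauFunctor.obj (T.heart.ι.obj Z)) :=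
      LinearEquiv.ofBijective (T.heart.ι.mapLinearMap k (X := X) (Y := (heartTau hT).obj Z))
        ⟨T.heart.ι.map_injective, T.heart.ι.map_surjective⟩
    let δ := (S.extDual (T.heart.ι.obj X) (T.heart.ι.obj Z)).symm (e.symm.dualMap η)
    obtain ⟨Y', i, p, hY⟩ := exists_heart_triangle δ
    refine ⟨Y', i, p, ses_of_distTriang hY, isExtClass_of_distTriang hT hY _ fun f ↦ ?_⟩
    have h1 : S.extDual _ _ δ = e.symm.dualMap η := LinearEquiv.apply_symm_apply _ _
    refine Eq.trans ?_ (LinearMap.congr_fun h1 (e f)).symm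
    change η f = η (e.symm (e f))
    rw [LinearEquiv.symm_apply_apply]

/-- The heart of a `τ`-invariant t-structure is hereditary. -/
theorem isHereditary_heart (hT : IsTauInvariant S T) : IsHereditary T.heart.FullSubcategory := by
  refine isHereditary_of_exists_ses fun {L K' K X} i p h j _ ↦ ?_
  obtain ⟨δ, hδ⟩ := h.exists_distTriang
  let j' := T.heart.ι.map j
  -- Since `τ` preserves monomorphisms of the heart, `Hom(L, τ K)` embeds in `Hom(L, τ X)`. Dually,
  -- every class in `Ext¹(K, L)` is restricted from `Ext¹(X, L)`.
  have hinj : Function.Injective fun f : T.heart.ι.obj L ⟶ S.tauFunctor.obj (T.heart.ι.obj K) ↦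
      f ≫ S.tauFunctor.map j' := by
    have := (heartTau_isEquivalence hT)
    have hm : Mono ((heartTau hT).map j) := inferInstance
    intro f g hfg
    obtain ⟨f, rfl⟩ : ∃ f' : L ⟶ (heartTau hT).obj K, T.heart.ι.map f' = f :=
        exists_heart_map_eq (X := L) (Y := (heartTau hT).obj K) _
    obtain ⟨g, rfl⟩ : ∃ f' : L ⟶ (heartTau hT).obj K, T.heart.ι.map f' = g :=
        exists_heart_map_eq (X := L) (Y := (heartTau hT).obj K) _
    have : f ≫ (heartTau hT).map j = g ≫ (heartTau hT).map j := T.heart.ι.map_injective (by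
      rw [Functor.map_comp, Functor.map_comp]; exact hfg)
    rw [(cancel_mono _).1 this]
  obtain ⟨δ', hδ'⟩ : ∃ δ' : T.heart.ι.obj X ⟶ (T.heart.ι.obj L)⟦(1 : ℤ)⟧, j' ≫ δ' = δ := by
    let F := Linear.rightComp k (T.heart.ι.obj L) (S.tauFunctor.map j')
    have hF : Function.Surjective F.dualMap :=
      LinearMap.dualMap_surjective_of_injective hinj
    obtain ⟨η, hη⟩ := hF (S.extDual _ _ δ)
    refine ⟨(S.extDual _ _).symm η, (S.extDual _ _).injective (LinearMap.ext fun f ↦ ?_)⟩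
    rw [S.extDual_comp, LinearEquiv.apply_symm_apply]
    exact LinearMap.congr_fun hη f
  obtain ⟨Y', i', p', hY⟩ := exists_heart_triangle δ'
  obtain ⟨b, hb1, hb2⟩ := complete_distinguished_triangle_morphism₂ _ _ hδ hY (𝟙 _) j' (by
    change δ ≫ (𝟙 _)⟦(1 : ℤ)⟧' = j' ≫ δ'
    rw [CategoryTheory.Functor.map_id, Category.comp_id, hδ'])
  obtain ⟨b, rfl⟩ := exists_heart_map_eq (X := K') (Y := Y') b
  refine ⟨Y', i', p', b, ses_of_distTriang hY, T.heart.ι.map_injective ?_,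
    T.heart.ι.map_injective ?_⟩
  · rw [Functor.map_comp]
    exact hb1.trans (Category.id_comp _)
  · rw [Functor.map_comp, Functor.map_comp]
    exact hb2.symm

end HeartDuality

namespace ARDuality.SimpleSystem

variable {k : Type t} [Field k] [IsAlgClosed k] {C : Type u} [Category.{v} C] [Abelian C]
  [Linear k C] {T : ARDuality k C} (𝒮 : T.SimpleSystem)

/-- This and the next three statements pass from indecomposable test objects to arbitrary ones by
decomposing. For length greater than one, the two almost split factors combine into a single
morphism from or to a biproduct. -/
theorem exists_lift_π_zero {a a' : ℤ} (h : a + 1 = a') {X : C} (f : X ⟶ 𝒮.V a' 0)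
    (hf : ¬ IsSplitEpi f) : ∃ l, l ≫ 𝒮.π a h 0 = f := by
  revert f
  refine induction_indecomposable k (fun X ↦ T.finite X X) (P := fun X ↦ ∀ f : X ⟶ 𝒮.V a' 0,
    ¬ IsSplitEpi f → ∃ l, l ≫ 𝒮.π a h 0 = f) ?_ ?_ ?_ ?_ X
  · intro X Y e hX f hf
    obtain ⟨l, hl⟩ := hX (e.hom ≫ f) fun hs ↦ hf
      ⟨⟨section_ (e.hom ≫ f) ≫ e.hom, by rw [Category.assoc, IsSplitEpi.id]⟩⟩
    exact ⟨e.inv ≫ l, by rw [Category.assoc, hl, Iso.inv_hom_id_assoc]⟩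
  · exact fun X hX f _ ↦ ⟨0, hX.eq_of_src _ _⟩
  · intro X hX f hf
    rcases 𝒮.right_almost_split hX h f (fun _ ↦ hf inferInstance) with hl | ⟨m, hm, -⟩
    · exact hl
    · lia
  · intro X Y hX hY f hf
    obtain ⟨l, hl⟩ := hX (biprod.inl ≫ f) fun hs ↦ hf
      ⟨⟨section_ (biprod.inl ≫ f) ≫ biprod.inl, by rw [Category.assoc, IsSplitEpi.id]⟩⟩
    obtain ⟨l', hl'⟩ := hY (biprod.inr ≫ f) fun hs ↦ hf
      ⟨⟨section_ (biprod.inr ≫ f) ≫ biprod.inr, by rw [Category.assoc, IsSplitEpi.id]⟩⟩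
    exact ⟨biprod.desc l l', by ext <;> simp [hl, hl']⟩

theorem exists_lift_desc {a a' : ℤ} (h : a + 1 = a') {n : ℕ} {X : C} (f : X ⟶ 𝒮.V a' (n + 1))
    (hf : ¬ IsSplitEpi f) : ∃ l, l ≫ biprod.desc (𝒮.ι a' n) (𝒮.π a h (n + 1)) = f := by
  revert f
  refine induction_indecomposable k (fun X ↦ T.finite X X) (P := fun X ↦
    ∀ f : X ⟶ 𝒮.V a' (n + 1), ¬ IsSplitEpi f →
      ∃ l, l ≫ biprod.desc (𝒮.ι a' n) (𝒮.π a h (n + 1)) = f) ?_ ?_ ?_ ?_ X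
  · intro X Y e hX f hf
    obtain ⟨l, hl⟩ := hX (e.hom ≫ f) fun hs ↦ hf
      ⟨⟨section_ (e.hom ≫ f) ≫ e.hom, by rw [Category.assoc, IsSplitEpi.id]⟩⟩
    exact ⟨e.inv ≫ l, by rw [Category.assoc, hl, Iso.inv_hom_id_assoc]⟩
  · exact fun X hX f _ ↦ ⟨0, hX.eq_of_src _ _⟩
  · intro X hX f hf
    rcases 𝒮.right_almost_split hX h f (fun _ ↦ hf inferInstance) with ⟨l, hl⟩ | ⟨m, hm, l, hl⟩
    · exact ⟨l ≫ biprod.inr, by simpa using hl⟩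
    · obtain rfl : n = m := by lia
      exact ⟨l ≫ biprod.inl, by simpa using hl⟩
  · intro X Y hX hY f hf
    obtain ⟨l, hl⟩ := hX (biprod.inl ≫ f) fun hs ↦ hf
      ⟨⟨section_ (biprod.inl ≫ f) ≫ biprod.inl, by rw [Category.assoc, IsSplitEpi.id]⟩⟩
    obtain ⟨l', hl'⟩ := hY (biprod.inr ≫ f) fun hs ↦ hf
      ⟨⟨section_ (biprod.inr ≫ f) ≫ biprod.inr, by rw [Category.assoc, IsSplitEpi.id]⟩⟩
    exact ⟨biprod.desc l l', by
      apply biprod.hom_ext' <;> simp only [biprod.inl_desc_assoc, biprod.inr_desc_assoc, hl, hl']⟩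

theorem exists_extend_ι_zero {a : ℤ} {X : C} (f : 𝒮.V a 0 ⟶ X)
    (hf : ¬ IsSplitMono f) : ∃ e, 𝒮.ι a 0 ≫ e = f := by
  revert f
  refine induction_indecomposable k (fun X ↦ T.finite X X) (P := fun X ↦ ∀ f : 𝒮.V a 0 ⟶ X,
    ¬ IsSplitMono f → ∃ e, 𝒮.ι a 0 ≫ e = f) ?_ ?_ ?_ ?_ X
  · intro X Y e hX f hf
    obtain ⟨l, hl⟩ := hX (f ≫ e.inv) fun hs ↦ hf
      ⟨⟨e.inv ≫ retraction (f ≫ e.inv), by rw [← Category.assoc, IsSplitMono.id]⟩⟩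
    exact ⟨l ≫ e.hom, by rw [← Category.assoc, hl, Category.assoc, e.inv_hom_id, Category.comp_id]⟩
  · exact fun X hX f _ ↦ ⟨0, hX.eq_of_tgt _ _⟩
  · intro X hX f hf
    rcases 𝒮.left_almost_split hX f (fun _ ↦ hf inferInstance) with hl | ⟨m, hm, -⟩
    · exact hl
    · lia
  · intro X Y hX hY f hf
    obtain ⟨l, hl⟩ := hX (f ≫ biprod.fst) fun hs ↦ hf
      ⟨⟨biprod.fst ≫ retraction (f ≫ biprod.fst), by rw [← Category.assoc, IsSplitMono.id]⟩⟩
    obtain ⟨l', hl'⟩ := hY (f ≫ biprod.snd) fun hs ↦ hf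
      ⟨⟨biprod.snd ≫ retraction (f ≫ biprod.snd), by rw [← Category.assoc, IsSplitMono.id]⟩⟩
    exact ⟨biprod.lift l l', by ext <;> simp [hl, hl']⟩

theorem exists_extend_lift (a : ℤ) {n : ℕ} {X : C} (f : 𝒮.V a (n + 1) ⟶ X)
    (hf : ¬ IsSplitMono f) :
    ∃ e, biprod.lift (𝒮.ι a (n + 1)) (𝒮.π a rfl n) ≫ e = f := by
  revert f
  refine induction_indecomposable k (fun X ↦ T.finite X X) (P := fun X ↦
    ∀ f : 𝒮.V a (n + 1) ⟶ X, ¬ IsSplitMono f →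
      ∃ e, biprod.lift (𝒮.ι a (n + 1)) (𝒮.π a rfl n) ≫ e = f) ?_ ?_ ?_ ?_ X
  · intro X Y e hX f hf
    obtain ⟨l, hl⟩ := hX (f ≫ e.inv) fun hs ↦ hf
      ⟨⟨e.inv ≫ retraction (f ≫ e.inv), by rw [← Category.assoc, IsSplitMono.id]⟩⟩
    exact ⟨l ≫ e.hom, by rw [← Category.assoc, hl, Category.assoc, e.inv_hom_id, Category.comp_id]⟩
  · exact fun X hX f _ ↦ ⟨0, hX.eq_of_tgt _ _⟩
  · intro X hX f hf
    rcases 𝒮.left_almost_split hX f (fun _ ↦ hf inferInstance) with ⟨l, hl⟩ | ⟨m, hm, l, hl⟩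
    · exact ⟨biprod.fst ≫ l, by simpa using hl⟩
    · obtain rfl : n = m := by lia
      exact ⟨biprod.snd ≫ l, by simpa using hl⟩
  · intro X Y hX hY f hf
    obtain ⟨l, hl⟩ := hX (f ≫ biprod.fst) fun hs ↦ hf
      ⟨⟨biprod.fst ≫ retraction (f ≫ biprod.fst), by rw [← Category.assoc, IsSplitMono.id]⟩⟩
    obtain ⟨l', hl'⟩ := hY (f ≫ biprod.snd) fun hs ↦ hf
      ⟨⟨biprod.snd ≫ retraction (f ≫ biprod.snd), by rw [← Category.assoc, IsSplitMono.id]⟩⟩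
    exact ⟨biprod.lift l l', by
      apply biprod.hom_ext <;> simp only [Category.assoc, biprod.lift_fst, biprod.lift_snd, hl, hl']⟩

theorem epi_desc {a a' : ℤ} (h : a + 1 = a') (n : ℕ) :
    Epi (biprod.desc (𝒮.ι a' n) (𝒮.π a h (n + 1))) :=
  epi_of_epi_fac (biprod.inr_desc (𝒮.ι a' n) (𝒮.π a h (n + 1)))

theorem mono_lift (a : ℤ) (n : ℕ) : Mono (biprod.lift (𝒮.ι a (n + 1)) (𝒮.π a rfl n)) :=
  mono_of_mono_fac (biprod.lift_fst (𝒮.ι a (n + 1)) (𝒮.π a rfl n))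

end ARDuality.SimpleSystem

/-! ### Almost split maps of the heart in the ambient category. -/

section HeartAlmostSplit

variable {k : Type t} [Field k] {D : Type u} [Category.{v} D] [Preadditive D]
  [Linear k D] [HasZeroObject D] [HasShift D ℤ] [∀ n : ℤ, (shiftFunctor D n).Additive]
  [∀ n : ℤ, (shiftFunctor D n).Linear k] [Pretriangulated D] [IsTriangulated D]
  {S : SerreFunctor k D} {T : TStructure D}

/-- A right almost split morphism of the heart is right almost split in the whole category. -/
theorem exists_lift_of_heart (hT : IsTauInvariant S T) {M V : T.heart.FullSubcategory} (p : M ⟶ V)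
    [Epi p] (hp : ∀ (X : T.heart.FullSubcategory) (f : X ⟶ V), ¬ IsSplitEpi f → ∃ l, l ≫ p = f)
    {Z : D} (b : Z ⟶ T.heart.ι.obj V) (hb : ¬ IsSplitEpi b) : ∃ l, l ≫ T.heart.ι.map p = b := by
  obtain ⟨δ, hδ⟩ := (Ses.of_kernel p).exists_distTriang
  have h0 : T.heart.ι.map p ≫ δ = 0 := comp_distTriang_mor_zero₂₃ _ hδ
  suffices h : b ≫ δ = 0 by
    obtain ⟨l, hl⟩ := Triangle.coyoneda_exact₃ _ hδ b h
    exact ⟨l, hl.symm⟩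
  refine (S.extDual _ _).map_eq_zero_iff.1 (LinearMap.ext fun f ↦ (S.extDual_comp b δ f).trans ?_)
  -- The obstruction is tested on a morphism `f` from `kernel p` to `τ Z`. Writing `kernel p` as `τ
  -- K` turns `f` into a morphism `c` from `K` to `Z`. The composite `c ≫ b` lies in the heart and
  -- is not a split epimorphism, so it lifts through `p` and the pairing vanishes.
  have := heartTau_isEquivalence hT
  let K := (heartTau hT).objPreimage (kernel p)
  let θ : S.tauFunctor.obj (T.heart.ι.obj K) ≅ T.heart.ι.obj (kernel p) :=
    T.heart.ι.mapIso ((heartTau hT).objObjPreimageIso (kernel p))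
  obtain ⟨c, hc⟩ := S.tauFunctor.map_surjective (θ.hom ≫ f)
  obtain ⟨g, hg⟩ := exists_heart_map_eq (X := K) (Y := V) (c ≫ b)
  obtain ⟨l, rfl⟩ := hp K g fun hs ↦ hb ⟨⟨T.heart.ι.map (section_ g) ≫ c, by
    rw [Category.assoc, ← hg, ← Functor.map_comp, IsSplitEpi.id, CategoryTheory.Functor.map_id]⟩⟩
  have h1 : f ≫ S.tauFunctor.map b = θ.inv ≫ S.tauFunctor.map (T.heart.ι.map (l ≫ p)) := by
    rw [hg, Functor.map_comp, hc, Category.assoc, Iso.inv_hom_id_assoc]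
  rw [h1, ← S.extDual_comp, Functor.map_comp, Category.assoc, h0, comp_zero, map_zero,
    LinearMap.zero_apply]
  rfl

/-- A left almost split morphism of the heart is left almost split in the whole category. -/
theorem exists_extend_of_heart (hT : IsTauInvariant S T) {M V : T.heart.FullSubcategory}
    (i : V ⟶ M) [Mono i]
    (hi : ∀ (X : T.heart.FullSubcategory) (f : V ⟶ X), ¬ IsSplitMono f → ∃ e, i ≫ e = f)
    {Z : D} (b : T.heart.ι.obj V ⟶ Z) (hb : ¬ IsSplitMono b) : ∃ e, T.heart.ι.map i ≫ e = b := by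
  obtain ⟨δ, hδ⟩ := (Ses.of_cokernel i).exists_distTriang
  have h0 : δ ≫ (T.heart.ι.map i)⟦(1 : ℤ)⟧' = 0 := comp_distTriang_mor_zero₃₁ _ hδ
  suffices h : δ ≫ b⟦(1 : ℤ)⟧' = 0 by
    obtain ⟨e, he⟩ : ∃ e : (T.heart.ι.obj M)⟦(1 : ℤ)⟧ ⟶ Z⟦(1 : ℤ)⟧,
        b⟦(1 : ℤ)⟧' = (-(T.heart.ι.map i)⟦(1 : ℤ)⟧') ≫ e :=
      Triangle.yoneda_exact₃ _ (rot_of_distTriang _ hδ) _ h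
    obtain ⟨e, rfl⟩ := (shiftFunctor D (1 : ℤ)).map_surjective e
    refine ⟨-e, (shiftFunctor D (1 : ℤ)).map_injective (Eq.trans ?_ he.symm)⟩
    rw [Preadditive.comp_neg, Functor.map_neg, Functor.map_comp, Preadditive.neg_comp]
  refine (S.extDual _ _).map_eq_zero_iff.1
    (LinearMap.ext fun f ↦ (S.extDual_comp_shift δ b f).trans ?_)
  obtain ⟨f', rfl⟩ : ∃ f' : Z ⟶ T.heart.ι.obj ((heartTau hT).obj (cokernel i)), f' = f := ⟨f, rfl⟩
  -- Although `Z` need not lie in the heart, `b ≫ f'` is a morphism of the heart. It is not a split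
  -- monomorphism, so it extends along `i`, and this kills the pairing with `δ`.
  obtain ⟨g, hg⟩ := exists_heart_map_eq (X := V) (Y := (heartTau hT).obj (cokernel i)) (b ≫ f')
  obtain ⟨l, rfl⟩ := hi _ g fun hs ↦ hb ⟨⟨f' ≫ T.heart.ι.map (retraction g), by
    rw [← Category.assoc, ← hg, ← Functor.map_comp, IsSplitMono.id,
      CategoryTheory.Functor.map_id]⟩⟩
  rw [Functor.map_comp] at hg
  refine (congrArg (S.extDual (T.heart.ι.obj V) (T.heart.ι.obj (cokernel i)) δ) hg).symm.trans ?_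
  refine (S.extDual_comp_shift δ _ (T.heart.ι.map l)).symm.trans ?_
  rw [h0, map_zero]
  rfl

end HeartAlmostSplit

section Arrows

variable {k : Type t} [Field k] {C : Type u} [Category.{v} C] [Preadditive C] [Linear k C]

theorem exists_ne_zero_of_numArrows_ne_zero {X Y : C} (h : numArrows k X Y ≠ 0) :
    ∃ f : X ⟶ Y, f ≠ 0 := by
  by_contra! h0
  have : Subsingleton (X ⟶ Y) := ⟨fun f g ↦ (h0 f).trans (h0 g).symm⟩
  exact h Module.finrank_zero_of_subsingleton

end Arrows

/-! ### Powers of the radical and the infinite radical. -/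

section RadicalPowers

variable {k : Type t} [Field k] [IsAlgClosed k] {C : Type u} [Category.{v} C] [Preadditive C]
  [Linear k C] [HasBinaryBiproducts C] [HasTrivialIdempotents C]

theorem radPow_comp {n : ℕ} {X Y Z : C} {f : X ⟶ Y} (hf : f ∈ radPow k n X Y) (g : Y ⟶ Z) :
    f ≫ g ∈ radPow k n X Z := by
  cases n with
  | zero => exact Submodule.mem_top
  | succ n =>
    induction hf using Submodule.span_induction with
    | mem x hx =>
      obtain ⟨W, a, b, ha, hb, rfl⟩ := hx
      exact Submodule.subset_span ⟨W, a, b ≫ g, ha, comp_mem_rad hb g, (Category.assoc _ _ _).symm⟩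
    | zero => rw [zero_comp]; exact Submodule.zero_mem _
    | add x y _ _ hx hy => rw [Preadditive.add_comp]; exact Submodule.add_mem _ hx hy
    | smul c x _ hx => rw [Linear.smul_comp]; exact Submodule.smul_mem _ c hx

theorem comp_radPow {n : ℕ} {X Y Z : C} (g : X ⟶ Y) {f : Y ⟶ Z} (hf : f ∈ radPow k n Y Z) :
    g ≫ f ∈ radPow k n X Z := by
  induction n generalizing Z with
  | zero => exact Submodule.mem_top
  | succ n ih =>
    induction hf using Submodule.span_induction with
    | mem x hx =>
      obtain ⟨W, a, b, ha, hb, rfl⟩ := hx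
      exact Submodule.subset_span ⟨W, g ≫ a, b, ih ha, hb, Category.assoc _ _ _⟩
    | zero => rw [comp_zero]; exact Submodule.zero_mem _
    | add x y _ _ hx hy => rw [Preadditive.comp_add]; exact Submodule.add_mem _ hx hy
    | smul c x _ hx => rw [Linear.comp_smul]; exact Submodule.smul_mem _ c hx

theorem comp_mem_radPow_succ {n : ℕ} {X Y Z : C} {f : X ⟶ Y} (hf : f ∈ radPow k n X Y)
    {g : Y ⟶ Z} (hg : g ∈ rad k Y Z) : f ≫ g ∈ radPow k (n + 1) X Z :=
  Submodule.subset_span ⟨Y, f, g, hf, hg, rfl⟩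

theorem radPow_one (X Y : C) : radPow k 1 X Y = rad k X Y := by
  refine le_antisymm (Submodule.span_le.2 ?_) fun f hf ↦ ?_
  · rintro _ ⟨W, a, b, -, hb, rfl⟩
    exact comp_mem_rad' a hb
  · exact Submodule.subset_span ⟨X, 𝟙 X, f, Submodule.mem_top, hf, Category.id_comp f⟩

theorem radPow_succ_le (n : ℕ) (X Y : C) : radPow k (n + 1) X Y ≤ radPow k n X Y := by
  induction n generalizing Y with
  | zero => exact le_top
  | succ n ih =>
    refine Submodule.span_mono ?_
    rintro _ ⟨W, a, b, ha, hb, rfl⟩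
    exact ⟨W, a, b, ih W ha, hb, rfl⟩

theorem radPow_antitone (X Y : C) : Antitone fun n ↦ radPow k n X Y :=
  antitone_nat_of_succ_le fun n ↦ radPow_succ_le n X Y

theorem infRad_comp {X Y Z : C} {f : X ⟶ Y} (hf : f ∈ infRad k X Y) (g : Y ⟶ Z) :
    f ≫ g ∈ infRad k X Z :=
  (Submodule.mem_iInf _).2 fun n ↦ radPow_comp ((Submodule.mem_iInf _).1 hf n) g

theorem comp_infRad {X Y Z : C} (g : X ⟶ Y) {f : Y ⟶ Z} (hf : f ∈ infRad k Y Z) :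
    g ≫ f ∈ infRad k X Z :=
  (Submodule.mem_iInf _).2 fun n ↦ comp_radPow g ((Submodule.mem_iInf _).1 hf n)

/-- The powers form a descending chain in a finite-dimensional space, so the infinite radical is
attained at a finite stage. -/
theorem exists_radPow_le_infRad (X Y : C) [Module.Finite k (X ⟶ Y)] :
    ∃ N, ∀ n, N ≤ n → radPow k n X Y ≤ infRad k X Y := by
  obtain ⟨N, hN⟩ := IsArtinian.monotone_stabilizes
    (⟨fun n ↦ OrderDual.toDual (radPow k n X Y), fun _ _ h ↦ radPow_antitone X Y h⟩ :
      ℕ →o (Submodule k (X ⟶ Y))ᵒᵈ)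
  refine ⟨N, fun n hn ↦ (radPow_antitone X Y hn).trans (le_iInf fun m ↦ ?_)⟩
  rcases le_total N m with h | h
  · exact (congrArg OrderDual.ofDual (hN m h)).le
  · exact radPow_antitone X Y h

theorem numArrows_ne_zero_iff (X Y : C) [Module.Finite k (X ⟶ Y)] :
    numArrows k X Y ≠ 0 ↔ ∃ f ∈ rad k X Y, f ∉ radPow k 2 X Y := by
  rw [numArrows, ← Nat.pos_iff_ne_zero, Module.finrank_pos_iff, Submodule.Quotient.nontrivial_iff,
    Ne, Submodule.submoduleOf_eq_top, SetLike.not_le_iff_exists]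

end RadicalPowers

/-- A family of indecomposable objects `V a n` of a linear category, together with the almost
split maps which make it into a component of the Auslander-Reiten quiver of type `ℤA_∞`, or a
quotient thereof. -/
structure MeshFamily (C : Type u) [Category.{v} C] [Preadditive C] [HasBinaryBiproducts C] where
  /-- the objects -/
  V : ℤ → ℕ → C
  indecomposable (a n) : Indecomposable (V a n)
  length_eq {a a' : ℤ} {m n : ℕ} (e : V a' m ≅ V a n) : m = n
  /-- the upward arrows -/
  ι (a n) : V a n ⟶ V a (n + 1)
  /-- the downward arrows -/
  π {a a' : ℤ} (h : a + 1 = a') (n) : V a (n + 1) ⟶ V a' n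
  lift_zero {a a' : ℤ} (h : a + 1 = a') {Z : C} (f : Z ⟶ V a' 0) (hf : ¬ IsSplitEpi f) :
    ∃ w, f = w ≫ π h 0
  lift_succ {a a' : ℤ} (h : a + 1 = a') {n : ℕ} {Z : C} (f : Z ⟶ V a' (n + 1))
    (hf : ¬ IsSplitEpi f) : ∃ u w, f = u ≫ ι a' n + w ≫ π h (n + 1)
  extend_zero {a : ℤ} {Z : C} (f : V a 0 ⟶ Z) (hf : ¬ IsSplitMono f) : ∃ u, f = ι a 0 ≫ u
  extend_succ {a a' : ℤ} (h : a + 1 = a') {n : ℕ} {Z : C} (f : V a (n + 1) ⟶ Z)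
    (hf : ¬ IsSplitMono f) : ∃ u w, f = ι a (n + 1) ≫ u + π h n ≫ w
  -- The next four fields retain the socle and top filtrations without mentioning the heart:
  -- morphisms descend to the quotients `π` by socles and restrict to the maximal subobjects `ι`.
  comp_π_eq_zero {a a' : ℤ} (h : a + 1 = a') (n : ℕ) {c : ℤ} (g : V c 0 ⟶ V a (n + 1)) :
    g ≫ π h n = 0
  exists_comp_π {a a' : ℤ} (h : a + 1 = a') (n : ℕ) {c c' : ℤ} (h' : c + 1 = c') (m : ℕ)
    (g : V c (m + 1) ⟶ V a (n + 1)) : ∃ g', g ≫ π h n = π h' m ≫ g'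
  ι_comp_eq_zero {a b : ℤ} {n : ℕ} (q : V a (n + 1) ⟶ V b 0) : ι a n ≫ q = 0
  exists_ι_comp {a b : ℤ} {n m : ℕ} (q : V a (n + 1) ⟶ V b (m + 1)) : ∃ q', ι a n ≫ q = q' ≫ ι b m
  π_zero_ne_zero {a a' : ℤ} (h : a + 1 = a') : π h 0 ≠ 0
  -- Neither of the two arrows ending in `V a' (n + 1)` factors through the other, which makes both
  -- irreducible.
  ι_ne {a a' : ℤ} (h : a + 1 = a') (n : ℕ) (w : V a' n ⟶ V a (n + 2)) : ι a' n ≠ w ≫ π h (n + 1)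
  π_ne {a a' : ℤ} (h : a + 1 = a') (n : ℕ) (w : V a (n + 2) ⟶ V a' n) : π h (n + 1) ≠ w ≫ ι a' n

/-! ### Mesh families: irreducible maps, the component, and vanishing of the infinite radical. -/

namespace MeshFamily

variable {k : Type t} [Field k] [IsAlgClosed k] {C : Type u} [Category.{v} C] [Preadditive C]
  [Linear k C] [HasBinaryBiproducts C] [HasTrivialIdempotents C] (𝒱 : MeshFamily C)

/-- The objects isomorphic to a member of the family. -/
def Mem : ObjectProperty C := fun X ↦ ∃ a n, Nonempty (X ≅ 𝒱.V a n)

variable (k) in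
theorem ι_mem_rad (hfin : ∀ X Y : C, Module.Finite k (X ⟶ Y)) (a : ℤ) (n : ℕ) :
    𝒱.ι a n ∈ rad k _ _ := by
  have := hfin (𝒱.V a n) (𝒱.V a n)
  refine mem_rad_of_not_isIso (𝒱.indecomposable _ _) (𝒱.indecomposable _ _) fun _ ↦ ?_
  have := 𝒱.length_eq (asIso (𝒱.ι a n))
  lia

variable (k) in
theorem π_mem_rad (hfin : ∀ X Y : C, Module.Finite k (X ⟶ Y)) {a a' : ℤ} (h : a + 1 = a') (n : ℕ) :
    𝒱.π h n ∈ rad k _ _ := by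
  have := hfin (𝒱.V a (n + 1)) (𝒱.V a (n + 1))
  refine mem_rad_of_not_isIso (𝒱.indecomposable _ _) (𝒱.indecomposable _ _) fun _ ↦ ?_
  have := 𝒱.length_eq (asIso (𝒱.π h n))
  lia

theorem exists_of_mem_radPow_zero {N : ℕ} {X : C} {a a' : ℤ} (h : a + 1 = a') {f : X ⟶ 𝒱.V a' 0}
    (hf : f ∈ radPow k (N + 1) X (𝒱.V a' 0)) : ∃ w ∈ radPow k N X _, f = w ≫ 𝒱.π h 0 := by
  induction hf using Submodule.span_induction with
  | mem x hx =>
    obtain ⟨W, p, q, hp, hq, rfl⟩ := hx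
    obtain ⟨w, rfl⟩ := 𝒱.lift_zero h q (not_isSplitEpi_of_mem_rad (𝒱.indecomposable _ _).1 hq)
    exact ⟨p ≫ w, radPow_comp hp w, (Category.assoc _ _ _).symm⟩
  | zero => exact ⟨0, Submodule.zero_mem _, zero_comp.symm⟩
  | add x y _ _ hx hy =>
    obtain ⟨w, hw, rfl⟩ := hx
    obtain ⟨w', hw', rfl⟩ := hy
    exact ⟨w + w', Submodule.add_mem _ hw hw', Preadditive.add_comp _ _ _ _ _ _ |>.symm⟩
  | smul c x _ hx =>
    obtain ⟨w, hw, rfl⟩ := hx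
    exact ⟨c • w, Submodule.smul_mem _ c hw, (Linear.smul_comp _ _ _ _ _ _).symm⟩

/-- The last radical factor is not a split epimorphism, so it factors through the almost split maps
at the cost of one power of the radical. -/
theorem exists_of_mem_radPow_succ {N n : ℕ} {X : C} {a a' : ℤ} (h : a + 1 = a')
    {f : X ⟶ 𝒱.V a' (n + 1)} (hf : f ∈ radPow k (N + 1) X (𝒱.V a' (n + 1))) :
    ∃ u ∈ radPow k N X _, ∃ w ∈ radPow k N X _, f = u ≫ 𝒱.ι a' n + w ≫ 𝒱.π h (n + 1) := by
  induction hf using Submodule.span_induction with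
  | mem x hx =>
    obtain ⟨W, p, q, hp, hq, rfl⟩ := hx
    obtain ⟨u, w, rfl⟩ := 𝒱.lift_succ h q (not_isSplitEpi_of_mem_rad (𝒱.indecomposable _ _).1 hq)
    exact ⟨p ≫ u, radPow_comp hp u, p ≫ w, radPow_comp hp w, by
      rw [Preadditive.comp_add, Category.assoc, Category.assoc]⟩
  | zero => exact ⟨0, Submodule.zero_mem _, 0, Submodule.zero_mem _, by simp⟩
  | add x y _ _ hx hy =>
    obtain ⟨u, hu, w, hw, rfl⟩ := hx
    obtain ⟨u', hu', w', hw', rfl⟩ := hy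
    exact ⟨u + u', Submodule.add_mem _ hu hu', w + w', Submodule.add_mem _ hw hw', by
      rw [Preadditive.add_comp, Preadditive.add_comp]; abel⟩
  | smul c x _ hx =>
    obtain ⟨u, hu, w, hw, rfl⟩ := hx
    exact ⟨c • u, Submodule.smul_mem _ c hu, c • w, Submodule.smul_mem _ c hw, by
      rw [Linear.smul_comp, Linear.smul_comp, smul_add]⟩

/-- Nakayama's argument: `1 - r` is invertible and can be moved to the other side. -/
theorem eq_inv_comp {X Y : C} {r : X ⟶ X} (hr : r ∈ rad k X X) {f g : X ⟶ Y}
    (h : f = r ≫ f + g) : ∃ s : X ⟶ X, f = s ≫ g := by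
  have := hr (𝟙 X)
  rw [Category.comp_id] at this
  refine ⟨inv (𝟙 X - r), (cancel_epi (𝟙 X - r)).1 ?_⟩
  rw [IsIso.hom_inv_id_assoc, Preadditive.sub_comp, Category.id_comp, sub_eq_iff_eq_add']
  exact h

theorem ι_notMem_radPow_two (a : ℤ) (n : ℕ) : 𝒱.ι a n ∉ radPow k 2 _ _ := fun hf ↦ by
  obtain ⟨u, hu, w, -, h⟩ := 𝒱.exists_of_mem_radPow_succ (sub_add_cancel a 1) hf
  rw [radPow_one] at hu
  obtain ⟨s, hs⟩ := eq_inv_comp hu h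
  exact 𝒱.ι_ne (sub_add_cancel a 1) n (s ≫ w) (hs.trans (Category.assoc _ _ _).symm)

theorem π_notMem_radPow_two {a a' : ℤ} (h : a + 1 = a') (n : ℕ) :
    𝒱.π h n ∉ radPow k 2 _ _ := fun hf ↦ by
  cases n with
  | zero =>
    obtain ⟨w, hw, hf⟩ := 𝒱.exists_of_mem_radPow_zero h hf
    rw [radPow_one] at hw
    obtain ⟨s, hs⟩ := eq_inv_comp hw (hf.trans (add_zero _).symm)
    exact 𝒱.π_zero_ne_zero h (hs.trans comp_zero)
  | succ n =>
    obtain ⟨u, -, w, hw, hf⟩ := 𝒱.exists_of_mem_radPow_succ h hf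
    rw [radPow_one] at hw
    obtain ⟨s, hs⟩ := eq_inv_comp hw (hf.trans (add_comm _ _))
    exact 𝒱.π_ne h n (s ≫ u) (hs.trans (Category.assoc _ _ _).symm)

/-- Write the irreducible morphism through the almost split maps. If none of its components were
invertible, they would be radical and the morphism would lie in the square of the radical. -/
theorem mem_of_irreducible_tgt (hfin : ∀ X Y : C, Module.Finite k (X ⟶ Y)) {X : C}
    (hX : Indecomposable X) {a : ℤ} {n : ℕ} {f : X ⟶ 𝒱.V a n} (hf : f ∈ rad k _ _)
    (hf2 : f ∉ radPow k 2 _ _) : 𝒱.Mem X := by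
  have := hfin X X
  have hs := not_isSplitEpi_of_mem_rad (𝒱.indecomposable _ _).1 hf
  cases n with
  | zero =>
    obtain ⟨w, rfl⟩ := 𝒱.lift_zero (sub_add_cancel a 1) f hs
    by_cases hw : IsIso w
    · exact ⟨_, _, ⟨asIso w⟩⟩
    · refine (hf2 (comp_mem_radPow_succ (n := 1) ?_ (𝒱.π_mem_rad k hfin _ _))).elim
      rw [radPow_one]
      exact mem_rad_of_not_isIso hX (𝒱.indecomposable _ _) hw
  | succ n =>
    obtain ⟨u, w, rfl⟩ := 𝒱.lift_succ (sub_add_cancel a 1) f hs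
    by_cases hu : IsIso u
    · exact ⟨_, _, ⟨asIso u⟩⟩
    by_cases hw : IsIso w
    · exact ⟨_, _, ⟨asIso w⟩⟩
    refine (hf2 (Submodule.add_mem _ (comp_mem_radPow_succ (n := 1) ?_ (𝒱.ι_mem_rad k hfin _ _))
      (comp_mem_radPow_succ (n := 1) ?_ (𝒱.π_mem_rad k hfin _ _)))).elim
    · rw [radPow_one]
      exact mem_rad_of_not_isIso hX (𝒱.indecomposable _ _) hu
    · rw [radPow_one]
      exact mem_rad_of_not_isIso hX (𝒱.indecomposable _ _) hw

theorem not_isSplitMono_of_mem_rad {X Y : C} (hX : ¬ IsZero X) {f : X ⟶ Y} (hf : f ∈ rad k X Y) :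
    ¬ IsSplitMono f := fun h ↦
  not_isIso_of_mem_rad hX (comp_mem_rad hf (retraction f))
    (by rw [IsSplitMono.id]; infer_instance)

theorem mem_of_irreducible_src (hfin : ∀ X Y : C, Module.Finite k (X ⟶ Y)) {X : C}
    (hX : Indecomposable X) {a : ℤ} {n : ℕ} {f : 𝒱.V a n ⟶ X} (hf : f ∈ rad k _ _)
    (hf2 : f ∉ radPow k 2 _ _) : 𝒱.Mem X := by
  have := fun X ↦ hfin X X
  have hs := not_isSplitMono_of_mem_rad (𝒱.indecomposable _ _).1 hf
  have key {Y : C} (hY : Indecomposable Y) {p : 𝒱.V a n ⟶ Y} (hp : p ∈ rad k _ _) {q : Y ⟶ X}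
      (hq : ¬ IsIso q) : p ≫ q ∈ radPow k 2 _ _ := by
    refine comp_mem_radPow_succ (n := 1) ?_ (mem_rad_of_not_isIso hY hX hq)
    rwa [radPow_one]
  cases n with
  | zero =>
    obtain ⟨w, rfl⟩ := 𝒱.extend_zero f hs
    by_cases hw : IsIso w
    · exact ⟨_, _, ⟨(asIso w).symm⟩⟩
    · exact (hf2 (key (𝒱.indecomposable _ _) (𝒱.ι_mem_rad k hfin _ _) hw)).elim
  | succ n =>
    obtain ⟨u, w, rfl⟩ := 𝒱.extend_succ rfl f hs
    by_cases hu : IsIso u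
    · exact ⟨_, _, ⟨(asIso u).symm⟩⟩
    by_cases hw : IsIso w
    · exact ⟨_, _, ⟨(asIso w).symm⟩⟩
    exact (hf2 (Submodule.add_mem _
      (key (𝒱.indecomposable _ _) (𝒱.ι_mem_rad k hfin _ _) hu)
      (key (𝒱.indecomposable _ _) (𝒱.π_mem_rad k hfin _ _) hw))).elim

theorem mem_iff_of_arLinked (hfin : ∀ X Y : C, Module.Finite k (X ⟶ Y)) {X Y : C}
    (h : ARLinked k X Y) : 𝒱.Mem X ↔ 𝒱.Mem Y := by
  obtain ⟨hX, hY, ⟨⟨e⟩⟩ | h⟩ := h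
  · exact ⟨fun ⟨a, n, ⟨e'⟩⟩ ↦ ⟨a, n, ⟨e.symm ≪≫ e'⟩⟩, fun ⟨a, n, ⟨e'⟩⟩ ↦ ⟨a, n, ⟨e ≪≫ e'⟩⟩⟩
  · have := hfin X Y
    obtain ⟨f, hf, hf2⟩ := (numArrows_ne_zero_iff X Y).1 h
    constructor
    · rintro ⟨a, n, ⟨e⟩⟩
      refine 𝒱.mem_of_irreducible_src hfin hY (comp_mem_rad' e.inv hf) fun h ↦ hf2 ?_
      rw [← e.hom_inv_id_assoc f]
      exact comp_radPow e.hom h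
    · rintro ⟨a, n, ⟨e⟩⟩
      refine 𝒱.mem_of_irreducible_tgt hfin hX (comp_mem_rad hf e.hom) fun h ↦ hf2 ?_
      have := radPow_comp h e.inv
      rwa [Category.assoc, e.hom_inv_id, Category.comp_id] at this

variable (k) in
theorem eqvGen_V (hfin : ∀ X Y : C, Module.Finite k (X ⟶ Y)) (a b : ℤ) (m n : ℕ) :
    Relation.EqvGen (ARLinked k) (𝒱.V a m) (𝒱.V b n) := by
  have h1 (a : ℤ) (n : ℕ) : Relation.EqvGen (ARLinked k) (𝒱.V a n) (𝒱.V a (n + 1)) := by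
    have := hfin (𝒱.V a n) (𝒱.V a (n + 1))
    exact .rel _ _ ⟨𝒱.indecomposable _ _, 𝒱.indecomposable _ _, .inr ((numArrows_ne_zero_iff _ _).2
      ⟨_, 𝒱.ι_mem_rad k hfin _ _, 𝒱.ι_notMem_radPow_two _ _⟩)⟩
  have h2 (a : ℤ) (n : ℕ) : Relation.EqvGen (ARLinked k) (𝒱.V a (n + 1)) (𝒱.V (a + 1) n) := by
    have := hfin (𝒱.V a (n + 1)) (𝒱.V (a + 1) n)
    exact .rel _ _ ⟨𝒱.indecomposable _ _, 𝒱.indecomposable _ _, .inr ((numArrows_ne_zero_iff _ _).2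
      ⟨𝒱.π rfl n, 𝒱.π_mem_rad k hfin _ _, 𝒱.π_notMem_radPow_two _ _⟩)⟩
  have h3 (a : ℤ) (n : ℕ) : Relation.EqvGen (ARLinked k) (𝒱.V a 0) (𝒱.V a n) := by
    induction n with
    | zero => exact .refl _
    | succ n ih => exact .trans _ _ _ ih (h1 a n)
  have h4 (a : ℤ) : Relation.EqvGen (ARLinked k) (𝒱.V 0 0) (𝒱.V a 0) := by
    induction a using Int.induction_on with
    | zero => exact .refl _
    | succ n ih => exact .trans _ _ _ ih (.trans _ _ _ (h1 _ 0) (h2 _ 0))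
    | pred n ih =>
      refine .trans _ _ _ ih (.symm _ _ ?_)
      have h := (h1 (-n - 1) 0).trans _ _ _ (h2 (-n - 1) 0)
      rwa [sub_add_cancel] at h
  exact .trans _ _ _ (.symm _ _ (.trans _ _ _ (h4 a) (h3 a m))) (.trans _ _ _ (h4 b) (h3 b n))

/-- The family is a component of the Auslander-Reiten quiver. -/
theorem eq_mem_of_isARComponent (hfin : ∀ X Y : C, Module.Finite k (X ⟶ Y)) {K : ObjectProperty C}
    (hK : IsARComponent k K) {a : ℤ} {n : ℕ} (h : K (𝒱.V a n)) (X : C) : K X ↔ 𝒱.Mem X := by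
  obtain ⟨X₀, hX₀, hK⟩ := hK
  have h0 := (hK _).1 h
  have key (Y Z : C) (h : Relation.EqvGen (ARLinked k) Y Z) : 𝒱.Mem Y ↔ 𝒱.Mem Z := by
    induction h with
    | rel _ _ h => exact 𝒱.mem_iff_of_arLinked hfin h
    | refl => rfl
    | symm _ _ _ h => exact h.symm
    | trans _ _ _ _ _ h h' => exact h.trans h'
  rw [hK]
  constructor
  · intro h
    exact (key _ _ (.trans _ _ _ (.symm _ _ h0) h)).1 ⟨a, n, ⟨Iso.refl _⟩⟩
  · rintro ⟨b, m, ⟨e⟩⟩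
    exact .trans _ _ _ h0 (.trans _ _ _ (𝒱.eqvGen_V k hfin a b n m) (.symm _ _ (.rel _ _
      ⟨indecomposable_of_iso e.symm (𝒱.indecomposable _ _), 𝒱.indecomposable _ _, .inl ⟨e⟩⟩)))

variable (k) in
/-- If there is a right almost split morphism to `V a n` with indecomposable source,
then `n = 0`. -/
theorem eq_zero_of_indecomposable_middle (hfin : ∀ X Y : C, Module.Finite k (X ⟶ Y)) {a : ℤ}
    {n : ℕ} {M : C} (hM : Indecomposable M) (g : M ⟶ 𝒱.V a n) (hg : ¬ IsSplitEpi g)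
    (h : ∀ (W : C) (f : W ⟶ 𝒱.V a n), ¬ IsSplitEpi f → ∃ l, l ≫ g = f) : n = 0 := by
  by_contra hn
  obtain ⟨n, rfl⟩ := Nat.exists_eq_succ_of_ne_zero hn
  have := fun X ↦ hfin X X
  have hgr : g ∈ rad k _ _ := mem_rad_of_not_isSplitEpi (𝒱.indecomposable _ _) hg
  -- Every irreducible morphism to `V a (n + 1)` factors through `g` by an isomorphism, so `M` would
  -- be isomorphic to both `V a n` and `V (a - 1) (n + 2)`.
  have key {W : C} (hW : Indecomposable W) (f : W ⟶ 𝒱.V a (n + 1)) (hf : f ∈ rad k _ _)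
      (hf2 : f ∉ radPow k 2 _ _) : Nonempty (W ≅ M) := by
    obtain ⟨l, rfl⟩ := h W f (not_isSplitEpi_of_mem_rad (𝒱.indecomposable _ _).1 hf)
    by_cases hl : IsIso l
    · exact ⟨asIso l⟩
    · refine (hf2 (comp_mem_radPow_succ (n := 1) ?_ hgr)).elim
      rw [radPow_one]
      exact mem_rad_of_not_isIso hW hM hl
  obtain ⟨e⟩ := key (𝒱.indecomposable _ _) (𝒱.ι a n) (𝒱.ι_mem_rad k hfin _ _)
    (𝒱.ι_notMem_radPow_two _ _)
  obtain ⟨e'⟩ := key (𝒱.indecomposable _ _) (𝒱.π (sub_add_cancel a 1) (n + 1))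
    (𝒱.π_mem_rad k hfin _ _) (𝒱.π_notMem_radPow_two _ _)
  have := 𝒱.length_eq (e ≪≫ e'.symm)
  lia

/-- All morphisms to `V a n` from members of the family of length at most `b` are killed
by `q`. -/
def Kills (b : ℕ) {a : ℤ} {n : ℕ} {Y : C} (q : 𝒱.V a n ⟶ Y) : Prop :=
  ∀ (c : ℤ) (m : ℕ) (g : 𝒱.V c m ⟶ 𝒱.V a n), m < b → g ≫ q = 0

variable {𝒱} in
-- A morphism followed by `π` kills the socle of its source, so it factors over a uniserial object
-- shorter by one, to which the hypothesis on `q` applies.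
theorem Kills.π_comp {b : ℕ} {a a' : ℤ} (h : a + 1 = a') {n : ℕ} {Y : C} {q : 𝒱.V a' n ⟶ Y}
    (hq : 𝒱.Kills b q) : 𝒱.Kills (b + 1) (𝒱.π h n ≫ q) := by
  intro c m g hm
  cases m with
  | zero => rw [← Category.assoc, 𝒱.comp_π_eq_zero, zero_comp]
  | succ m =>
    obtain ⟨g', hg'⟩ := 𝒱.exists_comp_π h n (c := c) rfl m g
    rw [← Category.assoc, hg', Category.assoc, hq _ _ g' (by lia), comp_zero]

-- Because the powers of the radical stabilize on the two Hom spaces concerned, peeling off an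
-- almost split map does not leave the infinite radical.
variable (k) in
theorem exists_of_mem_infRad_succ (hfin : ∀ X Y : C, Module.Finite k (X ⟶ Y)) {n : ℕ} {X : C}
    {a a' : ℤ} (h : a + 1 = a') {f : X ⟶ 𝒱.V a' (n + 1)} (hf : f ∈ infRad k X (𝒱.V a' (n + 1))) :
    ∃ u ∈ infRad k X _, ∃ w ∈ infRad k X _, f = u ≫ 𝒱.ι a' n + w ≫ 𝒱.π h (n + 1) := by
  have := hfin
  obtain ⟨N, hN⟩ := exists_radPow_le_infRad (k := k) X (𝒱.V a' n)
  obtain ⟨N', hN'⟩ := exists_radPow_le_infRad (k := k) X (𝒱.V a (n + 1 + 1))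
  obtain ⟨u, hu, w, hw, h⟩ := 𝒱.exists_of_mem_radPow_succ h
    ((Submodule.mem_iInf _).1 hf (max N N' + 1))
  exact ⟨u, hN _ (le_max_left _ _) hu, w, hN' _ (le_max_right _ _) hw, h⟩

variable (k) in
theorem exists_of_mem_infRad_zero (hfin : ∀ X Y : C, Module.Finite k (X ⟶ Y)) {X : C}
    {a a' : ℤ} (h : a + 1 = a') {f : X ⟶ 𝒱.V a' 0} (hf : f ∈ infRad k X (𝒱.V a' 0)) :
    ∃ w ∈ infRad k X _, f = w ≫ 𝒱.π h 0 := by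
  have := hfin
  obtain ⟨N, hN⟩ := exists_radPow_le_infRad (k := k) X (𝒱.V a 1)
  obtain ⟨w, hw, h⟩ := 𝒱.exists_of_mem_radPow_zero h ((Submodule.mem_iInf _).1 hf (N + 1))
  exact ⟨w, hN _ le_rfl hw, h⟩

/-- Peel off almost split maps repeatedly. The component through `ι` contributes nothing: `ι ≫ q` is
zero or lands in the maximal subobject of `V a n`, where the induction hypothesis on the target
applies. What remains runs through one more `π`, which raises the bound `b`. -/
theorem exists_kills (hfin : ∀ X Y : C, Module.Finite k (X ⟶ Y)) {X : C} {n : ℕ}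
    (ih : ∀ m < n, ∀ (a : ℤ), ∀ f ∈ infRad k X (𝒱.V a m), f = 0) {a : ℤ}
    {f : X ⟶ 𝒱.V a n} (hf : f ∈ infRad k X (𝒱.V a n)) (b : ℕ) :
    ∃ (a' : ℤ) (N : ℕ) (q : 𝒱.V a' N ⟶ 𝒱.V a n), 𝒱.Kills b q ∧
      ∃ v ∈ infRad k X (𝒱.V a' N), f = v ≫ q := by
  induction b with
  | zero => exact ⟨a, n, 𝟙 _, fun _ _ _ h ↦ (Nat.not_lt_zero _ h).elim, f, hf,
      (Category.comp_id f).symm⟩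
  | succ b hb =>
    obtain ⟨a', N, q, hq, v, hv, hfv⟩ := hb
    cases N with
    | zero =>
      obtain ⟨w, hw, hvw⟩ := 𝒱.exists_of_mem_infRad_zero k hfin (sub_add_cancel a' 1) hv
      exact ⟨_, _, 𝒱.π (sub_add_cancel a' 1) 0 ≫ q, hq.π_comp _, w, hw, by
        rw [hfv, hvw, Category.assoc]⟩
    | succ N =>
      obtain ⟨u, hu, w, hw, hvw⟩ := 𝒱.exists_of_mem_infRad_succ k hfin (sub_add_cancel a' 1) hv
      refine ⟨_, _, 𝒱.π (sub_add_cancel a' 1) (N + 1) ≫ q, hq.π_comp _, w, hw, ?_⟩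
      have h0 : u ≫ 𝒱.ι a' N ≫ q = 0 := by
        cases n with
        | zero => rw [𝒱.ι_comp_eq_zero, comp_zero]
        | succ n =>
          obtain ⟨q', hq'⟩ := 𝒱.exists_ι_comp q
          rw [hq', ← Category.assoc, ih n (Nat.lt_succ_self n) _ _ (infRad_comp hu q'), zero_comp]
      rw [hfv, hvw, Preadditive.add_comp, Category.assoc, h0, zero_add, Category.assoc]

/-- Choosing the bound `m + 1` makes `q` kill every morphism from a source of length index `m`, in
particular the other factor. -/
theorem infRad_eq_zero (hfin : ∀ X Y : C, Module.Finite k (X ⟶ Y)) {c : ℤ} {m : ℕ} (n : ℕ) :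
    ∀ (a : ℤ), ∀ f ∈ infRad k (𝒱.V c m) (𝒱.V a n), f = 0 := by
  induction n using Nat.strong_induction_on with
  | _ n ih =>
    intro a f hf
    obtain ⟨a', N, q, hq, v, -, rfl⟩ := 𝒱.exists_kills hfin ih hf (m + 1)
    exact hq _ _ v (Nat.lt_succ_self m)

/-- The component is generalized standard. -/
theorem isGeneralizedStandard (hfin : ∀ X Y : C, Module.Finite k (X ⟶ Y)) :
    IsGeneralizedStandard k 𝒱.Mem := by
  rintro X Y ⟨c, m, ⟨e⟩⟩ ⟨a, n, ⟨e'⟩⟩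
  refine (Submodule.eq_bot_iff _).2 fun f hf ↦ ?_
  have := 𝒱.infRad_eq_zero hfin _ _ _ (comp_infRad e.inv (infRad_comp hf e'.hom))
  rw [← cancel_epi e.inv, ← cancel_mono e'.hom, Category.assoc, this, comp_zero, zero_comp]

end MeshFamily

/-! ### Indecomposability along fully faithful functors. -/

section FullyFaithful

variable {C : Type*} [Category* C] [Preadditive C] [HasBinaryBiproducts C]
  {D : Type*} [Category* D] [Preadditive D] [HasBinaryBiproducts D]

/-- A decomposition of `F X` gives an idempotent, which lifts to an idempotent of `X` and is
therefore trivial. -/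
theorem indecomposable_map_of_full (F : C ⥤ D) [F.Full] [F.Faithful] [F.Additive]
    [HasTrivialIdempotents C] {X : C} (hX : Indecomposable X) : Indecomposable (F.obj X) := by
  refine ⟨not_isZero_map F hX.1, fun Y Z e ↦ ?_⟩
  obtain ⟨p, hp⟩ := F.map_surjective (e.hom ≫ biprod.fst ≫ biprod.inl ≫ e.inv)
  have hpp : p ≫ p = p := F.map_injective (by
    rw [F.map_comp, hp]; simp)
  rcases eq_zero_or_eq_one_of_idempotent hX p hpp with rfl | rfl
  · left
    rw [F.map_zero] at hp
    rw [IsZero.iff_id_eq_zero]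
    have : (biprod.inl : Y ⟶ Y ⊞ Z) ≫ e.inv ≫ (e.hom ≫ biprod.fst ≫ biprod.inl ≫ e.inv) ≫
      e.hom ≫ biprod.fst = 0 := by rw [← hp]; simp
    simpa using this
  · right
    rw [F.map_id] at hp
    rw [IsZero.iff_id_eq_zero]
    have : (biprod.inr : Z ⟶ Y ⊞ Z) ≫ e.inv ≫ (e.hom ≫ biprod.fst ≫ biprod.inl ≫ e.inv) ≫
      e.hom ≫ biprod.snd = 𝟙 Z := by rw [← hp]; simp
    simpa using this.symm

theorem indecomposable_of_map (F : C ⥤ D) [F.Faithful] [F.Additive]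
    {X : C} (hX : Indecomposable (F.obj X)) : Indecomposable X := by
  have : PreservesBinaryBiproducts F := preservesBinaryBiproducts_of_preservesBiproducts F
  refine ⟨fun h ↦ hX.1 (F.map_isZero h), fun Y Z e ↦ ?_⟩
  by_contra! hYZ
  rcases hX.2 (F.obj Y) (F.obj Z) (F.mapIso e ≪≫ F.mapBiprod Y Z) with h | h
  · exact not_isZero_map F hYZ.1 h
  · exact not_isZero_map F hYZ.2 h

end FullyFaithful

/-! ### The uniserial objects of the heart as a mesh family. -/

section HeartFamily

variable {k : Type t} [Field k] [IsAlgClosed k] {D : Type u} [Category.{v} D] [Preadditive D]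
  [Linear k D] [HasZeroObject D] [HasShift D ℤ] [∀ n : ℤ, (shiftFunctor D n).Additive]
  [∀ n : ℤ, (shiftFunctor D n).Linear k] [Pretriangulated D] [IsTriangulated D]
  {S : SerreFunctor k D} {T : TStructure D} {hT : IsTauInvariant S T}
  {hfin : ∀ X Y : D, Module.Finite k (X ⟶ Y)}

/-- The uniserial objects of the heart. -/
noncomputable def heartFamily (𝒮 : (heartDuality hT hfin).SimpleSystem) : MeshFamily D where
  V a n := T.heart.ι.obj (𝒮.V a n)
  indecomposable a n := indecomposable_map_of_full T.heart.ι (𝒮.indecomposable_V a n)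
  length_eq e := 𝒮.length_eq_of_iso (T.heart.ι.preimageIso e)
  ι a n := T.heart.ι.map (𝒮.ι a n)
  π h n := T.heart.ι.map (𝒮.π _ h n)
  lift_zero h Z f hf := by
    have := (𝒮.ses_soc_π _ h 0).epi
    obtain ⟨l, hl⟩ := exists_lift_of_heart hT (𝒮.π _ h 0)
      (fun _ f hf ↦ 𝒮.exists_lift_π_zero h f hf) f hf
    exact ⟨l, hl.symm⟩
  lift_succ {a a'} h {n Z} f hf := by
    have := (𝒮.ses_soc_π _ h (n + 1)).epi
    have := 𝒮.epi_desc h n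
    obtain ⟨l, hl⟩ := exists_lift_of_heart hT (biprod.desc (𝒮.ι a' n) (𝒮.π a h (n + 1)))
      (fun _ f hf ↦ 𝒮.exists_lift_desc h f hf) f hf
    refine ⟨l ≫ T.heart.ι.map biprod.fst, l ≫ T.heart.ι.map biprod.snd, ?_⟩
    rw [← hl, biprod.desc_eq, Functor.map_add, Preadditive.comp_add, Functor.map_comp,
      Functor.map_comp, Category.assoc, Category.assoc]
  extend_zero {a Z} f hf := by
    have := (𝒮.ses_ι_top a 0 rfl).mono
    obtain ⟨l, hl⟩ := exists_extend_of_heart hT (𝒮.ι a 0)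
      (fun _ f hf ↦ 𝒮.exists_extend_ι_zero f hf) f hf
    exact ⟨l, hl.symm⟩
  extend_succ {a a'} h {n Z} f hf := by
    subst h
    have := (𝒮.ses_ι_top a (n + 1) rfl).mono
    have := 𝒮.mono_lift a n
    obtain ⟨l, hl⟩ := exists_extend_of_heart hT (biprod.lift (𝒮.ι a (n + 1)) (𝒮.π a rfl n))
      (fun _ f hf ↦ 𝒮.exists_extend_lift a f hf) f hf
    refine ⟨T.heart.ι.map biprod.inl ≫ l, T.heart.ι.map biprod.inr ≫ l, ?_⟩
    rw [← hl, biprod.lift_eq, Functor.map_add, Preadditive.add_comp, Functor.map_comp,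
      Functor.map_comp, Category.assoc, Category.assoc]
  comp_π_eq_zero {a a'} h n c g := by
    obtain ⟨g, rfl⟩ := exists_heart_map_eq (X := 𝒮.V c 0) (Y := 𝒮.V a (n + 1)) g
    have h0 : g ≫ 𝒮.π a h n = 0 := by
      obtain ⟨g', hg'⟩ := 𝒮.eq_comp_soc a (n + 1) (j := c) g
      rw [← hg']
      exact (Category.assoc _ _ _).trans ((congrArg (g' ≫ ·) (𝒮.soc_comp_π a h n)).trans comp_zero)
    rw [← Functor.map_comp, h0, Functor.map_zero]
  exists_comp_π {a a'} h n c c' h' m g := by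
    obtain ⟨g, rfl⟩ := exists_heart_map_eq (X := 𝒮.V c (m + 1)) (Y := 𝒮.V a (n + 1)) g
    obtain ⟨s, hs⟩ := 𝒮.eq_comp_soc a (n + 1) (𝒮.soc c (m + 1) ≫ g)
    obtain ⟨g', hg'⟩ := (𝒮.ses_soc_π c h' m).desc (g ≫ 𝒮.π a h n) (by
      rw [← Category.assoc, ← hs, Category.assoc, 𝒮.soc_comp_π, comp_zero])
    exact ⟨T.heart.ι.map g', by rw [← Functor.map_comp, ← Functor.map_comp, hg']⟩
  ι_comp_eq_zero {a b n} q := by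
    obtain ⟨q, rfl⟩ := exists_heart_map_eq (X := 𝒮.V a (n + 1)) (Y := 𝒮.V b 0) q
    have h0 : 𝒮.ι a n ≫ q = 0 := 𝒮.ι_comp_eq_zero a n (j := b) q
    rw [← Functor.map_comp, h0, Functor.map_zero]
  exists_ι_comp {a b n m} q := by
    obtain ⟨q, rfl⟩ := exists_heart_map_eq (X := 𝒮.V a (n + 1)) (Y := 𝒮.V b (m + 1)) q
    obtain ⟨q', hq'⟩ := (𝒮.ses_ι_top b m rfl).lift (𝒮.ι a n ≫ q) (by
      rw [Category.assoc, 𝒮.ι_comp_eq_zero])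
    exact ⟨T.heart.ι.map q', by rw [← Functor.map_comp, ← Functor.map_comp, hq']⟩
  π_zero_ne_zero {a a'} h h0 := by
    have h0 : 𝒮.π a h 0 = 0 := T.heart.ι.map_injective (h0.trans (T.heart.ι.map_zero _ _).symm)
    have := (𝒮.ses_soc_π _ h 0).epi
    refine 𝒮.not_isZero_V a' 0 ((IsZero.iff_id_eq_zero _).2 ((cancel_epi (𝒮.π a h 0)).1 ?_))
    rw [h0, zero_comp, zero_comp]
  ι_ne {a a'} h n w hw := by
    obtain ⟨w, rfl⟩ := exists_heart_map_eq (X := 𝒮.V a' n) (Y := 𝒮.V a (n + 2)) w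
    have hw : 𝒮.ι a' n = w ≫ 𝒮.π a h (n + 1) :=
      T.heart.ι.map_injective (hw.trans (Functor.map_comp _ _ _).symm)
    obtain ⟨s, hs⟩ := 𝒮.eq_comp_soc a (n + 2) (𝒮.soc a' n ≫ w)
    apply 𝒮.soc_ne_zero a' (n + 1)
    rw [𝒮.soc_succ, hw, ← Category.assoc, ← hs, Category.assoc, 𝒮.soc_comp_π, comp_zero]
  π_ne {a a'} h n w hw := by
    obtain ⟨w, rfl⟩ := exists_heart_map_eq (X := 𝒮.V a (n + 2)) (Y := 𝒮.V a' n) w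
    have hw : 𝒮.π a h (n + 1) = w ≫ 𝒮.ι a' n :=
      T.heart.ι.map_injective (hw.trans (Functor.map_comp _ _ _).symm)
    have := (𝒮.ses_soc_π _ h (n + 1)).epi
    apply 𝒮.top_ne_zero a' (n + 1) rfl
    rw [← cancel_epi (𝒮.π a h (n + 1)), hw, Category.assoc, 𝒮.ι_comp_eq_zero, comp_zero, comp_zero]

theorem heartFamily_mem_iff (𝒮 : (heartDuality hT hfin).SimpleSystem)
    (X : T.heart.FullSubcategory) : (heartFamily 𝒮).Mem (T.heart.ι.obj X) ↔ 𝒮.IsUniserial X :=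
  ⟨fun ⟨a, n, ⟨e⟩⟩ ↦ ⟨a, n, ⟨T.heart.ι.preimageIso e⟩⟩,
    fun ⟨a, n, ⟨e⟩⟩ ↦ ⟨a, n, ⟨T.heart.ι.mapIso e⟩⟩⟩

end HeartFamily

/-! ### Conversion between indexed paths and reachability. -/

section PathsOfSteps

variable {C : Type u} [Category.{v} C] [Preadditive C] [HasBinaryBiproducts C]

theorem IsPath.snoc {n : ℕ} {p : Fin (n + 1) → C} (hp : IsPath n p) {W : C}
    (h : HomStep (p (Fin.last n)) W) : IsPath (n + 1) (Fin.snoc (α := fun _ ↦ C) p W) := by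
  constructor
  · intro i
    induction i using Fin.lastCases with
    | last => rw [Fin.snoc_last]; exact h.2.1
    | cast i => rw [Fin.snoc_castSucc]; exact hp.1 i
  · intro i
    rw [Fin.snoc_castSucc]
    induction i using Fin.lastCases with
    | last => rw [Fin.succ_last, Fin.snoc_last]; exact h.2.2
    | cast i => rw [Fin.succ_castSucc, Fin.snoc_castSucc]; exact hp.2 i

theorem Reaches.exists_isPath {X Y : C} (hX : Indecomposable X) (h : Reaches X Y) :
    ∃ (n : ℕ) (p : Fin (n + 1) → C), IsPath n p ∧ p 0 = X ∧ p (Fin.last n) = Y := by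
  induction h with
  | refl => exact ⟨0, fun _ ↦ X, ⟨fun _ ↦ hX, fun i ↦ i.elim0⟩, rfl, rfl⟩
  | @tail Y W _ h ih =>
    obtain ⟨n, p, hp, h0, rfl⟩ := ih
    refine ⟨n + 1, _, hp.snoc h, ?_, Fin.snoc_last _ _⟩
    rw [← h0, ← Fin.castSucc_zero, Fin.snoc_castSucc]

theorem IsConvex.of_reaches {K : ObjectProperty C} (hK : IsConvex K) {X Y Z : C}
    (hX : Indecomposable X) (hKX : K X) (hKZ : K Z) (hXY : Reaches X Y) (hYZ : Reaches Y Z) :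
    K Y := by
  obtain ⟨n, p, hp, h0, h1, i, rfl⟩ : ∃ (n : ℕ) (p : Fin (n + 1) → C), IsPath n p ∧ p 0 = X ∧
      p (Fin.last n) = Z ∧ ∃ i, p i = Y := by
    clear hKZ
    induction hYZ with
    | refl =>
      obtain ⟨n, p, hp, h0, h1⟩ := hXY.exists_isPath hX
      exact ⟨n, p, hp, h0, h1, _, h1⟩
    | @tail Z W _ h ih =>
      obtain ⟨n, p, hp, h0, rfl, i, hi⟩ := ih
      refine ⟨n + 1, _, hp.snoc h, ?_, Fin.snoc_last _ _, i.castSucc, ?_⟩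
      · rw [← h0, ← Fin.castSucc_zero, Fin.snoc_castSucc]
      · rw [← hi, Fin.snoc_castSucc]
  exact hK n p hp (h0 ▸ hKX) (h1 ▸ hKZ) i

theorem IsPath.reaches_zero {n : ℕ} {p : Fin (n + 1) → C} (hp : IsPath n p) (i : Fin (n + 1)) :
    Reaches (p 0) (p i) := by
  induction i using Fin.induction with
  | zero => exact .refl
  | succ i ih => exact ih.tail ⟨hp.1 _, hp.1 _, hp.2 i⟩

theorem IsPath.reaches_last {n : ℕ} {p : Fin (n + 1) → C} (hp : IsPath n p) (i : Fin (n + 1)) :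
    Reaches (p i) (p (Fin.last n)) := by
  induction i using Fin.reverseInduction with
  | last => exact .refl
  | cast i ih => exact .head ⟨hp.1 _, hp.1 _, hp.2 i⟩ ih

end PathsOfSteps

/-! ### Closure properties of Auslander-Reiten components. -/

section Components

variable {k : Type t} [Field k] {C : Type u} [Category.{v} C] [Preadditive C] [Linear k C]
  [HasBinaryBiproducts C] {K : ObjectProperty C}

theorem IsARComponent.indecomposable (hK : IsARComponent k K) {X : C} (hX : K X) :
    Indecomposable X := by
  obtain ⟨X₀, hX₀, hK⟩ := hK
  have key (Y Z : C) (h : Relation.EqvGen (ARLinked k) Y Z) :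
      Indecomposable Y ↔ Indecomposable Z := by
    induction h with
    | rel _ _ h => exact ⟨fun _ ↦ h.2.1, fun _ ↦ h.1⟩
    | refl => rfl
    | symm _ _ _ h => exact h.symm
    | trans _ _ _ _ _ h h' => exact h.trans h'
  exact (key _ _ ((hK X).1 hX)).1 hX₀

theorem IsARComponent.of_iso (hK : IsARComponent k K) {X Y : C} (e : X ≅ Y) (hX : K X) : K Y := by
  have hXi := hK.indecomposable hX
  obtain ⟨X₀, hX₀, hK⟩ := hK
  exact (hK Y).2 (.trans _ _ _ ((hK X).1 hX)
    (.rel _ _ ⟨hXi, indecomposable_of_iso e hXi, .inl ⟨e⟩⟩))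

end Components

/-! ### Connectedness, invariance and periodicity of tubes. -/

section TubeComponent

variable {k : Type t} [Field k] [IsAlgClosed k] {D : Type u} [Category.{v} D] [Preadditive D]
  [Linear k D] [HasZeroObject D] [HasShift D ℤ] [∀ n : ℤ, (shiftFunctor D n).Additive]
  [∀ n : ℤ, (shiftFunctor D n).Linear k] [Pretriangulated D]
  {S : SerreFunctor k D} {K : ObjectProperty D} {r : ℕ}

/-- Descend from `x` to the mouth of the tube, walk around the mouth by going up one level and down
again, and climb to `y`. Finiteness of the rank lets the walk reach every position. -/
theorem reaches_of_tubeArrows (hr : 0 < r) {V : ZMod r × ℕ → D}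
    (hV : ∀ x y, tubeArrows r x y ≠ 0 → HomStep (V x) (V y)) (x y : ZMod r × ℕ) :
    Reaches (V x) (V y) := by
  have : NeZero r := ⟨hr.ne'⟩
  have h1 (i : ZMod r) (l : ℕ) : HomStep (V (i, l)) (V (i, l + 1)) :=
    hV _ _ (by simp [tubeArrows])
  have h2 (i : ZMod r) (l : ℕ) : HomStep (V (i, l + 1)) (V (i + 1, l)) :=
    hV _ _ (by simp [tubeArrows])
  have h3 (i : ZMod r) (l : ℕ) : Reaches (V (i, 0)) (V (i, l)) := by
    induction l with
    | zero => exact .refl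
    | succ l ih => exact ih.tail (h1 i l)
  have h4 (l : ℕ) : ∀ i : ZMod r, ∃ j, Reaches (V (i, l)) (V (j, 0)) := by
    induction l with
    | zero => exact fun i ↦ ⟨i, .refl⟩
    | succ l ih =>
      intro i
      obtain ⟨j, hj⟩ := ih (i + 1)
      exact ⟨j, .head (h2 i l) hj⟩
  have h5 (i : ZMod r) (n : ℕ) : Reaches (V (i, 0)) (V (i + n, 0)) := by
    induction n with
    | zero => rw [Nat.cast_zero, add_zero]; exact .refl
    | succ n ih =>
      rw [Nat.cast_succ, ← add_assoc]
      exact (ih.tail (h1 _ 0)).tail (h2 _ 0)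
  obtain ⟨i, l⟩ := x
  obtain ⟨j, m⟩ := y
  obtain ⟨i', hi'⟩ := h4 l i
  have h6 := h5 i' (j - i').val
  rw [ZMod.natCast_zmod_val, add_sub_cancel] at h6
  exact hi'.trans (h6.trans (h3 j m))

theorem IsTubeOfRank.isStronglyConnected (hK : IsTubeOfRank S K r) : IsStronglyConnected K where
  indecomposable hX := hK.2.1.indecomposable hX
  of_iso e hX := hK.2.1.of_iso e hX
  reaches {X Y} hX hY := by
    have hXi := hK.2.1.indecomposable hX
    obtain ⟨hr, hK, V, hKV, hV, -, -, harr⟩ := hK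
    obtain ⟨x, ⟨e⟩⟩ := hV X hX
    obtain ⟨y, ⟨e'⟩⟩ := hV Y hY
    have h := reaches_of_tubeArrows hr (V := V) (fun x y hxy ↦
      ⟨hK.indecomposable (hKV x), hK.indecomposable (hKV y),
        exists_ne_zero_of_numArrows_ne_zero (k := k) (by rwa [harr])⟩) x y
    exact .head (.of_iso e hXi) (h.tail (.of_iso e'.symm (hK.indecomposable (hKV y))))

theorem IsTubeOfRank.isTauStable (hK : IsTubeOfRank S K r) : IsTauStable S K := by
  obtain ⟨hr, hK, V, hKV, hV, -, hτ, -⟩ := hK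
  intro X
  constructor
  · intro hX
    obtain ⟨⟨i, l⟩, ⟨e⟩⟩ := hV _ hX
    obtain ⟨e'⟩ := hτ (i + 1, l)
    have h1 : tubeTranslation r (i + 1, l) = (i, l) := by simp [tubeTranslation]
    rw [h1] at e'
    exact hK.of_iso (S.tauFunctor.preimageIso (e ≪≫ e'.symm)).symm (hKV (i + 1, l))
  · intro hX
    obtain ⟨x, ⟨e⟩⟩ := hV _ hX
    obtain ⟨e'⟩ := hτ x
    exact hK.of_iso ((S.tauFunctor.mapIso e) ≪≫ e').symm (hKV _)

variable [IsTriangulated D] {T : TStructure D}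

theorem IsTubeOfRank.exists_periodic (hK : IsTubeOfRank S K r) (hT : IsTauInvariant S T)
    (hfin : ∀ X Y : D, Module.Finite k (X ⟶ Y)) (hKT : K ≤ T.heart) :
    ∃ E : T.heart.FullSubcategory, K E.obj ∧ (heartDuality hT hfin).Periodic r E := by
  obtain ⟨hr, hK, V, hKV, -, -, hτ, -⟩ := hK
  let E : T.heart.FullSubcategory := ⟨V (0, 0), hKT _ (hKV _)⟩
  have key (n : ℕ) : Nonempty (T.heart.ι.obj (((heartDuality hT hfin).iter n).obj E) ≅
      V (-(n : ZMod r), 0)) := by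
    induction n with
    | zero => rw [Nat.cast_zero, neg_zero]; exact ⟨Iso.refl _⟩
    | succ n ih =>
      obtain ⟨e⟩ := ih
      obtain ⟨e'⟩ := hτ (-(n : ZMod r), 0)
      have h1 : tubeTranslation r (-(n : ZMod r), 0) = (-((n + 1 : ℕ) : ZMod r), 0) := by
        simp only [tubeTranslation, Nat.cast_succ]
        congr 1
        ring
      rw [h1] at e'
      exact ⟨S.tauFunctor.mapIso e ≪≫ e'⟩
  refine ⟨E, hKV _, hr, ?_⟩
  obtain ⟨e⟩ := key r
  rw [ZMod.natCast_self, neg_zero] at e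
  exact ⟨T.heart.ι.preimageIso e⟩

end TubeComponent

/-! ### Simplicity of the mouth and assembly of the theorem. -/

section TubeHeart

variable {k : Type t} [Field k] [IsAlgClosed k] {D : Type u} [Category.{v} D] [Preadditive D]
  [Linear k D] [HasZeroObject D] [HasShift D ℤ] [∀ n : ℤ, (shiftFunctor D n).Additive]
  [∀ n : ℤ, (shiftFunctor D n).Linear k] [Pretriangulated D] [IsTriangulated D]
  {S : SerreFunctor k D} {K : ObjectProperty D} {r : ℕ} {T : TStructure D}

/-- A brick of the system is simple if all indecomposable objects with a nonzero morphism to it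
are uniserial. -/
theorem ARDuality.SimpleSystem.simple {C : Type u} [Category.{v} C] [Abelian C] [Linear k C]
    {T : ARDuality k C} (𝒮 : T.SimpleSystem) (a : ℤ)
    (h : ∀ (Y : C) (f : Y ⟶ 𝒮.S a), Indecomposable Y → f ≠ 0 → 𝒮.IsUniserial Y) :
    Simple (𝒮.S a) where
  mono_isIso_iff_nonzero {Y} f _ := by
    constructor
    · rintro _ rfl
      refine 𝒮.not_isZero a ((IsZero.iff_id_eq_zero _).2 ?_)
      rw [← cancel_epi (0 : Y ⟶ 𝒮.S a), zero_comp, zero_comp]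
    · intro hf
      -- Some indecomposable summand of the subobject maps nontrivially to the brick. It is
      -- uniserial and this map is a monomorphism, so it has length one and is an isomorphism; hence
      -- `f` is an epimorphism.
      obtain ⟨Z, i, p, hZ, hip, hif⟩ :=
        exists_indecomposable_summand_src k (fun X ↦ T.finite X X) Y f hf
      have : IsSplitMono i := ⟨⟨p, hip⟩⟩
      obtain ⟨b, m, ⟨e⟩⟩ := h Z (i ≫ f) hZ hif
      have hg : e.inv ≫ i ≫ f ≠ 0 := fun h ↦ hif ((cancel_epi e.inv).1 (h.trans comp_zero.symm))
      have : IsIso (e.inv ≫ i ≫ f) := by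
        cases m with
        | zero => exact 𝒮.isIso (a := b) (b := a) _ hg
        | succ m =>
          have h0 : 𝒮.ι b m = 0 := (cancel_mono (e.inv ≫ i ≫ f)).1
            ((𝒮.ι_comp_eq_zero b m _).trans zero_comp.symm)
          exact (𝒮.soc_ne_zero b (m + 1) (by rw [𝒮.soc_succ, h0, comp_zero])).elim
      have : Epi f := epi_of_epi_fac (f := e.inv ≫ i) (h := e.inv ≫ i ≫ f) (Category.assoc _ _ _)
      exact isIso_of_mono_of_epi f

/-- The degree argument keeps every path between objects of `K` in the heart, so convexity may be
tested there. -/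
theorem isConvex_of_heart (hS : IsReachabilityTStructure K T) (hK : IsStronglyConnected K)
    {deg : D → ℤ} (hdeg : IsDegree deg) (L : ObjectProperty T.heart.FullSubcategory)
    (hL : IsConvex L) (hKL : ∀ X : T.heart.FullSubcategory, K X.obj ↔ L X) : IsConvex K := by
  intro n X hX h0 hn i
  have hH (i) : T.heart (X i) :=
    hS.heart_of_path hK hdeg h0 hn (hX.reaches_zero i) (hX.reaches_last i)
  refine (hKL ⟨X i, hH i⟩).2 (hL n (fun i ↦ ⟨X i, hH i⟩) ⟨fun i ↦ ?_, fun i ↦ ?_⟩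
    ((hKL _).1 h0) ((hKL _).1 hn) i)
  · exact indecomposable_of_map T.heart.ι (hX.1 i)
  · obtain ⟨f, hf⟩ := hX.2 i
    exact ⟨ObjectProperty.homMk f, fun h ↦ hf (congrArg T.heart.ι.map h)⟩

theorem IsTubeOfRank.isGeneralizedStandard_and_isConvex_and_exists_tStructure [HasTrivialIdempotents D] (hK : IsTubeOfRank S K r)
    (hfin : ∀ X Y : D, Module.Finite k (X ⟶ Y)) {deg : D → ℤ} (hdeg : IsDegree deg) :
    IsGeneralizedStandard k K ∧ IsConvex K ∧
    ∃ T : TStructure D, IsTauInvariant S T ∧ IsHereditary T.heart.FullSubcategory ∧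
      ∃ hKT : K ≤ T.heart, ∀ (X : D) (hX : K X),
        IsPeripheral S X → Simple (⟨X, hKT X hX⟩ : T.heart.FullSubcategory) := by
  have hc := hK.isStronglyConnected
  obtain ⟨T, hS⟩ := exists_tStructure S hfin hc fun X ↦ (hK.isTauStable X).2
  have hT := hS.isTauInvariant hc hK.isTauStable
  have hKT := hS.le_heart hc hdeg
  obtain ⟨E, hE, hEr⟩ := hK.exists_periodic hT hfin hKT
  obtain ⟨𝒮, hs, a, n, ⟨e⟩⟩ := ARDuality.exists_simpleSystem
    (indecomposable_of_map T.heart.ι (X := E) (hc.indecomposable hE)) hEr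
  have hmem := (heartFamily 𝒮).eq_mem_of_isARComponent hfin hK.2.1 (a := a) (n := n)
    (hc.of_iso (T.heart.ι.mapIso e) hE)
  -- The uniserial objects form a component that meets `K` in `E`, so they are `K`. No relation
  -- between the rank of the tube and the period of the bricks has to be established.
  obtain rfl : K = (heartFamily 𝒮).Mem := funext fun X ↦ propext (hmem X)
  have hconv : IsConvex (heartFamily 𝒮).Mem := isConvex_of_heart hS hc hdeg 𝒮.IsUniserial
    (𝒮.isConvex_isUniserial hs) (heartFamily_mem_iff 𝒮)
  refine ⟨(heartFamily 𝒮).isGeneralizedStandard hfin, hconv, T, hT, isHereditary_heart hT, hKT,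
    fun X hX hp ↦ ?_⟩
  obtain ⟨M, f, g, h, ⟨hARdist, -, hARi, hARne, hAR⟩, hM⟩ := hp
  replace hAR (W : D) (q : W ⟶ X) (hq : ¬ IsSplitEpi q) : ∃ l, l ≫ g = q := hAR W q hq
  obtain ⟨b, m, ⟨φ⟩⟩ := id hX
  have hm := (heartFamily 𝒮).eq_zero_of_indecomposable_middle k hfin (a := b) (n := m) hM
    (g ≫ φ.hom) (fun hs ↦ hARne ?_) (fun W f' hf' ↦ ?_)
  · subst hm
    let e' : (⟨X, hKT X hX⟩ : T.heart.FullSubcategory) ≅ 𝒮.S b := T.heart.ι.preimageIso φ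
    -- An indecomposable of the heart is reachable from `K`. With a nonzero morphism to `S b` it
    -- lies on a path between objects of `K`, hence is uniserial by convexity.
    have := 𝒮.simple b fun Y q hY hq ↦ by
      have hYi := indecomposable_map_of_full T.heart.ι hY
      have hYr : ReachableFrom (heartFamily 𝒮).Mem (T.heart.ι.obj Y) :=
        (reachableAisle_iff hYi).1 ((hS.isLE_iff _).1 ((T.mem_heart_iff _).1 Y.property).1)
      obtain ⟨X', hX', hXY⟩ := hYr
      refine (heartFamily_mem_iff 𝒮 Y).1 (hconv.of_reaches (hc.indecomposable hX') hX'
        (Z := T.heart.ι.obj (𝒮.S b)) ⟨b, 0, ⟨Iso.refl _⟩⟩ hXY (.single ⟨hYi, ?_,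
          T.heart.ι.map q, fun h ↦ hq (T.heart.ι.map_injective (h.trans
            (T.heart.ι.map_zero _ _).symm))⟩))
      exact (heartFamily 𝒮).indecomposable b 0
    exact Simple.of_iso e'
  · have h1 : g ≫ h = 0 := comp_distTriang_mor_zero₂₃ _ hARdist
    have h2 : φ.hom ≫ section_ (g ≫ φ.hom) ≫ g = 𝟙 X := by
      rw [← cancel_mono φ.hom, Category.assoc, Category.assoc, IsSplitEpi.id, Category.comp_id,
        Category.id_comp]
    change h = 0
    rw [← Category.id_comp h, ← h2, Category.assoc, Category.assoc, h1, comp_zero, comp_zero]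
  · obtain ⟨l, hl⟩ := hAR W (f' ≫ φ.inv) fun hs ↦ hf' ⟨⟨φ.inv ≫ section_ (f' ≫ φ.inv), by
      rw [← cancel_mono φ.inv, Category.assoc, Category.assoc, IsSplitEpi.id, Category.comp_id,
        Category.id_comp]⟩⟩
    exact ⟨l, by rw [← Category.assoc, hl, Category.assoc, φ.inv_hom_id, Category.comp_id]⟩

end TubeHeart

end Tubes

/-- The bounded derived category enters only through its Hom-finiteness, the trivial idempotents of
its indecomposables and the degree, all derived from the standard t-structure. -/
theorem theorem4p2 {k : Type t} [Field k] [IsAlgClosed k]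
    {A : Type u} [Category.{v} A] [Abelian A] [Linear k A] [HasDerivedCategory.{w} A]
    (hfin : Tubes.IsExtFinite k A) (hher : Tubes.IsHereditary A)
    (S : Tubes.SerreFunctor k (DerivedCategory.Bounded A))
    (K : ObjectProperty (DerivedCategory.Bounded A)) (hK : Tubes.IsTube S K) :
    Tubes.IsGeneralizedStandard k K ∧
    Tubes.IsConvex K ∧
    ∃ T : TStructure (DerivedCategory.Bounded A),
      Tubes.IsTauInvariant S T ∧
      Tubes.IsHereditary T.heart.FullSubcategory ∧
      ∃ hKT : K ≤ T.heart, ∀ (X : DerivedCategory.Bounded A) (hX : K X),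
        Tubes.IsPeripheral S X → Simple (⟨X, hKT X hX⟩ : T.heart.FullSubcategory) := by
  have ht := Tubes.isHereditaryTStructure_onBounded k hher
  have := ht.hasTrivialIdempotents
  obtain ⟨deg, hdeg⟩ := ht.exists_isDegree
  obtain ⟨r, hr⟩ := hK
  exact hr.isGeneralizedStandard_and_isConvex_and_exists_tStructure (Tubes.finite_hom_bounded hher hfin) hdeg
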